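/- Let $M$ be a smooth compact Riemannian manifold with boundary $X$, and let $\Gamma$ be a finitely generated group of polynomial growth consisting of isometries of $M$ (which preserve $X$). Denote by $|\gamma|$ the word length on $\Gamma$ and by $\overline\Gamma$ the closure of $\Gamma$ in the compact Lie group of isometries of $M$. An isometry $\gamma$ acts on $T^*M$ and on $T^*X$ by the codifferential $\partial\gamma=((d\gamma)^t)^{-1}$; for brevity, $\gamma^*$ denotes the pullback of forms under $\partial\gamma$, and $\gamma(\omega)=(\gamma^{-1})^*\omega$. The fixed point submanifolds of $\partial\gamma$ in $T^*M$ and $T^*X$ are identified with the cotangent bundles $T^*M^\gamma$ and $T^*X^\gamma$ of the fixed point sets $M^\gamma$ and $X^\gamma$. Let $\Omega(T^*M)$ be the graded algebra of smooth complex-valued compactly supported forms on $T^*M$. The smooth crossed product $\Omega(T^*M)\rtimes\Gamma$ consists of the families $\omega=\{\omega(\gamma)\}_{\gamma\in\Gamma}$ of forms, supported in a common compact set, all of whose derivatives are $O((1+|\gamma|)^{-N})$ uniformly on compact sets for every $N$; its product is $(\omega_1\wedge\omega_2)(\gamma)=\sum_{\gamma_1\gamma_2=\gamma}\omega_1(\gamma_1)\wedge\gamma_1(\omega_2(\gamma_2))$.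 Let $F\varphi(\xi)=\int e^{-ix\xi}\varphi(x)\,dx$, let $H_\pm=F(\mathcal S(\overline{\mathbb R}_\pm))$ with the topology of $\mathcal S(\overline{\mathbb R}_\pm)$, let $\Pi_+:H_+\oplus H_-\to H_+$ be the projection, and let $\Pi'u=\lim_{x\to0+}(F^{-1}u)(x)$ for $u\in H_+\oplus H_-$. A boundary symbol is an operator $$\begin{pmatrix}\Pi_+a+\Pi'_\eta g & c\\ \Pi'_\xi b& q\end{pmatrix}:\overline H_+\oplus\mathbb C\to\overline H_+\oplus\mathbb C,\qquad a\in\mathbb C\oplus H_+\oplus H_-,\ g\in H_+\widehat\otimes H_-,\ c\in H_+,\ b\in H_-,\ q\in\mathbb C,$$ (with $\overline H_+$ the closure of $H_+$ in $L^2(\mathbb R)$), its regularized trace is $\operatorname{tr}'=\Pi'_\eta g(\eta,\eta)+q$, and $\widetilde\Sigma_X$ is the algebra of smooth families of boundary symbols parametrized by $T^*X$. Let $\widetilde\Sigma_X\otimes\Omega(T^*X)$ be the compactly supported smooth forms on $T^*X$ with boundary symbols as coefficients, with $d$ the exterior differential applied to the coefficients, and let $(\widetilde\Sigma_X\otimes\Omega(T^*X))\rtimes\Gamma$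 be the smooth crossed product, i.e. the families indexed by $\Gamma$ that are supported in a common compact set and decay rapidly in the Fréchet topologies above. Put $\operatorname{tr}_X(\sum_I\omega_I\,dt^I)=\sum_I\operatorname{tr}'(\omega_I)\,dt^I$. Let $\gamma\in\Gamma$, let $\langle\gamma\rangle$ be its conjugacy class in $\Gamma$, let $C^\gamma\subset\overline\Gamma$ be its centralizer with a Haar measure $dh$, and for $\gamma'\in\langle\gamma\rangle$ choose $z=z(\gamma,\gamma')\in\overline\Gamma$ with $\gamma'=z\gamma z^{-1}$. Define $$\tau^\gamma(\omega)=\sum_{\gamma'\in\langle\gamma\rangle}\int_{C^\gamma}h^*\bigl(z^*\omega(\gamma')\bigr)\big|_{T^*M^\gamma}\,dh,\qquad \tau^\gamma_X(\omega)=\sum_{\gamma'\in\langle\gamma\rangle}\int_{C^\gamma}\operatorname{tr}_X\Bigl(h^*\bigl(z^*\omega(\gamma')\bigr)\big|_{T^*X^\gamma}\Bigr)\,dh$$ for $\omega\in\Omega(T^*M)\rtimes\Gamma$ and $\omega\in(\widetilde\Sigma_X\otimes\Omega(T^*X))\rtimes\Gamma$, respectively. These integrals and series converge absolutely, and: 1.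 The summands of $\tau^\gamma$ and $\tau^\gamma_X$ do not depend on the choice of the elements $z$. 2. $\tau^\gamma(\omega_1\wedge\omega_2)=(-1)^{\deg\omega_1\deg\omega_2}\,\tau^\gamma(\omega_2\wedge\omega_1)$ for all homogeneous $\omega_1,\omega_2\in\Omega(T^*M)\rtimes\Gamma$. 3. For every $\omega\in(\widetilde\Sigma_X\otimes\Omega(T^*X))\rtimes\Gamma$ the form $\tau^\gamma_X(\omega)$ is smooth on $T^*X^\gamma$ and $d\,\tau^\gamma_X(\omega)=\tau^\gamma_X(d\omega)$. -/

import Mathlib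

open Set Filter Topology MeasureTheory Manifold Bundle
open scoped ContDiff

noncomputable section

/-! ### Complex-valued differential forms on a manifold (possibly with boundary) -/

section Forms

variable {E : Type*} [NormedAddCommGroup E] [NormedSpace ℝ E]
  {H : Type*} [TopologicalSpace H] (J : ModelWithCorners ℝ E H)
  (N : Type*) [TopologicalSpace N] [ChartedSpace H N]

/-- Complex-valued differential forms of degree `k` on `N`, without any regularity requirement. -/
abbrev DiffForm (k : ℕ) : Type _ := ∀ p : N, TangentSpace J p [⋀^Fin k]→L[ℝ] ℂ

variable {J N}

/-- The expression of a form in the preferred chart at `p₀`: its pullback under the inverse of the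
chart. -/
def DiffForm.localRep {k : ℕ} (θ : DiffForm J N k) (p₀ : N) (y : E) : E [⋀^Fin k]→L[ℝ] ℂ :=
  (θ ((extChartAt J p₀).symm y)).compContinuousLinearMap
    (mfderivWithin 𝓘(ℝ, E) J (extChartAt J p₀).symm (range J) y)

/-- A form is smooth if all its expressions in charts are smooth (up to the boundary). -/
def DiffForm.IsSmooth {k : ℕ} (θ : DiffForm J N k) : Prop :=
  ∀ p₀ : N, ContDiffOn ℝ ∞ (θ.localRep p₀) (extChartAt J p₀).target

/-- The exterior derivative, computed at `p` in the preferred chart at `p`. -/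
def DiffForm.extD {k : ℕ} (θ : DiffForm J N k) : DiffForm J N (k + 1) := fun p =>
  ContinuousAlternatingMap.compContinuousLinearMap
    (extDerivWithin (θ.localRep p) (range J) (extChartAt J p p))
    (mfderiv J 𝓘(ℝ, E) (extChartAt J p) p)

/-- The pullback `f^*θ` of a form under a map `f : N → N`. -/
def DiffForm.pullback {k : ℕ} (f : N → N) (θ : DiffForm J N k) : DiffForm J N k := fun p =>
  (θ (f p)).compContinuousLinearMap (mfderiv J J f p)

end Forms

section Wedge

variable {V : Type*} [AddCommGroup V] [Module ℝ V] [TopologicalSpace V]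

/-- The multilinear map `v ↦ α (v₁, …, v_k) * β (v_{k+1}, …, v_{k+l})`. -/
def prodMultilinear {k l : ℕ} (α : V [⋀^Fin k]→L[ℝ] ℂ) (β : V [⋀^Fin l]→L[ℝ] ℂ) :
    ContinuousMultilinearMap ℝ (fun _ : Fin (k + l) => V) ℂ where
  toMultilinearMap := (LinearMap.mul' ℝ ℂ).compMultilinearMap
    ((MultilinearMap.domCoprod α.toMultilinearMap β.toMultilinearMap).domDomCongr finSumFinEquiv)
  cont := by
    change Continuous fun v : Fin (k + l) → V =>
      α (fun i => v (finSumFinEquiv (Sum.inl i))) * β (fun i => v (finSumFinEquiv (Sum.inr i)))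
    exact (α.cont.comp (by fun_prop)).mul (β.cont.comp (by fun_prop))

/-- The exterior product
`(α ∧ β)(v) = 1 / (k! l!) ∑_σ sign σ α(v_{σ 1}, …, v_{σ k}) β(v_{σ (k+1)}, …, v_{σ (k+l)})`. -/
def wedge {k l : ℕ} (α : V [⋀^Fin k]→L[ℝ] ℂ) (β : V [⋀^Fin l]→L[ℝ] ℂ) :
    V [⋀^Fin (k + l)]→L[ℝ] ℂ :=
  ((k.factorial * l.factorial : ℝ)⁻¹) •
    ContinuousMultilinearMap.alternatization (prodMultilinear α β)

end Wedge

/-! ### Forms on fixed point submanifolds -/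

section Fixed

variable {E : Type*} [NormedAddCommGroup E] [NormedSpace ℝ E]
  {H : Type*} [TopologicalSpace H] (J : ModelWithCorners ℝ E H)
  {N : Type*} [TopologicalSpace N] [ChartedSpace H N]

/-- The tangent space at `p` of the fixed point submanifold of `φ`: the tangent vectors at `p`
that are fixed by the differential of `φ`. -/
def FixedTangent (φ : N → N) (p : N) : Set (TangentSpace J p) :=
  {v | tangentMap J J φ (⟨p, v⟩ : TangentBundle J N) = ⟨p, v⟩}

/-- Fields of functions of `k` tangent vectors on the fixed point submanifold of `φ`. For the
codifferential `φ = ∂γ` of an isometry `γ` of `M`, the fixed point submanifold of `T^*M` is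
identified with `T^*(M^γ)` by restricting covectors to `T M^γ`. -/
abbrev FixForm (φ : N → N) (k : ℕ) : Type _ :=
  ∀ p : Function.fixedPoints φ, (Fin k → FixedTangent J φ (p : N)) → ℂ

variable {J}

/-- Restriction of a form to the fixed point submanifold of `φ`. -/
def DiffForm.restrict {k : ℕ} (φ : N → N) (θ : DiffForm J N k) : FixForm J φ k :=
  fun p v => θ p (fun i => (v i : TangentSpace J (p : N)))

/-- `β` is a smooth form on the fixed point submanifold of `φ` and `β'` is its exterior
derivative: locally `β` is the restriction of a smooth form `α` of the ambient manifold and `β'`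
is the restriction of `dα`. -/
def FixForm.HasExtD {k : ℕ} {φ : N → N} (β : FixForm J φ k) (β' : FixForm J φ (k + 1)) : Prop :=
  ∀ p : Function.fixedPoints φ, ∃ U ∈ 𝓝 (p : N), ∃ α : DiffForm J N k, α.IsSmooth ∧
    ∀ q : Function.fixedPoints φ, (q : N) ∈ U →
      α.restrict φ q = β q ∧ α.extD.restrict φ q = β' q

end Fixed

/-! ### Word length and polynomial growth -/

section Growth

variable {Γ : Type*} [Group Γ]

/-- The length of `γ` in the word metric of the generating set `S`. -/
def wordLength (S : Finset Γ) (γ : Γ) : ℕ :=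
  sInf {n | ∃ l : List Γ, l.length = n ∧ (∀ a ∈ l, a ∈ S ∨ a⁻¹ ∈ S) ∧ l.prod = γ}

/-- Polynomial growth with respect to the finite generating set `S`. -/
def HasPolynomialGrowth (S : Finset Γ) : Prop :=
  ∃ C d : ℕ, ∀ n : ℕ, {γ : Γ | wordLength S γ ≤ n}.encard ≤ ((C * (n + 1) ^ d : ℕ) : ℕ∞)

end Growth

/-! ### Smooth crossed products of forms

A homogeneous element of degree `k` of a smooth crossed product is a family, indexed by the group,
of forms of degree `k`. The families are supported in a common compact set and decrease rapidly in
every seminorm of the topology of uniform convergence of all derivatives on compact sets. -/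

section Crossed

variable {E : Type*} [NormedAddCommGroup E] [NormedSpace ℝ E]
  {H : Type*} [TopologicalSpace H] {J : ModelWithCorners ℝ E H}
  {N : Type*} [TopologicalSpace N] [ChartedSpace H N]
  {Γ : Type*} [Group Γ]

/-- `θ : Γ → Ω^k(N)` is an element of the smooth crossed product `Ω_c(N) ⋊ Γ`. -/
structure IsCrossedForm (S : Finset Γ) {k : ℕ} (θ : Γ → DiffForm J N k) : Prop where
  smooth : ∀ γ, (θ γ).IsSmooth
  compact_support : ∃ K : Set N, IsCompact K ∧ ∀ γ, ∀ p ∉ K, θ γ p = 0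
  rapid_decay : ∀ (p₀ : N) (K : Set E), IsCompact K → K ⊆ (extChartAt J p₀).target →
    ∀ i n : ℕ, ∃ C : ℝ, ∀ γ, ∀ y ∈ K,
      ‖iteratedFDerivWithin ℝ i ((θ γ).localRep p₀) (range J) y‖ *
        (1 + (wordLength S γ : ℝ)) ^ n ≤ C

/-- A rapidly decreasing family, indexed by `Γ`, of smooth compactly supported forms on `N` with
values in the Schwartz space `𝓢(Q)`. A form with values in `𝓢(Q)` is written as a family of forms
depending on `x ∈ Q`, smooth in all variables; the seminorms are the Schwartz seminorms in `x`,
uniform on compact sets of `N`. -/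
structure IsCrossedSchwartz (S : Finset Γ) {Q : Type*} [NormedAddCommGroup Q] [NormedSpace ℝ Q]
    {k : ℕ} (φ : Γ → Q → DiffForm J N k) : Prop where
  smooth : ∀ γ (p₀ : N), ContDiffOn ℝ ∞ (fun z : E × Q => (φ γ z.2).localRep p₀ z.1)
    ((extChartAt J p₀).target ×ˢ univ)
  compact_support : ∃ K : Set N, IsCompact K ∧ ∀ γ x, ∀ p ∉ K, φ γ x p = 0
  rapid_decay : ∀ (p₀ : N) (K : Set E), IsCompact K → K ⊆ (extChartAt J p₀).target →
    ∀ i j n : ℕ, ∃ C : ℝ, ∀ γ, ∀ y ∈ K, ∀ x : Q,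
      (1 + ‖x‖) ^ j * ‖iteratedFDerivWithin ℝ i (fun z : E × Q => (φ γ z.2).localRep p₀ z.1)
        (range J ×ˢ univ) (y, x)‖ * (1 + (wordLength S γ : ℝ)) ^ n ≤ C

end Crossed

/-! ### Boundary symbols and the regularized trace

The Fourier transform is `(F φ)(ξ) = ∫ exp(-i x ξ) φ(x) dx`. -/

section BoundarySymbols

/-- The Fourier transform of the restriction to `s ⊆ ℝ` of a function `φ`. -/
def fourierOn (s : Set ℝ) (φ : ℝ → ℂ) (ξ : ℝ) : ℂ :=
  ∫ x in s, Complex.exp (-(Complex.I * x * ξ)) * φ x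

/-- The space `H₊`: Fourier transforms of Schwartz functions on the closed half-line `x ≥ 0`. -/
def HPlus : Set (ℝ → ℂ) := {u | ∃ φ : SchwartzMap ℝ ℂ, u = fourierOn (Ici 0) φ}

/-- The space `H₋`: Fourier transforms of Schwartz functions on the closed half-line `x ≤ 0`. -/
def HMinus : Set (ℝ → ℂ) := {u | ∃ φ : SchwartzMap ℝ ℂ, u = fourierOn (Iic 0) φ}

open Classical in
/-- The projection `Π₊ : H₊ ⊕ H₋ → H₊`. -/
def piPlus (u : ℝ → ℂ) : ℝ → ℂ :=
  if h : ∃ w ∈ HPlus, u - w ∈ HMinus then h.choose else 0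

/-- The functional `Π' u = lim_{x → 0+} (F⁻¹ u)(x)` on `H₊ ⊕ H₋`. The inverse Fourier transform is
the improper integral `(F⁻¹ u)(x) = lim_{R → ∞} (2π)⁻¹ ∫_{-R}^{R} exp(i x ξ) u(ξ) dξ`, as the
elements of `H₊ ⊕ H₋` are only `O(1 / |ξ|)`. -/
def piPrime (u : ℝ → ℂ) : ℂ :=
  limUnder (𝓝[>] (0 : ℝ)) fun x : ℝ => limUnder (atTop : Filter ℝ) fun R : ℝ =>
    (2 * Real.pi : ℂ)⁻¹ * ∫ ξ in (-R)..R, Complex.exp (Complex.I * x * ξ) * u ξ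

/-- A boundary symbol at one covector, described by its principal symbol `a`, Green symbol `g`,
coboundary symbol `c`, boundary symbol `b`, and scalar entry `q`. -/
@[ext]
structure BoundarySymbol where
  a : ℝ → ℂ
  g : ℝ → ℝ → ℂ
  c : ℝ → ℂ
  b : ℝ → ℂ
  q : ℂ

/-- The operator given by the matrix with rows `(Π₊ a + Π'_η g, c)` and `(Π'_ξ b, q)`, on the dense
subspace `H₊ ⊕ ℂ` of the sum of the `L²`-closure of `H₊` and `ℂ`. For `a ∈ ℂ ⊕ H₊ ⊕ H₋`,
`g ∈ H₊ ⊗ H₋`, `c ∈ H₊`, `b ∈ H₋` the operator determines the data `(a, g, c, b, q)`, so operator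
families of this form are described by families of data. -/
def BoundarySymbol.act (s : BoundarySymbol) (h : ℝ → ℂ) (v : ℂ) : (ℝ → ℂ) × ℂ :=
  (fun ξ => piPlus (fun ζ => s.a ζ * h ζ) ξ + piPrime (fun η => s.g ξ η * h η) + s.c ξ * v,
    piPrime (fun ξ => s.b ξ * h ξ) + s.q * v)

/-- The regularized trace `tr' = Π'_η g(η, η) + q`. -/
def BoundarySymbol.regTrace (s : BoundarySymbol) : ℂ := piPrime (fun η => s.g η η) + s.q

end BoundarySymbols

section BoundaryForms

variable {E : Type*} [NormedAddCommGroup E] [NormedSpace ℝ E]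
  {H : Type*} [TopologicalSpace H] (J : ModelWithCorners ℝ E H)
  (N : Type*) [TopologicalSpace N] [ChartedSpace H N]

/-- Forms of degree `k` on `N` whose coefficients are boundary symbols: each entry is a form for
every value of the covariables `ξ`, `η`. -/
structure BoundaryForm (k : ℕ) where
  a : ℝ → DiffForm J N k
  g : ℝ → ℝ → DiffForm J N k
  c : ℝ → DiffForm J N k
  b : ℝ → DiffForm J N k
  q : DiffForm J N k

variable {J N} {k : ℕ}

/-- The exterior differential, acting on the coefficients. -/
def BoundaryForm.extD (θ : BoundaryForm J N k) : BoundaryForm J N (k + 1) where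
  a ξ := (θ.a ξ).extD
  g ξ η := (θ.g ξ η).extD
  c ξ := (θ.c ξ).extD
  b ξ := (θ.b ξ).extD
  q := θ.q.extD

/-- The pullback under `f : N → N`. -/
def BoundaryForm.pullback (f : N → N) (θ : BoundaryForm J N k) : BoundaryForm J N k where
  a ξ := (θ.a ξ).pullback f
  g ξ η := (θ.g ξ η).pullback f
  c ξ := (θ.c ξ).pullback f
  b ξ := (θ.b ξ).pullback f
  q := θ.q.pullback f

/-- The boundary symbol obtained by evaluating the form on tangent vectors at `p`. -/
def BoundaryForm.eval (θ : BoundaryForm J N k) (p : N) (v : Fin k → TangentSpace J p) :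
    BoundarySymbol where
  a ξ := θ.a ξ p v
  g ξ η := θ.g ξ η p v
  c ξ := θ.c ξ p v
  b ξ := θ.b ξ p v
  q := θ.q p v

/-- The restriction to the fixed point submanifold of `φ`, followed by the regularized trace of the
coefficients. -/
def BoundaryForm.trRestrict (φ : N → N) (θ : BoundaryForm J N k) : FixForm J φ k :=
  fun p v => (θ.eval p (fun i => (v i : TangentSpace J (p : N)))).regTrace

variable {Γ : Type*} [Group Γ]

/-- `u` is a rapidly decreasing family of smooth compactly supported `H₊`-valued forms. -/
def IsCrossedHPlus (S : Finset Γ) (u : Γ → ℝ → DiffForm J N k) : Prop :=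
  ∃ φ : Γ → ℝ → DiffForm J N k, IsCrossedSchwartz S φ ∧
    ∀ γ ξ p v, u γ ξ p v = fourierOn (Ici 0) (fun x => φ γ x p v) ξ

/-- `u` is a rapidly decreasing family of smooth compactly supported `H₋`-valued forms. -/
def IsCrossedHMinus (S : Finset Γ) (u : Γ → ℝ → DiffForm J N k) : Prop :=
  ∃ φ : Γ → ℝ → DiffForm J N k, IsCrossedSchwartz S φ ∧
    ∀ γ ξ p v, u γ ξ p v = fourierOn (Iic 0) (fun x => φ γ x p v) ξ

/-- `u` is a rapidly decreasing family of smooth compactly supported forms with values in the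
completed tensor product `H₊ ⊗ H₋`, i.e. in the space of Fourier transforms of Schwartz functions
on the quadrant `x ≥ 0 ≥ y`. -/
def IsCrossedHPlusHMinus (S : Finset Γ) (u : Γ → ℝ → ℝ → DiffForm J N k) : Prop :=
  ∃ φ : Γ → ℝ × ℝ → DiffForm J N k, IsCrossedSchwartz S φ ∧
    ∀ γ ξ η p v, u γ ξ η p v =
      ∫ x in (Ici (0 : ℝ)) ×ˢ (Iic (0 : ℝ)),
        Complex.exp (-(Complex.I * (x.1 * ξ + x.2 * η))) * φ γ x p v

/-- `θ` is an element of degree `k` of the smooth crossed product with `Γ` of the algebra of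
compactly supported forms on `N` with boundary symbols as coefficients: `a` takes values in
`ℂ ⊕ H₊ ⊕ H₋` (the functions of `ξ` with the transmission property), `g` in `H₊ ⊗ H₋`,
`c` in `H₊`, `b` in `H₋` and `q` in `ℂ`. -/
structure IsCrossedBoundaryForm (S : Finset Γ) (θ : Γ → BoundaryForm J N k) : Prop where
  a_mem : ∃ (a₀ : Γ → DiffForm J N k) (a₁ a₂ : Γ → ℝ → DiffForm J N k),
    IsCrossedForm S a₀ ∧ IsCrossedHPlus S a₁ ∧ IsCrossedHMinus S a₂ ∧
      ∀ γ ξ, (θ γ).a ξ = a₀ γ + a₁ γ ξ + a₂ γ ξ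
  g_mem : IsCrossedHPlusHMinus S fun γ => (θ γ).g
  c_mem : IsCrossedHPlus S fun γ => (θ γ).c
  b_mem : IsCrossedHMinus S fun γ => (θ γ).b
  q_mem : IsCrossedForm S fun γ => (θ γ).q

end BoundaryForms

/-! ### The averaged traces

`G` is a topological group, acting on `N` through `act`, and `Γ` is a subgroup of `G`. -/

section Trace

variable {E : Type*} [NormedAddCommGroup E] [NormedSpace ℝ E]
  {H : Type*} [TopologicalSpace H] {J : ModelWithCorners ℝ E H}
  {N : Type*} [TopologicalSpace N] [ChartedSpace H N]
  {G : Type*} [Group G] [TopologicalSpace G] [IsTopologicalGroup G]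

/-- The centralizer of `γ` in the closure of `Γ`. -/
def closureCentralizer {Γ : Subgroup G} (γ : Γ) : Subgroup G :=
  Γ.topologicalClosure ⊓ Subgroup.centralizer {(γ : G)}

/-- `z` belongs to the closure of `Γ` and conjugates `γ` and `γ' = z γ z⁻¹`. -/
def IsConjugator {Γ : Subgroup G} (γ γ' : Γ) (z : G) : Prop :=
  z ∈ Γ.topologicalClosure ∧ (γ' : G) = z * γ * z⁻¹

/-- The product of the crossed product algebra:
`(ω₁ ω₂)(γ) = ∑_{γ₁ γ₂ = γ} ω₁(γ₁) ∧ γ₁(ω₂(γ₂))`, where `γ₁(θ) = (γ₁⁻¹)^* θ`. -/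
def crossedMul (act : G → N → N) {Γ : Subgroup G} {k l : ℕ}
    (ω₁ : Γ → DiffForm J N k) (ω₂ : Γ → DiffForm J N l) : Γ → DiffForm J N (k + l) :=
  fun γ p => ∑' γ₁ : Γ, wedge (ω₁ γ₁ p) ((ω₂ (γ₁⁻¹ * γ)).pullback (act (γ₁⁻¹ : Γ)) p)

variable [MeasurableSpace G]

/-- The summand `∫ h^*(z^* θ(γ'))|_{N^γ} dh` of the functional `τ^γ`, the integral being over the
centralizer of `γ` in the closure of `Γ`. -/
def tauSummand (act : G → N → N) {Γ : Subgroup G} (γ : Γ) (μ : Measure (closureCentralizer γ))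
    {k : ℕ} (θ : Γ → DiffForm J N k) (γ' : Γ) (z : G) : FixForm J (act γ) k :=
  fun p v => ∫ h : closureCentralizer γ,
    (((θ γ').pullback (act z)).pullback (act h)).restrict (act γ) p v ∂μ

/-- The functional `τ^γ`, for a choice `z` of conjugating elements. -/
def tau (act : G → N → N) {Γ : Subgroup G} (γ : Γ) (μ : Measure (closureCentralizer γ))
    (z : Γ → G) {k : ℕ} (θ : Γ → DiffForm J N k) : FixForm J (act γ) k :=
  fun p v => ∑' γ' : {γ' : Γ // IsConj γ γ'}, tauSummand act γ μ θ γ' (z γ') p v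

/-- The integrals and the series defining `τ^γ(θ)` converge absolutely. -/
def TauConverges (act : G → N → N) {Γ : Subgroup G} (γ : Γ) (μ : Measure (closureCentralizer γ))
    (z : Γ → G) {k : ℕ} (θ : Γ → DiffForm J N k) : Prop :=
  ∀ (p : Function.fixedPoints (act γ)) (v : Fin k → FixedTangent J (act γ) (p : N)),
    (∀ γ' : {γ' : Γ // IsConj γ γ'}, Integrable (fun h : closureCentralizer γ =>
      (((θ γ').pullback (act (z γ'))).pullback (act h)).restrict (act γ) p v) μ) ∧
    Summable fun γ' : {γ' : Γ // IsConj γ γ'} => tauSummand act γ μ θ γ' (z γ') p v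

/-- The summand `∫ tr_X (h^*(z^* θ(γ'))|_{N^γ}) dh` of the functional `τ_X^γ`. -/
def tauXSummand (act : G → N → N) {Γ : Subgroup G} (γ : Γ) (μ : Measure (closureCentralizer γ))
    {k : ℕ} (θ : Γ → BoundaryForm J N k) (γ' : Γ) (z : G) : FixForm J (act γ) k :=
  fun p v => ∫ h : closureCentralizer γ,
    (((θ γ').pullback (act z)).pullback (act h)).trRestrict (act γ) p v ∂μ

/-- The functional `τ_X^γ`, for a choice `z` of conjugating elements. -/
def tauX (act : G → N → N) {Γ : Subgroup G} (γ : Γ) (μ : Measure (closureCentralizer γ))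
    (z : Γ → G) {k : ℕ} (θ : Γ → BoundaryForm J N k) : FixForm J (act γ) k :=
  fun p v => ∑' γ' : {γ' : Γ // IsConj γ γ'}, tauXSummand act γ μ θ γ' (z γ') p v

/-- The integrals and the series defining `τ_X^γ(θ)` converge absolutely. -/
def TauXConverges (act : G → N → N) {Γ : Subgroup G} (γ : Γ) (μ : Measure (closureCentralizer γ))
    (z : Γ → G) {k : ℕ} (θ : Γ → BoundaryForm J N k) : Prop :=
  ∀ (p : Function.fixedPoints (act γ)) (v : Fin k → FixedTangent J (act γ) (p : N)),
    (∀ γ' : {γ' : Γ // IsConj γ γ'}, Integrable (fun h : closureCentralizer γ =>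
      (((θ γ').pullback (act (z γ'))).pullback (act h)).trRestrict (act γ) p v) μ) ∧
    Summable fun γ' : {γ' : Γ // IsConj γ γ'} => tauXSummand act γ μ θ γ' (z γ') p v

end Trace

/-! ### Cotangent bundles and the isometry group -/

section Isometries

variable {E : Type*} [NormedAddCommGroup E] [NormedSpace ℝ E]
  {H : Type*} [TopologicalSpace H] (I : ModelWithCorners ℝ E H)
  (M : Type*) [TopologicalSpace M] [ChartedSpace H M] [IsManifold I ∞ M]

/-- The cotangent bundle of `M`, with its structure of a manifold modelled on
`I.prod 𝓘(ℝ, E →L[ℝ] ℝ)`. -/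
abbrev CotangentBundle : Type _ :=
  TotalSpace (E →L[ℝ] ℝ) (fun x : M => TangentSpace I x →L[ℝ] Bundle.Trivial M ℝ x)

variable {M}

/-- The codifferential `∂f = ((df)^t)⁻¹`, i.e. `(x, ξ) ↦ (f x, ξ ∘ (df_x)⁻¹)`. -/
def codifferential (f : M → M) (p : CotangentBundle I M) : CotangentBundle I M :=
  ⟨f p.1, ContinuousLinearMap.comp p.2 (mfderiv I I f p.1).inverse⟩

variable {I}
variable (g : ContMDiffRiemannianMetric I ∞ E (fun x : M => TangentSpace I x))

/-- Isometries of the Riemannian manifold `(M, g)` preserving the boundary. -/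
structure IsIsometry (f : M ≃ₜ M) : Prop where
  contMDiff : ContMDiff I I ∞ f
  contMDiff_symm : ContMDiff I I ∞ f.symm
  inner_map : ∀ (x : M) (v w : TangentSpace I x),
    g.inner (f x) (mfderiv I I f x v) (mfderiv I I f x w) = g.inner x v w
  boundary : f '' I.boundary M = I.boundary M

/-- The group of isometries of `(M, g)`. -/
def isometrySubgroup : Subgroup (M ≃ₜ M) where
  carrier := {f | IsIsometry g f}
  one_mem' := by
    refine ⟨contMDiff_id, contMDiff_id, fun x v w => ?_, image_id _⟩
    have h : mfderiv I I (⇑(1 : M ≃ₜ M)) x = ContinuousLinearMap.id ℝ _ := mfderiv_id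
    rw [h]; rfl
  mul_mem' := by
    intro f₁ f₂ h₁ h₂
    refine ⟨h₁.contMDiff.comp h₂.contMDiff, h₂.contMDiff_symm.comp h₁.contMDiff_symm,
      fun x v w => ?_, ?_⟩
    · have h : mfderiv I I (⇑(f₁ * f₂)) x = (mfderiv I I f₁ (f₂ x)).comp (mfderiv I I f₂ x) :=
        mfderiv_comp x (h₁.contMDiff.mdifferentiable (by simp) _)
          (h₂.contMDiff.mdifferentiable (by simp) _)
      rw [h]
      exact (h₁.inner_map (f₂ x) _ _).trans (h₂.inner_map x v w)
    · change (f₁ ∘ f₂) '' _ = _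
      rw [image_comp, h₂.boundary, h₁.boundary]
  inv_mem' := by
    intro f hf
    refine ⟨hf.contMDiff_symm, hf.contMDiff, fun x v w => ?_, ?_⟩
    · have key : ∀ k : M → M, k = id →
          g.inner (k x) (mfderiv I I k x v) (mfderiv I I k x w) = g.inner x v w := by
        rintro _ rfl
        rw [mfderiv_id]; rfl
      have h : mfderiv I I (f ∘ f.symm) x =
          (mfderiv I I f (f.symm x)).comp (mfderiv I I f.symm x) :=
        mfderiv_comp x (hf.contMDiff.mdifferentiable (by simp) _)
          (hf.contMDiff_symm.mdifferentiable (by simp) _)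
      have h' := key (f ∘ f.symm) (by ext; simp)
      rw [h] at h'
      exact (hf.inner_map (f.symm x) _ _).symm.trans h'
    · change f.symm '' _ = _
      conv_lhs => rw [← hf.boundary]
      rw [← image_comp]; simp

/-- The group of isometries as a type. -/
abbrev IsometryGroup : Type _ := isometrySubgroup g

/-- The compact-open topology (for an isometry and its inverse) on the isometry group. -/
instance : TopologicalSpace (IsometryGroup g) :=
  TopologicalSpace.induced
    (fun f => (((f : M ≃ₜ M) : C(M, M)), ((f : M ≃ₜ M).symm : C(M, M)))) inferInstance

instance [LocallyCompactSpace M] : IsTopologicalGroup (IsometryGroup g) where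
  continuous_mul := by
    have h : Continuous fun f : IsometryGroup g =>
      (((f : M ≃ₜ M) : C(M, M)), ((f : M ≃ₜ M).symm : C(M, M))) := continuous_induced_dom
    refine continuous_induced_rng.2 (Continuous.prodMk ?_ ?_)
    · exact ContinuousMap.continuous_comp'.comp
        ((h.fst.comp continuous_snd).prodMk (h.fst.comp continuous_fst))
    · exact ContinuousMap.continuous_comp'.comp
        ((h.snd.comp continuous_fst).prodMk (h.snd.comp continuous_snd))
  continuous_inv := by
    have h : Continuous fun f : IsometryGroup g =>
      (((f : M ≃ₜ M) : C(M, M)), ((f : M ≃ₜ M).symm : C(M, M))) := continuous_induced_dom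
    exact continuous_induced_rng.2 (h.snd.prodMk h.fst)

instance : MeasurableSpace (IsometryGroup g) := borel _

instance : BorelSpace (IsometryGroup g) := ⟨rfl⟩

variable {g}

/-- The action of isometries on the cotangent bundle of `M`. -/
def cotangentAction (f : IsometryGroup g) : CotangentBundle I M → CotangentBundle I M :=
  codifferential I (f : M ≃ₜ M)

variable {E' : Type*} [NormedAddCommGroup E'] [NormedSpace ℝ E']
  {H' : Type*} [TopologicalSpace H'] (I' : ModelWithCorners ℝ E' H')
  {X : Type*} [TopologicalSpace X] [ChartedSpace H' X] [IsManifold I' ∞ X]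

open Classical in
/-- The map induced on the boundary, embedded into `M` by `ι`, by a map `f : M → M`: the map
`f_X` with `ι ∘ f_X = f ∘ ι`. -/
def boundaryMap (ι : X → M) (f : M → M) (x : X) : X :=
  if h : ∃ y, ι y = f (ι x) then h.choose else x

/-- The action of isometries of `M` on the cotangent bundle of the boundary. -/
def boundaryCotangentAction (ι : X → M) (f : IsometryGroup g) :
    CotangentBundle I' X → CotangentBundle I' X :=
  codifferential I' (boundaryMap ι (f : M ≃ₜ M))

end Isometries

end

noncomputable section

/-! ### Smooth maps depending continuously on a parameter -/

section ParamSmooth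

universe u v

variable {P : Type v} [TopologicalSpace P] {E F F' F'' : Type u}
  [NormedAddCommGroup E] [NormedSpace ℝ E] [NormedAddCommGroup F] [NormedSpace ℝ F]
  [NormedAddCommGroup F'] [NormedSpace ℝ F'] [NormedAddCommGroup F''] [NormedSpace ℝ F'']

/-- `f (p, y)` is `n` times differentiable in `y` within `s` for `(p, y) ∈ O`, and the derivatives
in `y` are jointly continuous in `(p, y)`. -/
def ParamDiff (s : Set E) (O : Set (P × E)) :
    ℕ → ∀ {F : Type u} [NormedAddCommGroup F] [NormedSpace ℝ F], (P × E → F) → Prop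
  | 0, _, _, _, f => ContinuousOn f (O ∩ Prod.snd ⁻¹' s)
  | n + 1, _, _, _, f => ContinuousOn f (O ∩ Prod.snd ⁻¹' s) ∧ ∃ f' : P × E → (E →L[ℝ] _),
      (∀ w ∈ O, w.2 ∈ s → HasFDerivWithinAt (fun y => f (w.1, y)) (f' w) s w.2) ∧
        ParamDiff s O n f'

variable {s : Set E} {O O' : Set (P × E)} {n : ℕ}

theorem ParamDiff.continuousOn {f : P × E → F} (h : ParamDiff s O n f) :
    ContinuousOn f (O ∩ Prod.snd ⁻¹' s) := by
  cases n with
  | zero => exact h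
  | succ n => exact h.1

theorem ParamDiff.of_succ {f : P × E → F} (h : ParamDiff s O (n + 1) f) : ParamDiff s O n f := by
  induction n generalizing F with
  | zero => exact h.1
  | succ n ih =>
    obtain ⟨hc, f', hf', hn⟩ := h
    exact ⟨hc, f', hf', ih hn⟩

theorem ParamDiff.mono {f : P × E → F} (h : ParamDiff s O n f) (hO : O' ⊆ O) :
    ParamDiff s O' n f := by
  induction n generalizing F with
  | zero => exact ContinuousOn.mono h (by gcongr)
  | succ n ih =>
    obtain ⟨hc, f', hf', hn⟩ := h
    exact ⟨hc.mono (by gcongr), f', fun w hw => hf' w (hO hw), ih hn⟩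

theorem ParamDiff.congr {f g : P × E → F} (hO : IsOpen O) (h : ParamDiff s O n f)
    (hfg : ∀ w ∈ O, w.2 ∈ s → g w = f w) : ParamDiff s O n g := by
  have hc : ContinuousOn g (O ∩ Prod.snd ⁻¹' s) :=
    h.continuousOn.congr fun w hw => hfg w hw.1 hw.2
  cases n with
  | zero => exact hc
  | succ n =>
    obtain ⟨-, f', hf', hn⟩ := h
    refine ⟨hc, f', fun w hw hs => ?_, hn⟩
    refine (hf' w hw hs).congr_of_eventuallyEq ?_ (hfg _ hw hs)
    have : ∀ᶠ y in 𝓝 w.2, (w.1, y) ∈ O :=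
      (Continuous.prodMk_right w.1).continuousAt.eventually (hO.mem_nhds hw)
    filter_upwards [nhdsWithin_le_nhds this, self_mem_nhdsWithin] with y hy hys
    exact hfg _ hy hys

/-- `ParamDiff` is a local property. -/
theorem ParamDiff.of_local {f : P × E → F} (hs : UniqueDiffOn ℝ s)
    (h : ∀ w ∈ O, w.2 ∈ s → ∃ O' ∈ 𝓝 w, ParamDiff s O' n f) : ParamDiff s O n f := by
  have h' : ∀ w ∈ O, w.2 ∈ s → ∃ O', IsOpen O' ∧ w ∈ O' ∧ ParamDiff s O' n f := by
    intro w hw hws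
    obtain ⟨O', hO', hf⟩ := h w hw hws
    obtain ⟨U, hU, hUo, hwU⟩ := mem_nhds_iff.1 hO'
    exact ⟨U, hUo, hwU, hf.mono hU⟩
  clear h
  have hcont : ∀ {G : Type u} [NormedAddCommGroup G] [NormedSpace ℝ G] {f : P × E → G} {n : ℕ},
      (∀ w ∈ O, w.2 ∈ s → ∃ O', IsOpen O' ∧ w ∈ O' ∧ ParamDiff s O' n f) →
        ContinuousOn f (O ∩ Prod.snd ⁻¹' s) := by
    intro G _ _ f n h w hw
    obtain ⟨O', hO', hwO', hf⟩ := h w hw.1 hw.2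
    refine ((hf.continuousOn w ⟨hwO', hw.2⟩).mono_of_mem_nhdsWithin ?_)
    filter_upwards [self_mem_nhdsWithin, nhdsWithin_le_nhds (hO'.mem_nhds hwO')] with a ha ha'
    exact ⟨ha', ha.2⟩
  induction n generalizing F with
  | zero => exact hcont h'
  | succ n ih =>
    refine ⟨hcont h', fun w => fderivWithin ℝ (fun y => f (w.1, y)) s w.2, fun w hw hws => ?_,
      ih fun w hw hws => ?_⟩
    · obtain ⟨O', hO', hwO', -, f', hf', -⟩ := h' w hw hws
      exact (hf' w hwO' hws).differentiableWithinAt.hasFDerivWithinAt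
    · obtain ⟨O', hO', hwO', -, f', hf', hn⟩ := h' w hw hws
      exact ⟨O', hO', hwO', hn.congr hO' fun w hw hws => (hf' w hw hws).fderivWithin (hs _ hws)⟩

theorem ParamDiff.fderivWithin {f : P × E → F} (hs : UniqueDiffOn ℝ s) (hO : IsOpen O)
    (h : ParamDiff s O (n + 1) f) :
    ParamDiff s O n fun w => fderivWithin ℝ (fun y => f (w.1, y)) s w.2 := by
  obtain ⟨-, f', hf', hn⟩ := h
  exact hn.congr hO fun w hw hws => (hf' w hw hws).fderivWithin (hs _ hws)

/-- Change of the parameter. -/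
theorem ParamDiff.reparam {P' : Type*} [TopologicalSpace P'] {f : P × E → F} {q : P' → P}
    (h : ParamDiff s O n f) (hq : Continuous q) :
    ParamDiff s (Prod.map q id ⁻¹' O) n fun w : P' × E => f (q w.1, w.2) := by
  have hc : Continuous (Prod.map q (id : E → E)) := hq.prodMap continuous_id
  induction n generalizing F with
  | zero => exact ContinuousOn.comp h hc.continuousOn fun w hw => hw
  | succ n ih =>
    obtain ⟨h0, f', hf', hn⟩ := h
    exact ⟨h0.comp hc.continuousOn fun w hw => hw, fun w => f' (q w.1, w.2),
      fun w hw hws => hf' (q w.1, w.2) hw hws, ih hn⟩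

theorem ParamDiff.add {f g : P × E → F} (hf : ParamDiff s O n f) (hg : ParamDiff s O n g) :
    ParamDiff s O n (fun w => f w + g w) := by
  induction n generalizing F with
  | zero => exact ContinuousOn.add hf hg
  | succ n ih =>
    obtain ⟨hf0, f', hf', hfn⟩ := hf
    obtain ⟨hg0, g', hg', hgn⟩ := hg
    exact ⟨hf0.add hg0, _, fun w hw hws => (hf' w hw hws).add (hg' w hw hws), ih hfn hgn⟩

theorem ParamDiff.clm (L : F →L[ℝ] F') {f : P × E → F} (hf : ParamDiff s O n f) :
    ParamDiff s O n (fun w => L (f w)) := by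
  induction n generalizing F F' with
  | zero => exact L.continuous.comp_continuousOn hf
  | succ n ih =>
    obtain ⟨hf0, f', hf', hfn⟩ := hf
    exact ⟨L.continuous.comp_continuousOn hf0, _,
      fun w hw hws => L.hasFDerivAt.comp_hasFDerivWithinAt _ (hf' w hw hws),
      ih (ContinuousLinearMap.compL ℝ E F F' L) hfn⟩

theorem ParamDiff.sub {f g : P × E → F} (hf : ParamDiff s O n f) (hg : ParamDiff s O n g) :
    ParamDiff s O n (fun w => f w - g w) := by
  simpa [sub_eq_add_neg] using hf.add (hg.clm (-ContinuousLinearMap.id ℝ F))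

theorem ParamDiff.prodMk {f : P × E → F} {g : P × E → F'} (hf : ParamDiff s O n f)
    (hg : ParamDiff s O n g) : ParamDiff s O n (fun w => (f w, g w)) := by
  simpa using (hf.clm (ContinuousLinearMap.inl ℝ F F')).add
    (hg.clm (ContinuousLinearMap.inr ℝ F F'))

theorem ParamDiff.bilin (B : F →L[ℝ] F' →L[ℝ] F'') {f : P × E → F} {g : P × E → F'}
    (hf : ParamDiff s O n f) (hg : ParamDiff s O n g) :
    ParamDiff s O n (fun w => B (f w) (g w)) := by
  induction n generalizing F F' F'' with
  | zero => exact B.isBoundedBilinearMap.continuous.comp_continuousOn (ContinuousOn.prodMk hf hg)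
  | succ n ih =>
    have hfs := hf.of_succ
    have hgs := hg.of_succ
    obtain ⟨hf0, f', hf', hfn⟩ := hf
    obtain ⟨hg0, g', hg', hgn⟩ := hg
    exact ⟨B.isBoundedBilinearMap.continuous.comp_continuousOn (hf0.prodMk hg0), _,
      fun w hw hws => B.hasFDerivWithinAt_of_bilinear (hf' w hw hws) (hg' w hw hws),
      (ih (B.precompR E) hfs hgn).add (ih (B.precompL E) hfn hgs)⟩

/-- A smooth map, viewed as a family independent of the parameter. -/
theorem ParamDiff.of_contDiffOn {f : E → F} (hs : UniqueDiffOn ℝ s) {U : Set E} (hU : IsOpen U)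
    (hf : ContDiffOn ℝ n f (s ∩ U)) (hO : ∀ w ∈ O, w.2 ∈ U) :
    ParamDiff s O n (fun w => f w.2) := by
  induction n generalizing F with
  | zero =>
    exact hf.continuousOn.comp continuousOn_snd fun w hw => ⟨hw.2, hO w hw.1⟩
  | succ n ih =>
    have hu : UniqueDiffOn ℝ (s ∩ U) := hs.inter hU
    have key := (contDiffOn_succ_iff_fderivWithin (n := n) hu).1 (by exact_mod_cast hf)
    refine ⟨hf.continuousOn.comp continuousOn_snd fun w hw => ⟨hw.2, hO w hw.1⟩,
      fun w => _root_.fderivWithin ℝ f (s ∩ U) w.2, fun w hw hws => ?_, ih key.2.2⟩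
    have h1 := (key.1 w.2 ⟨hws, hO w hw⟩).hasFDerivWithinAt
    exact h1.mono_of_mem_nhdsWithin (inter_mem_nhdsWithin _ (hU.mem_nhds (hO w hw)))

theorem ParamDiff.snd : ParamDiff s O n (fun w : P × E => w.2) := by
  cases n with
  | zero => exact continuousOn_snd
  | succ n =>
    refine ⟨continuousOn_snd, fun _ => .id ℝ E, fun w _ _ => hasFDerivWithinAt_id _ _, ?_⟩
    induction n with
    | zero => exact continuousOn_const
    | succ n ih =>
      refine ⟨continuousOn_const, fun _ => 0, fun w _ _ => hasFDerivWithinAt_const _ _ _, ?_⟩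
      have h0 : ∀ {G : Type u} [NormedAddCommGroup G] [NormedSpace ℝ G] (m : ℕ),
          ParamDiff s O m (fun _ : P × E => (0 : G)) := by
        intro G _ _ m
        induction m generalizing G with
        | zero => exact continuousOn_const
        | succ m ihm => exact ⟨continuousOn_const, fun _ => 0,
            fun w _ _ => hasFDerivWithinAt_const _ _ _, ihm⟩
      exact h0 n

/-- Composition of families. -/
theorem ParamDiff.comp {t : Set F} {f : P × F → F'} {u : P × E → F} {O' : Set (P × F)}
    (hf : ParamDiff t O' n f) (hu : ParamDiff s O n u) (hO : IsOpen O)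
    (hO' : ∀ w ∈ O, w.2 ∈ s → (w.1, u w) ∈ O' ∧ u w ∈ t) :
    ParamDiff s O n (fun w => f (w.1, u w)) := by
  have hc : ∀ {G : Type u} [NormedAddCommGroup G] [NormedSpace ℝ G] {f : P × F → G},
      ContinuousOn f (O' ∩ Prod.snd ⁻¹' t) → ContinuousOn u (O ∩ Prod.snd ⁻¹' s) →
        ContinuousOn (fun w => f (w.1, u w)) (O ∩ Prod.snd ⁻¹' s) := fun hf hu =>
    hf.comp (continuousOn_fst.prodMk hu) fun w hw => hO' w hw.1 hw.2
  induction n generalizing F' with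
  | zero => exact hc hf hu
  | succ n ih =>
    have hus := hu.of_succ
    obtain ⟨hf0, f', hf', hfn⟩ := hf
    obtain ⟨hu0, u', hu', hun⟩ := hu
    refine ⟨hc hf0 hu0, fun w => (f' (w.1, u w)).comp (u' w), fun w hw hws => ?_,
      (ih hfn hus).bilin (ContinuousLinearMap.compL ℝ E F F') hun⟩
    have h1 := hf' (w.1, u w) (hO' w hw hws).1 (hO' w hw hws).2
    have hO₁ : ∀ᶠ y in 𝓝[s] w.2, (w.1, y) ∈ O := nhdsWithin_le_nhds
      ((Continuous.prodMk_right w.1).continuousAt.eventually (hO.mem_nhds hw))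
    have h2 : HasFDerivWithinAt (fun y => u (w.1, y)) (u' w) (s ∩ {y | (w.1, y) ∈ O}) w.2 :=
      (hu' w hw hws).mono inter_subset_left
    have h3 := h1.comp w.2 h2 fun y hy => (hO' (w.1, y) hy.2 hy.1).2
    exact h3.mono_of_mem_nhdsWithin (inter_mem self_mem_nhdsWithin hO₁)

/-- Composition with a smooth map. -/
theorem ParamDiff.contDiffOn_comp {t U : Set F} {f : F → F'} {u : P × E → F}
    (ht : UniqueDiffOn ℝ t) (hU : IsOpen U) (hf : ContDiffOn ℝ n f (t ∩ U))
    (hu : ParamDiff s O n u) (hO : IsOpen O) (hO' : ∀ w ∈ O, w.2 ∈ s → u w ∈ t ∩ U) :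
    ParamDiff s O n (fun w => f (u w)) :=
  (ParamDiff.of_contDiffOn (P := P) (O := Prod.snd ⁻¹' U) ht hU hf fun _ h => h).comp hu hO
    fun w hw hws => ⟨(hO' w hw hws).2, (hO' w hw hws).1⟩

theorem ParamDiff.inverse [CompleteSpace E] [CompleteSpace F] {A : P × E → (E →L[ℝ] F)}
    (hA : ParamDiff s O n A) (hO : IsOpen O)
    (hinv : ∀ w ∈ O, w.2 ∈ s → (A w).IsInvertible) :
    ParamDiff s O n (fun w => (A w).inverse) := by
  have hopen : IsOpen {A : E →L[ℝ] F | A.IsInvertible} := ContinuousLinearEquiv.isOpen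
  refine ParamDiff.contDiffOn_comp (t := univ) uniqueDiffOn_univ hopen (fun B hB => ?_) hA hO
    fun w hw hws => ⟨mem_univ _, hinv w hw hws⟩
  obtain ⟨e, rfl⟩ := hB.2
  exact (contDiffAt_map_inverse e).contDiffWithinAt

/-- Bootstrapping for a system `Du = A`, `DA = Φ(u, A)`. -/
theorem ParamDiff.bootstrap {u : P × E → F} {A : P × E → (E →L[ℝ] F)}
    {Φ : P × E → (E →L[ℝ] (E →L[ℝ] F))}
    (hu : ContinuousOn u (O ∩ Prod.snd ⁻¹' s)) (hA : ContinuousOn A (O ∩ Prod.snd ⁻¹' s))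
    (hu' : ∀ w ∈ O, w.2 ∈ s → HasFDerivWithinAt (fun y => u (w.1, y)) (A w) s w.2)
    (hA' : ∀ w ∈ O, w.2 ∈ s → HasFDerivWithinAt (fun y => A (w.1, y)) (Φ w) s w.2)
    (hΦ : ∀ n, ParamDiff s O n u → ParamDiff s O n A → ParamDiff s O n Φ) (n : ℕ) :
    ParamDiff s O n u ∧ ParamDiff s O n A := by
  induction n with
  | zero => exact ⟨hu, hA⟩
  | succ n ih => exact ⟨⟨hu, A, hu', ih.2⟩, ⟨hA, Φ, hA', hΦ n ih.1 ih.2⟩⟩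

/-- The members of a family are smooth. -/
theorem ParamDiff.contDiffOn_slice {f : P × E → F} (h : ParamDiff s O n f) (hO : IsOpen O)
    (hs : UniqueDiffOn ℝ s) (p : P) :
    ContDiffOn ℝ n (fun y => f (p, y)) (s ∩ {y | (p, y) ∈ O}) := by
  have hU : IsOpen {y : E | (p, y) ∈ O} := hO.preimage (Continuous.prodMk_right p)
  induction n generalizing F with
  | zero =>
    exact contDiffOn_zero.2 (ContinuousOn.comp (ParamDiff.continuousOn h)
      (Continuous.prodMk_right p).continuousOn fun y hy => ⟨hy.2, hy.1⟩)
  | succ n ih =>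
    obtain ⟨h0, f', hf', hn⟩ := h
    have hd : ∀ y ∈ s ∩ {y | (p, y) ∈ O}, HasFDerivWithinAt (fun y => f (p, y)) (f' (p, y))
        (s ∩ {y | (p, y) ∈ O}) y := fun y hy => (hf' (p, y) hy.2 hy.1).mono inter_subset_left
    have key := (contDiffOn_succ_iff_fderivWithin (n := n) (hs.inter hU)).2
      ⟨fun y hy => (hd y hy).differentiableWithinAt, fun h => by simp at h,
        (ih hn).congr fun y hy => (hd y hy).fderivWithin ((hs.inter hU) y hy)⟩
    exact_mod_cast key

/-- The integral of a family over a compact parameter space is smooth, and can be differentiated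
under the integral. -/
theorem ParamDiff.hasFDerivAt_integral [CompactSpace P] [MeasurableSpace P] [OpensMeasurableSpace P]
    {ν : Measure P} [IsFiniteMeasure ν] {U : Set E} (hU : IsOpen U) [LocallyCompactSpace E]
    [CompleteSpace F]
    {f : P × E → F} {f' : P × E → (E →L[ℝ] F)} (hf : ContinuousOn f (univ ×ˢ U))
    (hf' : ∀ w, w.2 ∈ U → HasFDerivAt (fun y => f (w.1, y)) (f' w) w.2)
    (hc : ContinuousOn f' (univ ×ˢ U)) {y : E} (hy : y ∈ U) :
    HasFDerivAt (fun y => ∫ p, f (p, y) ∂ν) (∫ p, f' (p, y) ∂ν) y := by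
  obtain ⟨K, hK, hKU, hKc⟩ := local_compact_nhds (hU.mem_nhds hy)
  have hslice : ∀ {G : Type u} [NormedAddCommGroup G] {f : P × E → G},
      ContinuousOn f (univ ×ˢ U) → ∀ y ∈ U, Continuous fun p => f (p, y) := fun hf y hy =>
    continuousOn_univ.1 (hf.comp (Continuous.prodMk_left y).continuousOn fun p _ => ⟨mem_univ _, hy⟩)
  have hmeas : ∀ {G : Type u} [NormedAddCommGroup G] {g : P → G}, Continuous g →
      AEStronglyMeasurable g ν := fun hg =>
    (hg.stronglyMeasurable_of_hasCompactSupport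
      (HasCompactSupport.of_compactSpace _)).aestronglyMeasurable
  obtain ⟨C, hC⟩ := (isCompact_univ.prod hKc).exists_bound_of_continuousOn
    (hc.mono (prod_mono_right hKU))
  refine hasFDerivAt_integral_of_dominated_of_fderiv_le (F' := fun y p => f' (p, y))
    (bound := fun _ => C) (s := interior K) (isOpen_interior.mem_nhds (mem_interior_iff_mem_nhds.2 hK))
    ?_ ?_ (hmeas (hslice hc y hy)) ?_ (integrable_const C) ?_
  · filter_upwards [hU.mem_nhds hy] with z hz using hmeas (hslice hf z hz)
  · exact (hslice hf y hy).integrable_of_hasCompactSupport (HasCompactSupport.of_compactSpace _)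
  · exact Eventually.of_forall fun p z hz => hC (p, z) ⟨mem_univ _, interior_subset hz⟩
  · exact Eventually.of_forall fun p z hz => hf' (p, z) (hKU (interior_subset hz))

theorem ParamDiff.contDiffOn_integral [CompactSpace P] [MeasurableSpace P]
    [OpensMeasurableSpace P] {ν : Measure P} [IsFiniteMeasure ν] {U : Set E} (hU : IsOpen U)
    [LocallyCompactSpace E] [CompleteSpace F] {f : P × E → F}
    (hf : ParamDiff univ (univ ×ˢ U) n f) :
    ContDiffOn ℝ n (fun y => ∫ p, f (p, y) ∂ν) U := by
  have hslice : ∀ {G : Type u} [NormedAddCommGroup G] {f : P × E → G},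
      ContinuousOn f ((univ ×ˢ U) ∩ Prod.snd ⁻¹' univ) → ContinuousOn f (univ ×ˢ U) := by
    intro G _ f hf
    simpa using hf
  induction n generalizing F with
  | zero =>
    refine contDiffOn_zero.2 fun y hy => ?_
    have hf0 := hslice hf.continuousOn
    obtain ⟨K, hK, hKU, hKc⟩ := local_compact_nhds (hU.mem_nhds hy)
    obtain ⟨C, hC⟩ := (isCompact_univ.prod hKc).exists_bound_of_continuousOn
      (hf0.mono (prod_mono_right hKU))
    refine ContinuousAt.continuousWithinAt (continuousAt_of_dominated (bound := fun _ => C)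
      ?_ ?_ (integrable_const C) ?_)
    · filter_upwards [hU.mem_nhds hy] with z hz
      exact (Continuous.stronglyMeasurable_of_hasCompactSupport (continuousOn_univ.1 (hf0.comp
        (Continuous.prodMk_left z).continuousOn fun p _ => ⟨mem_univ _, hz⟩))
        (HasCompactSupport.of_compactSpace _)).aestronglyMeasurable
    · filter_upwards [hK] with z hz
      exact Eventually.of_forall fun p => hC (p, z) ⟨mem_univ _, hz⟩
    · refine Eventually.of_forall fun p => ?_
      exact ((hf0 (p, y) ⟨mem_univ _, hy⟩).continuousAt
        ((isOpen_univ.prod hU).mem_nhds ⟨mem_univ _, hy⟩)).comp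
        (Continuous.prodMk_right p).continuousAt
  | succ n ih =>
    obtain ⟨h0, f', hf', hn⟩ := hf
    have hd : ∀ y ∈ U, HasFDerivAt (fun y => ∫ p, f (p, y) ∂ν) (∫ p, f' (p, y) ∂ν) y :=
      fun y hy => ParamDiff.hasFDerivAt_integral hU (hslice h0)
        (fun w hw => hasFDerivWithinAt_univ.1 (hf' w ⟨mem_univ _, hw⟩ (mem_univ _)))
        (hslice hn.continuousOn) hy
    have key := (contDiffOn_succ_iff_fderiv_of_isOpen (n := n) hU).2
      ⟨fun y hy => (hd y hy).differentiableAt.differentiableWithinAt, fun h => by simp at h,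
        (ih hn).congr fun y hy => (hd y hy).fderiv⟩
    exact_mod_cast key

end ParamSmooth

/-! ### Isometries in coordinates -/

section LocalRiemannian

set_option synthInstance.maxHeartbeats 200000

variable {E : Type*} [NormedAddCommGroup E] [NormedSpace ℝ E]

instance instNormedAddCommGroupBilin : NormedAddCommGroup (E →L[ℝ] E →L[ℝ] ℝ) :=
  ContinuousLinearMap.toNormedAddCommGroup

instance instNormedSpaceBilin : NormedSpace ℝ (E →L[ℝ] E →L[ℝ] ℝ) :=
  ContinuousLinearMap.toNormedSpace

instance instNormedAddCommGroupTrilin : NormedAddCommGroup (E →L[ℝ] E →L[ℝ] E →L[ℝ] ℝ) :=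
  ContinuousLinearMap.toNormedAddCommGroup

instance instNormedSpaceTrilin : NormedSpace ℝ (E →L[ℝ] E →L[ℝ] E →L[ℝ] ℝ) :=
  ContinuousLinearMap.toNormedSpace

instance instNormedAddCommGroupBilinSelf : NormedAddCommGroup (E →L[ℝ] E →L[ℝ] E) :=
  ContinuousLinearMap.toNormedAddCommGroup

instance instNormedSpaceBilinSelf : NormedSpace ℝ (E →L[ℝ] E →L[ℝ] E) :=
  ContinuousLinearMap.toNormedSpace

/-- The operation `T ↦ ((u, v, w) ↦ T u v w + T v u w - T w u v)`. -/
def koszulCLM : (E →L[ℝ] E →L[ℝ] E →L[ℝ] ℝ) →L[ℝ] (E →L[ℝ] E →L[ℝ] E →L[ℝ] ℝ) :=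
  let L : (E →L[ℝ] E →L[ℝ] E →L[ℝ] ℝ) →L[ℝ] (E →L[ℝ] E →L[ℝ] E →L[ℝ] ℝ) :=
    (ContinuousLinearMap.flipₗᵢ ℝ E E (E →L[ℝ] ℝ)).toContinuousLinearEquiv
  let L' : (E →L[ℝ] E →L[ℝ] ℝ) →L[ℝ] (E →L[ℝ] E →L[ℝ] ℝ) :=
    (ContinuousLinearMap.flipₗᵢ ℝ E E ℝ).toContinuousLinearEquiv
  .id ℝ _ + L - (ContinuousLinearMap.compL ℝ E _ _ L').comp L

@[simp]
theorem koszulCLM_apply (T : E →L[ℝ] E →L[ℝ] E →L[ℝ] ℝ) (u v w : E) :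
    koszulCLM T u v w = T u v w + T v u w - T w u v := rfl

/-- The Christoffel symbols of the metric with coefficients `G`. -/
def christoffel (s : Set E) (G : E → E →L[ℝ] E →L[ℝ] ℝ) (x : E) : E →L[ℝ] E →L[ℝ] E :=
  (ContinuousLinearMap.compL ℝ E (E →L[ℝ] ℝ) E ((2⁻¹ : ℝ) • (G x).inverse)).comp
    (koszulCLM (fderivWithin ℝ G s x))

theorem isInvertible_of_posDef [FiniteDimensional ℝ E] {B : E →L[ℝ] E →L[ℝ] ℝ}
    (hB : ∀ v, v ≠ 0 → 0 < B v v) : B.IsInvertible := by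
  have hinj : Function.Injective B := by
    refine (injective_iff_map_eq_zero B).2 fun v hv => ?_
    by_contra h
    have := hB v h
    simp [hv] at this
  have hfin : Module.finrank ℝ E = Module.finrank ℝ (E →L[ℝ] ℝ) := by
    rw [← (LinearMap.toContinuousLinearMap (𝕜 := ℝ) (E := E) (F' := ℝ)).finrank_eq]
    exact (Subspace.dual_finrank_eq (K := ℝ) (V := E)).symm
  let e : E ≃ₗ[ℝ] (E →L[ℝ] ℝ) :=
    LinearEquiv.ofInjectiveOfFinrankEq (B : E →ₗ[ℝ] (E →L[ℝ] ℝ)) hinj hfin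
  refine ⟨e.toContinuousLinearEquiv, ?_⟩
  ext v w
  rfl

theorem apply_christoffel [FiniteDimensional ℝ E] {s : Set E} {G : E → E →L[ℝ] E →L[ℝ] ℝ} {x : E}
    (hG : ∀ v, v ≠ 0 → 0 < G x v v) (u v w : E) :
    2 * G x (christoffel s G x u v) w = koszulCLM (fderivWithin ℝ G s x) u v w := by
  have h := (isInvertible_of_posDef hG).self_apply_inverse (koszulCLM (fderivWithin ℝ G s x) u v)
  have : christoffel s G x u v =
    (2⁻¹ : ℝ) • (G x).inverse (koszulCLM (fderivWithin ℝ G s x) u v) := rfl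
  rw [this, map_smul, h]
  simp

/-- The second derivative of an isometry, in terms of its first derivative `A` and the Christoffel
symbols of the source and of the target. -/
def isometrySnd (Γ₁ Γ₂ : E →L[ℝ] E →L[ℝ] E) (A : E →L[ℝ] E) : E →L[ℝ] E →L[ℝ] E :=
  (ContinuousLinearMap.compL ℝ E E E A).comp Γ₁ -
    ((ContinuousLinearMap.compL ℝ E E E).flip A).comp (Γ₂.comp A)

@[simp]
theorem isometrySnd_apply (Γ₁ Γ₂ : E →L[ℝ] E →L[ℝ] E) (A : E →L[ℝ] E) (a b : E) :
    isometrySnd Γ₁ Γ₂ A a b = A (Γ₁ a b) - Γ₂ (A a) (A b) := rfl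

theorem hasFDerivWithinAt_of_isometry [FiniteDimensional ℝ E] {s t : Set E}
    {G H : E → E →L[ℝ] E →L[ℝ] ℝ} {u : E → E} {x : E} (hs : UniqueDiffOn ℝ s) (hx : x ∈ s)
    (hxs : x ∈ closure (interior s)) (hu : ContDiffWithinAt ℝ 2 u s x)
    (hG : DifferentiableWithinAt ℝ G s x) (hH : DifferentiableWithinAt ℝ H t (u x))
    (hG₀ : ∀ v, v ≠ 0 → 0 < G x v v) (hH₀ : ∀ v, v ≠ 0 → 0 < H (u x) v v)
    (hH₁ : ∀ v w, H (u x) v w = H (u x) w v)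
    (hut : ∀ᶠ z in 𝓝[s] x, u z ∈ t)
    (hiso : ∀ᶠ z in 𝓝[s] x, ∀ v w,
      H (u z) (fderivWithin ℝ u s z v) (fderivWithin ℝ u s z w) = G z v w) :
    HasFDerivWithinAt (fderivWithin ℝ u s) (isometrySnd (christoffel s G x) (christoffel t H (u x))
      (fderivWithin ℝ u s x)) s x := by
  set A := fderivWithin ℝ u s x with hA
  set D := fderivWithin ℝ (fderivWithin ℝ u s) s x with hD
  have hisox : ∀ v w, H (u x) (A v) (A w) = G x v w := hiso.self_of_nhdsWithin hx
  have hdu : HasFDerivWithinAt u A s x :=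
    (hu.differentiableWithinAt (by simp)).hasFDerivWithinAt
  have hdA : HasFDerivWithinAt (fderivWithin ℝ u s) D s x :=
    ((hu.fderivWithin_right hs (m := 1) (by norm_num) hx).differentiableWithinAt
      (by simp)).hasFDerivWithinAt
  have hsymm : ∀ a b, D a b = D b a := hu.isSymmSndFDerivWithinAt (by simp) hs hxs hx
  have hHu : HasFDerivWithinAt (fun z => H (u z)) ((fderivWithin ℝ H t (u x)).comp A) s x := by
    have := hH.hasFDerivWithinAt.comp x (hdu.mono (inter_subset_left (t := u ⁻¹' t)))
      fun z hz => hz.2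
    exact this.mono_of_mem_nhdsWithin (inter_mem self_mem_nhdsWithin hut)
  set TG := fderivWithin ℝ G s x
  set TH := fderivWithin ℝ H t (u x)
  have key : ∀ c v w, TH (A c) (A v) (A w) + H (u x) (D c v) (A w) + H (u x) (A v) (D c w) =
      TG c v w := by
    intro c v w
    have h1 := (hHu.clm_apply (hdA.clm_apply (hasFDerivWithinAt_const v x s))).clm_apply
      (hdA.clm_apply (hasFDerivWithinAt_const w x s))
    have h2 := (hG.hasFDerivWithinAt.clm_apply (hasFDerivWithinAt_const v x s)).clm_apply
      (hasFDerivWithinAt_const w x s)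
    have h3 := h2.congr_of_eventuallyEq (hiso.mono fun z hz => hz v w) (hisox v w)
    have h4 := (hs x hx).eq h1 h3
    have h5 := congrArg (fun L : E →L[ℝ] ℝ => L c) h4
    simp at h5
    linarith
  have hAinj : Function.Injective A := by
    refine (injective_iff_map_eq_zero A).2 fun v hv => ?_
    by_contra h
    have h1 := hG₀ v h
    rw [← hisox, hv] at h1
    simp at h1
  have hAsurj : Function.Surjective A :=
    (LinearMap.injective_iff_surjective (f := (A : E →ₗ[ℝ] E))).1 hAinj
  have hfinal : D = isometrySnd (christoffel s G x) (christoffel t H (u x)) A := by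
    ext a b
    have hzero : ∀ w, H (u x) (D a b - isometrySnd (christoffel s G x)
        (christoffel t H (u x)) A a b) (A w) = 0 := by
      intro w
      have e1 := apply_christoffel (s := s) hG₀ a b w
      have e2 := apply_christoffel (s := t) hH₀ (A a) (A b) (A w)
      rw [koszulCLM_apply] at e1 e2
      rw [← hisox] at e1
      have k1 := key a b w
      have k2 := key b a w
      have k3 := key w a b
      rw [isometrySnd_apply, map_sub, map_sub]
      simp only [sub_apply]
      rw [hH₁ (A b) (D a w)] at k1
      rw [hsymm b a, hH₁ (A a) (D b w)] at k2
      rw [hsymm w a, hsymm w b, hH₁ (A a) (D b w)] at k3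
      linarith
    set d := D a b - isometrySnd (christoffel s G x) (christoffel t H (u x)) A a b with hd
    obtain ⟨w, hw⟩ := hAsurj d
    have := hzero w
    rw [hw] at this
    by_contra hne
    have hd0 : d ≠ 0 := fun h => hne (sub_eq_zero.1 h)
    exact (hH₀ d hd0).ne' this
  rw [← hfinal]
  exact hdA

/-- Derivatives pass to pointwise limits of equicontinuous families. -/
theorem hasFDerivWithinAt_of_tendsto {F ι : Type*} [NormedAddCommGroup F] [NormedSpace ℝ F]
    {𝓛 : Filter ι} [NeBot 𝓛] {B : Set E} (hB : Convex ℝ B) {u : ι → E → F} {A : ι → E → E →L[ℝ] F}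
    {v : E → F} {A' : E → E →L[ℝ] F} {y : E} (hy : y ∈ B)
    (hu : ∀ᶠ i in 𝓛, ∀ z ∈ B, HasFDerivWithinAt (u i) (A i z) B z)
    (hv : ∀ z ∈ B, Tendsto (fun i => u i z) 𝓛 (𝓝 (v z)))
    (hA : Tendsto (fun i => A i y) 𝓛 (𝓝 (A' y)))
    (heq : ∀ ε > 0, ∃ δ > 0, ∀ᶠ i in 𝓛, ∀ z ∈ B, ‖z - y‖ < δ → ‖A i z - A i y‖ ≤ ε) :
    HasFDerivWithinAt v (A' y) B y := by
  rw [hasFDerivWithinAt_iff_isLittleO, Asymptotics.isLittleO_iff]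
  intro ε hε
  obtain ⟨δ, hδ, h⟩ := heq ε hε
  have hball : ∀ᶠ z in 𝓝[B] y, z ∈ B ∩ Metric.ball y δ :=
    inter_mem self_mem_nhdsWithin (nhdsWithin_le_nhds (Metric.ball_mem_nhds y hδ))
  filter_upwards [hball] with z hz
  have hest : ∀ᶠ i in 𝓛, ‖u i z - u i y - A i y (z - y)‖ ≤ ε * ‖z - y‖ := by
    filter_upwards [h, hu] with i hi hui
    have hconv : Convex ℝ (B ∩ Metric.ball y δ) := hB.inter (convex_ball y δ)
    exact hconv.norm_image_sub_le_of_norm_hasFDerivWithin_le'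
      (fun w hw => (hui w hw.1).mono inter_subset_left)
      (fun w hw => hi w hw.1 (mem_ball_iff_norm.1 hw.2)) ⟨hy, Metric.mem_ball_self hδ⟩ hz
  refine le_of_tendsto ?_ hest
  have hAz : Tendsto (fun i => A i y (z - y)) 𝓛 (𝓝 (A' y (z - y))) :=
    ((ContinuousLinearMap.apply ℝ F (z - y)).continuous.tendsto _).comp hA
  exact (((hv z hz.1).sub (hv y hy)).sub hAz).norm

/-- `u` solves the equation for isometries on `B`, with values in `C` and with derivative `A`
bounded by `R`. -/
structure SolvesIsometry (B C : Set E) (Γ₁ Γ₂ : E → E →L[ℝ] E →L[ℝ] E) (R : ℝ) (u : E → E)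
    (A : E → E →L[ℝ] E) : Prop where
  mem : ∀ y ∈ B, u y ∈ C
  norm_le : ∀ y ∈ B, ‖A y‖ ≤ R
  fst : ∀ y ∈ B, HasFDerivWithinAt u (A y) B y
  snd : ∀ y ∈ B, HasFDerivWithinAt A (isometrySnd (Γ₁ y) (Γ₂ (u y)) (A y)) B y

theorem Filter.Tendsto.clm_bilin {ι F F' F'' : Type*} [NormedAddCommGroup F] [NormedSpace ℝ F]
    [NormedAddCommGroup F'] [NormedSpace ℝ F'] [NormedAddCommGroup F''] [NormedSpace ℝ F'']
    (B : F →L[ℝ] F' →L[ℝ] F'') {l : Filter ι} {f : ι → F} {g : ι → F'} {a : F} {b : F'}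
    (hf : Tendsto f l (𝓝 a)) (hg : Tendsto g l (𝓝 b)) :
    Tendsto (fun i => B (f i) (g i)) l (𝓝 (B a b)) :=
  (B.continuous₂.tendsto (a, b)).comp (hf.prodMk_nhds hg)

set_option maxHeartbeats 1000000 in
theorem Filter.Tendsto.isometrySnd {ι : Type*} {l : Filter ι} {Γ₁ Γ₂ : ι → E →L[ℝ] E →L[ℝ] E}
    {A : ι → E →L[ℝ] E} {Γ₁' Γ₂' : E →L[ℝ] E →L[ℝ] E} {A' : E →L[ℝ] E}
    (h₁ : Tendsto Γ₁ l (𝓝 Γ₁')) (h₂ : Tendsto Γ₂ l (𝓝 Γ₂')) (hA : Tendsto A l (𝓝 A')) :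
    Tendsto (fun i => isometrySnd (Γ₁ i) (Γ₂ i) (A i)) l (𝓝 (isometrySnd Γ₁' Γ₂' A')) := by
  have e₁ : Tendsto (fun i => (ContinuousLinearMap.compL ℝ E E E (A i)).comp (Γ₁ i)) l
      (𝓝 ((ContinuousLinearMap.compL ℝ E E E A').comp Γ₁')) :=
    Filter.Tendsto.clm_bilin (F := (E →L[ℝ] E) →L[ℝ] (E →L[ℝ] E)) (F' := E →L[ℝ] (E →L[ℝ] E))
      (ContinuousLinearMap.compL ℝ E (E →L[ℝ] E) (E →L[ℝ] E))
      (((ContinuousLinearMap.compL ℝ E E E).continuous.tendsto A').comp hA) h₁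
  have e₂ : Tendsto (fun i => (Γ₂ i).comp (A i)) l (𝓝 (Γ₂'.comp A')) :=
    Filter.Tendsto.clm_bilin (F := E →L[ℝ] (E →L[ℝ] E)) (F' := E →L[ℝ] E)
      (ContinuousLinearMap.compL ℝ E E (E →L[ℝ] E)) h₂ hA
  have e₃ : Tendsto
      (fun i => ((ContinuousLinearMap.compL ℝ E E E).flip (A i)).comp ((Γ₂ i).comp (A i))) l
      (𝓝 (((ContinuousLinearMap.compL ℝ E E E).flip A').comp (Γ₂'.comp A'))) :=
    Filter.Tendsto.clm_bilin (F := (E →L[ℝ] E) →L[ℝ] (E →L[ℝ] E)) (F' := E →L[ℝ] (E →L[ℝ] E))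
      (ContinuousLinearMap.compL ℝ E (E →L[ℝ] E) (E →L[ℝ] E))
      (((ContinuousLinearMap.compL ℝ E E E).flip.continuous.tendsto A').comp hA) e₂
  exact e₁.sub e₃

theorem continuousOn_isometrySnd {Kb C : Set E} {Γ₁ Γ₂ : E → E →L[ℝ] E →L[ℝ] E} {R : ℝ}
    (h₁ : ContinuousOn Γ₁ Kb) (h₂ : ContinuousOn Γ₂ C) :
    ContinuousOn (fun p : E × E × (E →L[ℝ] E) => isometrySnd (Γ₁ p.1) (Γ₂ p.2.1) p.2.2)
      (Kb ×ˢ C ×ˢ Metric.closedBall 0 R) := by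
  have h₁' := h₁.comp (continuousOn_fst (s := Kb ×ˢ C ×ˢ Metric.closedBall (0 : E →L[ℝ] E) R))
    fun p hp => hp.1
  have h₂' := h₂.comp ((continuous_fst.comp continuous_snd).continuousOn
    (s := Kb ×ˢ C ×ˢ Metric.closedBall (0 : E →L[ℝ] E) R)) fun p hp => hp.2.1
  intro p hp
  exact Filter.Tendsto.isometrySnd (h₁' p hp) (h₂' p hp)
    ((continuous_snd.comp continuous_snd).continuousWithinAt)

variable [FiniteDimensional ℝ E] {B Kb C : Set E} {Γ₁ Γ₂ : E → E →L[ℝ] E →L[ℝ] E} {R : ℝ}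

theorem SolvesIsometry.exists_lipschitz (hB : Convex ℝ B) (hBK : B ⊆ Kb) (hKb : IsCompact Kb)
    (hC : IsCompact C) (h₁ : ContinuousOn Γ₁ Kb) (h₂ : ContinuousOn Γ₂ C) :
    ∃ L : ℝ, 0 ≤ L ∧ ∀ u A, SolvesIsometry B C Γ₁ Γ₂ R u A → ∀ y ∈ B, ∀ z ∈ B,
      ‖A z - A y‖ ≤ L * ‖z - y‖ ∧ ‖u z - u y‖ ≤ |R| * ‖z - y‖ := by
  have : ProperSpace (E →L[ℝ] E) := FiniteDimensional.proper ℝ _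
  obtain ⟨L, hL⟩ := (hKb.prod (hC.prod (isCompact_closedBall (0 : E →L[ℝ] E) R))).exists_bound_of_continuousOn
    (f := fun p : E × E × (E →L[ℝ] E) => isometrySnd (Γ₁ p.1) (Γ₂ p.2.1) p.2.2)
    (continuousOn_isometrySnd h₁ h₂)
  refine ⟨|L|, abs_nonneg _, fun u A h y hy z hz => ⟨?_, ?_⟩⟩
  · refine hB.norm_image_sub_le_of_norm_hasFDerivWithin_le (fun w hw => h.snd w hw)
      (fun w hw => ?_) hy hz
    exact (hL (w, u w, A w) ⟨hBK hw, h.mem w hw, by simpa using h.norm_le w hw⟩).trans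
      (le_abs_self L)
  · exact hB.norm_image_sub_le_of_norm_hasFDerivWithin_le (fun w hw => h.fst w hw)
      (fun w hw => (h.norm_le w hw).trans (le_abs_self R)) hy hz

/-- Pointwise limits of solutions of the equation for isometries are solutions. -/
theorem SolvesIsometry.exists_limit {ι : Type*} (𝒰 : Ultrafilter ι) (hB : Convex ℝ B) (hBK : B ⊆ Kb)
    (hKb : IsCompact Kb) (hC : IsCompact C) (h₁ : ContinuousOn Γ₁ Kb) (h₂ : ContinuousOn Γ₂ C)
    {u : ι → E → E} {A : ι → E → E →L[ℝ] E} {v : E → E}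
    (h : ∀ᶠ i in (𝒰 : Filter ι), SolvesIsometry B C Γ₁ Γ₂ R (u i) (A i))
    (hv : ∀ y ∈ B, Tendsto (fun i => u i y) 𝒰 (𝓝 (v y))) :
    ∃ A' : E → E →L[ℝ] E, SolvesIsometry B C Γ₁ Γ₂ R v A' ∧
      ∀ y ∈ B, Tendsto (fun i => A i y) 𝒰 (𝓝 (A' y)) := by
  have hprop : ProperSpace (E →L[ℝ] E) := FiniteDimensional.proper ℝ _
  obtain ⟨L, hL0, hL⟩ := SolvesIsometry.exists_lipschitz (R := R) hB hBK hKb hC h₁ h₂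
  have hlim : ∀ y ∈ B, ∃ a ∈ Metric.closedBall (0 : E →L[ℝ] E) R,
      Tendsto (fun i => A i y) 𝒰 (𝓝 a) := by
    intro y hy
    have hmem : ∀ᶠ i in (𝒰 : Filter ι), A i y ∈ Metric.closedBall (0 : E →L[ℝ] E) R :=
      h.mono fun i hi => by simpa using hi.norm_le y hy
    obtain ⟨a, ha, hle⟩ := (isCompact_closedBall (0 : E →L[ℝ] E) R).ultrafilter_le_nhds
      (𝒰.map fun i => A i y) (le_principal_iff.2 hmem)
    exact ⟨a, ha, hle⟩
  choose! A' hA'R hA' using hlim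
  have hvC : ∀ y ∈ B, v y ∈ C := fun y hy =>
    hC.isClosed.mem_of_tendsto (hv y hy) (h.mono fun i hi => hi.mem y hy)
  have hunif := ((hKb.prod (hC.prod (isCompact_closedBall (0 : E →L[ℝ] E) R))).uniformContinuousOn_of_continuous
    (f := fun p : E × E × (E →L[ℝ] E) => isometrySnd (Γ₁ p.1) (Γ₂ p.2.1) p.2.2)
    (continuousOn_isometrySnd h₁ h₂))
  rw [Metric.uniformContinuousOn_iff] at hunif
  refine ⟨A', ⟨hvC, fun y hy => by simpa using hA'R y hy, fun y hy => ?_, fun y hy => ?_⟩, hA'⟩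
  · refine hasFDerivWithinAt_of_tendsto hB hy (h.mono fun i hi => hi.fst) hv (hA' y hy)
      fun ε hε => ⟨ε / (L + 1), by positivity, h.mono fun i hi z hz hzy => ?_⟩
    refine (hL _ _ hi y hy z hz).1.trans ?_
    rw [lt_div_iff₀ (by positivity)] at hzy
    nlinarith [norm_nonneg (z - y)]
  · have hsnd : Tendsto (fun i => isometrySnd (Γ₁ y) (Γ₂ (u i y)) (A i y)) 𝒰
        (𝓝 (isometrySnd (Γ₁ y) (Γ₂ (v y)) (A' y))) := by
      have hΓ : Tendsto (fun i => Γ₂ (u i y)) 𝒰 (𝓝 (Γ₂ (v y))) :=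
        (h₂ (v y) (hvC y hy)).tendsto.comp (tendsto_nhdsWithin_iff.2
          ⟨hv y hy, h.mono fun i hi => hi.mem y hy⟩)
      exact Filter.Tendsto.isometrySnd tendsto_const_nhds hΓ (hA' y hy)
    refine hasFDerivWithinAt_of_tendsto (A := fun i z => isometrySnd (Γ₁ z) (Γ₂ (u i z)) (A i z))
      (A' := fun z => isometrySnd (Γ₁ z) (Γ₂ (v z)) (A' z)) hB hy (h.mono fun i hi => hi.snd) hA'
      hsnd fun ε hε => ?_
    obtain ⟨δ, hδ, hu⟩ := hunif ε hε
    refine ⟨δ / (L + |R| + 1), by positivity, h.mono fun i hi z hz hzy => ?_⟩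
    have hmem : ∀ w ∈ B, (w, u i w, A i w) ∈ Kb ×ˢ C ×ˢ Metric.closedBall (0 : E →L[ℝ] E) R :=
      fun w hw => ⟨hBK hw, hi.mem w hw, by simpa using hi.norm_le w hw⟩
    have h3 := hL _ _ hi y hy z hz
    rw [lt_div_iff₀ (by positivity)] at hzy
    have h0 := norm_nonneg (z - y)
    have hR := abs_nonneg R
    have hdist : dist (z, u i z, A i z) (y, u i y, A i y) < δ := by
      rw [Prod.dist_eq, Prod.dist_eq, dist_eq_norm, dist_eq_norm, dist_eq_norm, max_lt_iff,
        max_lt_iff]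
      refine ⟨?_, ?_, ?_⟩ <;> nlinarith [mul_nonneg hL0 h0, mul_nonneg hR h0]
    have := hu _ (hmem z hz) _ (hmem y hy) hdist
    rw [dist_eq_norm] at this
    exact this.le

end LocalRiemannian

section Param

set_option synthInstance.maxHeartbeats 200000

universe u v

variable {P : Type v} [TopologicalSpace P] {E : Type u}
  [NormedAddCommGroup E] [NormedSpace ℝ E] {s : Set E} {O : Set (P × E)} {n : ℕ}

theorem ParamDiff.isometrySnd {Γ₁ Γ₂ : P × E → E →L[ℝ] E →L[ℝ] E} {A : P × E → E →L[ℝ] E}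
    (h₁ : ParamDiff s O n Γ₁) (h₂ : ParamDiff s O n Γ₂) (hA : ParamDiff s O n A) :
    ParamDiff s O n (fun w => isometrySnd (Γ₁ w) (Γ₂ w) (A w)) := by
  have e₁ : ParamDiff s O n (fun w => (ContinuousLinearMap.compL ℝ E E E (A w)).comp (Γ₁ w)) :=
    ParamDiff.bilin (F := (E →L[ℝ] E) →L[ℝ] (E →L[ℝ] E)) (F' := E →L[ℝ] (E →L[ℝ] E))
      (ContinuousLinearMap.compL ℝ E (E →L[ℝ] E) (E →L[ℝ] E))
      (hA.clm (ContinuousLinearMap.compL ℝ E E E)) h₁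
  have e₂ : ParamDiff s O n (fun w => (Γ₂ w).comp (A w)) :=
    ParamDiff.bilin (F := E →L[ℝ] (E →L[ℝ] E)) (F' := E →L[ℝ] E)
      (ContinuousLinearMap.compL ℝ E E (E →L[ℝ] E)) h₂ hA
  have e₃ : ParamDiff s O n
      (fun w => ((ContinuousLinearMap.compL ℝ E E E).flip (A w)).comp ((Γ₂ w).comp (A w))) :=
    ParamDiff.bilin (F := (E →L[ℝ] E) →L[ℝ] (E →L[ℝ] E)) (F' := E →L[ℝ] (E →L[ℝ] E))
      (ContinuousLinearMap.compL ℝ E (E →L[ℝ] E) (E →L[ℝ] E))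
      (hA.clm (ContinuousLinearMap.compL ℝ E E E).flip) e₂
  exact e₁.sub e₃

theorem contDiffOn_christoffel [FiniteDimensional ℝ E] {G : E → E →L[ℝ] E →L[ℝ] ℝ} {t : Set E}
    (hs : UniqueDiffOn ℝ s) (ht : ∀ x ∈ t, t ∈ 𝓝[s] x) (hts : t ⊆ s) (hG : ContDiffOn ℝ ∞ G t)
    (hG₀ : ∀ x ∈ t, ∀ v, v ≠ 0 → 0 < G x v v) : ContDiffOn ℝ ∞ (christoffel s G) t := by
  intro x hx
  have hD : ContDiffWithinAt ℝ ∞ (fderivWithin ℝ G s) t x :=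
    ((((hG x hx).mono_of_mem_nhdsWithin (ht x hx)).fderivWithin_right hs (m := ∞) (by simp)
      (hts hx))).mono hts
  have hinv : ContDiffWithinAt ℝ ∞ (fun x => (G x).inverse) t x := by
    have hc := isInvertible_of_posDef (hG₀ x hx)
    obtain ⟨e, he⟩ := hc
    have := contDiffAt_map_inverse (n := ∞) e
    rw [he] at this
    exact this.comp_contDiffWithinAt x (hG x hx)
  have h1 : ContDiffWithinAt ℝ ∞ (fun x => koszulCLM (fderivWithin ℝ G s x)) t x :=
    koszulCLM.contDiff.contDiffAt.comp_contDiffWithinAt x hD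
  have h2 : ContDiffWithinAt ℝ ∞ (fun x => ContinuousLinearMap.compL ℝ E (E →L[ℝ] ℝ) E
      ((2⁻¹ : ℝ) • (G x).inverse)) t x := by
    exact (ContinuousLinearMap.compL ℝ E (E →L[ℝ] ℝ) E).contDiff.contDiffAt.comp_contDiffWithinAt
      (f := fun x => (2⁻¹ : ℝ) • (G x).inverse) x (hinv.const_smul (2⁻¹ : ℝ))
  exact h2.clm_comp h1

end Param

/-! ### Maps and metrics in charts -/

section Charts

variable {E : Type*} [NormedAddCommGroup E] [NormedSpace ℝ E]
  {H : Type*} [TopologicalSpace H] (J : ModelWithCorners ℝ E H)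
  {N : Type*} [TopologicalSpace N] [ChartedSpace H N]

/-- The expression of `f` in the charts at `x₀` and `y₀`. -/
def chartExpr (x₀ y₀ : N) (f : N → N) (y : E) : E :=
  extChartAt J y₀ (f ((extChartAt J x₀).symm y))

/-- The derivative of the inverse of the chart at `x₀`. -/
def chartSymmDeriv (x₀ : N) (y : E) : E →L[ℝ] E :=
  mfderivWithin 𝓘(ℝ, E) J (extChartAt J x₀).symm (range J) y

/-- The derivative of the chart at `x₀`. -/
def chartDeriv (x₀ x : N) : E →L[ℝ] E := mfderiv J 𝓘(ℝ, E) (extChartAt J x₀) x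

/-- The derivative of `f`, as a map between model spaces. -/
def modelDeriv (f : N → N) (x : N) : E →L[ℝ] E := mfderiv J J f x

theorem range_mem_nhdsWithin_target {x₀ : N} {y : E} (hy : y ∈ (extChartAt J x₀).target) :
    (extChartAt J x₀).target ∈ 𝓝[range J] y :=
  extChartAt_target_mem_nhdsWithin_of_mem hy

theorem eventually_chart_mem {x₀ y₀ : N} {f : N → N} {y : E} (hy : y ∈ (extChartAt J x₀).target)
    (hf : ContinuousAt f ((extChartAt J x₀).symm y))
    (hfy : f ((extChartAt J x₀).symm y) ∈ (extChartAt J y₀).source) :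
    ∀ᶠ z in 𝓝[range J] y, z ∈ (extChartAt J x₀).target ∧
      f ((extChartAt J x₀).symm z) ∈ (extChartAt J y₀).source := by
  have h0 : ∀ᶠ z in 𝓝[range J] y, z ∈ (extChartAt J x₀).target := range_mem_nhdsWithin_target J hy
  have h1 : ContinuousAt (extChartAt J x₀).symm y := continuousAt_extChartAt_symm'' hy
  have h2 := hf.comp h1
  filter_upwards [h0, nhdsWithin_le_nhds (h2 ((isOpen_extChartAt_source y₀).mem_nhds hfy))]
    with z hz hz' using ⟨hz, hz'⟩

/-- The coefficients of a metric in the chart at `x₀`. -/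
def coordMetric (b : N → E →L[ℝ] E →L[ℝ] ℝ) (x₀ : N) (y : E) : E →L[ℝ] E →L[ℝ] ℝ :=
  (b ((extChartAt J x₀).symm y)).bilinearComp (chartSymmDeriv J x₀ y) (chartSymmDeriv J x₀ y)

@[simp]
theorem coordMetric_apply (b : N → E →L[ℝ] E →L[ℝ] ℝ) (x₀ : N) (y v w : E) :
    coordMetric J b x₀ y v w = b ((extChartAt J x₀).symm y) (chartSymmDeriv J x₀ y v)
      (chartSymmDeriv J x₀ y w) := rfl

variable [IsManifold J ∞ N]

theorem chartDeriv_comp_chartSymmDeriv {x₀ : N} {y : E} (hy : y ∈ (extChartAt J x₀).target) :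
    (chartDeriv J x₀ ((extChartAt J x₀).symm y)).comp (chartSymmDeriv J x₀ y) = .id ℝ E :=
  have : IsManifold J 1 N := .of_le (n := ∞) (by simp)
  mfderiv_extChartAt_comp_mfderivWithin_extChartAt_symm hy

theorem chartSymmDeriv_comp_chartDeriv {x₀ : N} {y : E} (hy : y ∈ (extChartAt J x₀).target) :
    (chartSymmDeriv J x₀ y).comp (chartDeriv J x₀ ((extChartAt J x₀).symm y)) = .id ℝ E :=
  have : IsManifold J 1 N := .of_le (n := ∞) (by simp)
  mfderivWithin_extChartAt_symm_comp_mfderiv_extChartAt hy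

theorem chartSymmDeriv_self (x₀ : N) : chartSymmDeriv J x₀ (extChartAt J x₀ x₀) = .id ℝ E :=
  have : IsManifold J 1 N := .of_le (n := ∞) (by simp)
  mfderivWithin_range_extChartAt_symm

theorem chartDeriv_self (x₀ : N) : chartDeriv J x₀ x₀ = .id ℝ E :=
  have : IsManifold J 1 N := .of_le (n := ∞) (by simp)
  mfderiv_extChartAt_self

theorem chartExpr_contDiffWithinAt {x₀ y₀ : N} {f : N → N} {y : E} {n : ℕ∞ω} (hn : n ≤ ∞)
    (hy : y ∈ (extChartAt J x₀).target) (hf : ContMDiffAt J J n f ((extChartAt J x₀).symm y))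
    (hfy : f ((extChartAt J x₀).symm y) ∈ (extChartAt J y₀).source) :
    ContDiffWithinAt ℝ n (chartExpr J x₀ y₀ f) (range J) y := by
  have : IsManifold J n N := .of_le (n := ∞) hn
  have h := (contMDiffAt_iff_of_mem_source (x := x₀) (y := y₀)
    (by simpa using (extChartAt J x₀).map_target hy) (by simpa using hfy)).1 hf
  rw [(extChartAt J x₀).right_inv hy] at h
  exact h.2

theorem contMDiffAt_of_chartExpr {x₀ y₀ : N} {f : N → N} {y : E} {n : ℕ∞ω} (hn : n ≤ ∞)
    (hy : y ∈ (extChartAt J x₀).target) (hc : ContinuousAt f ((extChartAt J x₀).symm y))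
    (hfy : f ((extChartAt J x₀).symm y) ∈ (extChartAt J y₀).source)
    (hf : ContDiffWithinAt ℝ n (chartExpr J x₀ y₀ f) (range J) y) :
    ContMDiffAt J J n f ((extChartAt J x₀).symm y) := by
  have : IsManifold J n N := .of_le (n := ∞) hn
  refine (contMDiffAt_iff_of_mem_source (x := x₀) (y := y₀)
    (by simpa using (extChartAt J x₀).map_target hy) (by simpa using hfy)).2 ⟨hc, ?_⟩
  rw [(extChartAt J x₀).right_inv hy]
  exact hf

/-- The chain rule for expressions in charts. -/
theorem modelDeriv_comp_chartSymmDeriv {x₀ y₀ : N} {f : N → N} {y : E}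
    (hy : y ∈ (extChartAt J x₀).target)
    (hf : MDifferentiableAt J J f ((extChartAt J x₀).symm y))
    (hfy : f ((extChartAt J x₀).symm y) ∈ (extChartAt J y₀).source) :
    (modelDeriv J f ((extChartAt J x₀).symm y)).comp (chartSymmDeriv J x₀ y) =
      (chartSymmDeriv J y₀ (chartExpr J x₀ y₀ f y)).comp
        (fderivWithin ℝ (chartExpr J x₀ y₀ f) (range J) y) := by
  have : IsManifold J 1 N := .of_le (n := ∞) (by simp)
  have hU : UniqueMDiffWithinAt 𝓘(ℝ, E) (range J) y :=
    J.uniqueMDiffOn _ (extChartAt_target_subset_range x₀ hy)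
  have h1 : MDifferentiableWithinAt 𝓘(ℝ, E) J (extChartAt J x₀).symm (range J) y :=
    mdifferentiableWithinAt_extChartAt_symm hy
  have h2 : MDifferentiableAt J 𝓘(ℝ, E) (extChartAt J y₀) (f ((extChartAt J x₀).symm y)) :=
    mdifferentiableAt_extChartAt (by simpa using hfy)
  have h3 : fderivWithin ℝ (chartExpr J x₀ y₀ f) (range J) y =
      (chartDeriv J y₀ (f ((extChartAt J x₀).symm y))).comp
        ((modelDeriv J f ((extChartAt J x₀).symm y)).comp (chartSymmDeriv J x₀ y)) := by
    rw [← mfderivWithin_eq_fderivWithin]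
    have e1 : mfderivWithin 𝓘(ℝ, E) J (f ∘ (extChartAt J x₀).symm) (range J) y =
        (mfderiv J J f ((extChartAt J x₀).symm y)).comp
          (mfderivWithin 𝓘(ℝ, E) J (extChartAt J x₀).symm (range J) y) :=
      mfderiv_comp_mfderivWithin y hf h1 hU
    have e2 := mfderiv_comp_mfderivWithin (g := extChartAt J y₀)
      (f := f ∘ (extChartAt J x₀).symm) (s := range J) y h2 (hf.comp_mdifferentiableWithinAt y h1) hU
    rw [e1] at e2
    exact e2
  have h4 : (extChartAt J y₀).symm (chartExpr J x₀ y₀ f y) = f ((extChartAt J x₀).symm y) :=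
    (extChartAt J y₀).left_inv hfy
  have h5 := chartSymmDeriv_comp_chartDeriv J (x₀ := y₀) (y := chartExpr J x₀ y₀ f y)
    ((extChartAt J y₀).map_source hfy)
  rw [h4] at h5
  rw [h3, ← ContinuousLinearMap.comp_assoc, h5, ContinuousLinearMap.id_comp]

theorem fderivWithin_chartExpr {x₀ y₀ : N} {f : N → N} {y : E}
    (hy : y ∈ (extChartAt J x₀).target)
    (hf : MDifferentiableAt J J f ((extChartAt J x₀).symm y))
    (hfy : f ((extChartAt J x₀).symm y) ∈ (extChartAt J y₀).source) :
    fderivWithin ℝ (chartExpr J x₀ y₀ f) (range J) y =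
      (chartDeriv J y₀ (f ((extChartAt J x₀).symm y))).comp
        ((modelDeriv J f ((extChartAt J x₀).symm y)).comp (chartSymmDeriv J x₀ y)) := by
  have h4 : (extChartAt J y₀).symm (chartExpr J x₀ y₀ f y) = f ((extChartAt J x₀).symm y) :=
    (extChartAt J y₀).left_inv hfy
  have h5 := chartDeriv_comp_chartSymmDeriv J (x₀ := y₀) (y := chartExpr J x₀ y₀ f y)
    ((extChartAt J y₀).map_source hfy)
  rw [h4] at h5
  rw [modelDeriv_comp_chartSymmDeriv J hy hf hfy, ← ContinuousLinearMap.comp_assoc, h5,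
    ContinuousLinearMap.id_comp]

/-- A smooth Riemannian metric, given by its values on the tangent spaces. -/
structure IsSmoothMetric (b : N → E →L[ℝ] E →L[ℝ] ℝ) : Prop where
  symm : ∀ x v w, b x v w = b x w v
  pos : ∀ x v, v ≠ 0 → 0 < b x v v
  smooth : ∀ x₀, ContDiffOn ℝ ∞ (coordMetric J b x₀) (extChartAt J x₀).target

/-- Smooth maps preserving a metric. -/
structure PreservesMetric (b : N → E →L[ℝ] E →L[ℝ] ℝ) (f : N → N) : Prop where
  contMDiff : ContMDiff J J ∞ f
  map : ∀ x v w, b (f x) (modelDeriv J f x v) (modelDeriv J f x w) = b x v w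

variable {J}

theorem IsSmoothMetric.coordMetric_pos {b : N → E →L[ℝ] E →L[ℝ] ℝ} (hb : IsSmoothMetric J b)
    {x₀ : N} {y : E} (hy : y ∈ (extChartAt J x₀).target) (v : E) (hv : v ≠ 0) :
    0 < coordMetric J b x₀ y v v := by
  refine hb.pos _ _ fun h => hv ?_
  have := congrArg (fun L : E →L[ℝ] E => L v) (chartDeriv_comp_chartSymmDeriv J hy)
  have h' : (chartSymmDeriv J x₀ y) v = 0 := h
  rw [ContinuousLinearMap.comp_apply, h', map_zero] at this
  exact this.symm

theorem PreservesMetric.coordMetric {b : N → E →L[ℝ] E →L[ℝ] ℝ} {f : N → N}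
    (hf : PreservesMetric J b f) {x₀ y₀ : N} {y : E} (hy : y ∈ (extChartAt J x₀).target)
    (hfy : f ((extChartAt J x₀).symm y) ∈ (extChartAt J y₀).source) (v w : E) :
    coordMetric J b y₀ (chartExpr J x₀ y₀ f y) (fderivWithin ℝ (chartExpr J x₀ y₀ f) (range J) y v)
      (fderivWithin ℝ (chartExpr J x₀ y₀ f) (range J) y w) = coordMetric J b x₀ y v w := by
  have h := modelDeriv_comp_chartSymmDeriv J hy
    (hf.contMDiff.mdifferentiable (by simp) _) hfy
  have h4 : (extChartAt J y₀).symm (chartExpr J x₀ y₀ f y) = f ((extChartAt J x₀).symm y) :=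
    (extChartAt J y₀).left_inv hfy
  have hv := congrArg (fun L : E →L[ℝ] E => L v) h
  have hw := congrArg (fun L : E →L[ℝ] E => L w) h
  simp only [ContinuousLinearMap.comp_apply] at hv hw
  rw [coordMetric_apply, coordMetric_apply, h4, ← hv, ← hw, hf.map]

theorem exists_lower_bound [FiniteDimensional ℝ E] {C : Set E} (hC : IsCompact C)
    {G : E → E →L[ℝ] E →L[ℝ] ℝ} (hG : ContinuousOn G C)
    (hpos : ∀ y ∈ C, ∀ v, v ≠ 0 → 0 < G y v v) :
    ∃ c > 0, ∀ y ∈ C, ∀ v, c * ‖v‖ ^ 2 ≤ G y v v := by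
  have hprop : ProperSpace E := FiniteDimensional.proper ℝ E
  have hcont : ContinuousOn (fun p : E × E => G p.1 p.2 p.2) (C ×ˢ Metric.sphere (0 : E) 1) := by
    have h1 : ContinuousOn (fun p : E × E => G p.1) (C ×ˢ Metric.sphere (0 : E) 1) :=
      hG.comp continuousOn_fst fun p hp => hp.1
    exact (h1.clm_apply continuousOn_snd).clm_apply continuousOn_snd
  obtain ⟨c, hc, h⟩ := (hC.prod (isCompact_sphere (0 : E) 1)).exists_forall_le' hcont (a := 0)
    (fun p hp => hpos _ hp.1 _ fun h0 => by simpa [h0] using hp.2)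
  refine ⟨c, hc, fun y hy v => ?_⟩
  by_cases hv : v = 0
  · simp [hv]
  have hn : 0 < ‖v‖ := norm_pos_iff.2 hv
  have := h (y, ‖v‖⁻¹ • v) ⟨hy, by simp [norm_smul, hn.ne']⟩
  simp only [map_smul, smul_apply, smul_eq_mul] at this
  calc c * ‖v‖ ^ 2 ≤ ‖v‖⁻¹ * (‖v‖⁻¹ * G y v v) * ‖v‖ ^ 2 := by gcongr
    _ = G y v v := by field_simp

/-- A family of isometries, converging to a point uniformly near a point, solves the equation for
isometries in charts with uniform bounds. -/
theorem exists_solvesIsometry [FiniteDimensional ℝ E] {b : N → E →L[ℝ] E →L[ℝ] ℝ}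
    (hb : IsSmoothMetric J b) {ι : Type*} {𝓛 : Filter ι} {f : ι → N → N} {x₀ y₀ q : N} {y₁ : E}
    (hy₁ : y₁ ∈ (extChartAt J x₀).target) (hq : q ∈ (extChartAt J y₀).source)
    (hf : ∀ᶠ i in 𝓛, PreservesMetric J b (f i))
    (hlim : Tendsto (fun p : ι × N => f p.1 p.2) (𝓛 ×ˢ 𝓝 ((extChartAt J x₀).symm y₁)) (𝓝 q)) :
    ∃ r > 0, ∃ (Kb C : Set E) (R : ℝ), IsCompact Kb ∧ IsCompact C ∧
      Kb ⊆ (extChartAt J x₀).target ∧ C ⊆ (extChartAt J y₀).target ∧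
      range J ∩ Metric.ball y₁ r ⊆ Kb ∧
      ∀ᶠ i in 𝓛, (∀ y ∈ Kb, f i ((extChartAt J x₀).symm y) ∈ (extChartAt J y₀).source) ∧
        SolvesIsometry (range J ∩ Metric.ball y₁ r) C
          (christoffel (range J) (_root_.coordMetric J b x₀))
          (christoffel (range J) (_root_.coordMetric J b y₀)) R (chartExpr J x₀ y₀ (f i))
          (fderivWithin ℝ (chartExpr J x₀ y₀ (f i)) (range J)) := by
  have hprop : ProperSpace E := FiniteDimensional.proper ℝ E
  have hball : ∀ {T : Set E} {y : E}, T ∈ 𝓝[range J] y → ∃ ρ > 0,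
      range J ∩ Metric.closedBall y ρ ⊆ T := by
    intro T y hT
    obtain ⟨ρ, hρ, h⟩ := Metric.mem_nhdsWithin_iff.1 hT
    refine ⟨ρ / 2, by positivity, fun z hz => h ⟨?_, hz.1⟩⟩
    exact Metric.closedBall_subset_ball (by linarith) hz.2
  have hcpt : ∀ y ρ, IsCompact (range J ∩ Metric.closedBall y ρ) := fun y ρ =>
    (isCompact_closedBall y ρ).inter_left J.isClosed_range
  obtain ⟨ρ, hρ, hC⟩ := hball (range_mem_nhdsWithin_target J ((extChartAt J y₀).map_source hq))
  have hqn : (extChartAt J y₀).source ∩ (extChartAt J y₀) ⁻¹'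
      Metric.closedBall (extChartAt J y₀ q) ρ ∈ 𝓝 q :=
    inter_mem ((isOpen_extChartAt_source y₀).mem_nhds hq)
      ((continuousAt_extChartAt' hq) (Metric.closedBall_mem_nhds _ hρ))
  obtain ⟨I', hI', V, hV, hIV⟩ := mem_prod_iff.1 (hlim hqn)
  have hVn : (extChartAt J x₀).target ∩ (extChartAt J x₀).symm ⁻¹' V ∈ 𝓝[range J] y₁ :=
    inter_mem (range_mem_nhdsWithin_target J hy₁)
      (nhdsWithin_le_nhds ((continuousAt_extChartAt_symm'' hy₁) hV))
  obtain ⟨r, hr, hK⟩ := hball hVn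
  have hKt := fun y hy => (hK (a := y) hy).1
  obtain ⟨C₁, hC₁⟩ := (hcpt y₁ r).exists_bound_of_continuousOn (((hb.smooth x₀).continuousOn).mono hKt)
  obtain ⟨c, hc, hcb⟩ := exists_lower_bound (hcpt (extChartAt J y₀ q) ρ)
    (((hb.smooth y₀).continuousOn).mono hC) fun y hy => hb.coordMetric_pos (hC hy)
  refine ⟨r, hr, _, _, √(C₁ / c), hcpt y₁ r, hcpt (extChartAt J y₀ q) ρ, hKt, hC,
    inter_subset_inter_right _ Metric.ball_subset_closedBall, ?_⟩
  filter_upwards [hI', hf] with i hi hfi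
  have hsrc : ∀ y ∈ range J ∩ Metric.closedBall y₁ r,
      f i ((extChartAt J x₀).symm y) ∈ (extChartAt J y₀).source ∧
      chartExpr J x₀ y₀ (f i) y ∈ Metric.closedBall (extChartAt J y₀ q) ρ := fun y hy =>
    hIV (a := (i, (extChartAt J x₀).symm y)) ⟨hi, (hK hy).2⟩
  refine ⟨fun y hy => (hsrc y hy).1, ?_⟩
  have hsub : range J ∩ Metric.ball y₁ r ⊆ range J ∩ Metric.closedBall y₁ r :=
    inter_subset_inter_right _ Metric.ball_subset_closedBall
  have hsm : ∀ y ∈ range J ∩ Metric.ball y₁ r,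
      ContDiffWithinAt ℝ ∞ (chartExpr J x₀ y₀ (f i)) (range J) y := fun y hy =>
    chartExpr_contDiffWithinAt J le_rfl (hKt y (hsub hy)) hfi.contMDiff.contMDiffAt
      (hsrc y (hsub hy)).1
  have hmem : ∀ y ∈ range J ∩ Metric.ball y₁ r, chartExpr J x₀ y₀ (f i) y ∈
      range J ∩ Metric.closedBall (extChartAt J y₀ q) ρ := fun y hy =>
    ⟨extChartAt_target_subset_range y₀ ((extChartAt J y₀).map_source (hsrc y (hsub hy)).1),
      (hsrc y (hsub hy)).2⟩
  refine ⟨hmem, fun y hy => ?_, fun y hy => ?_, fun y hy => ?_⟩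
  · refine ContinuousLinearMap.opNorm_le_bound _ (Real.sqrt_nonneg _) fun v => ?_
    have h1 := hfi.coordMetric (hKt y (hsub hy)) (hsrc y (hsub hy)).1 v v
    have h2 := hcb _ (hmem y hy) (fderivWithin ℝ (chartExpr J x₀ y₀ (f i)) (range J) y v)
    have h3 : _root_.coordMetric J b x₀ y v v ≤ C₁ * ‖v‖ * ‖v‖ := by
      refine (le_abs_self _).trans (((_root_.coordMetric J b x₀ y).le_opNorm₂ v v).trans ?_)
      have := hC₁ y (hsub hy)
      gcongr
    rw [h1] at h2
    have hv : (0 : ℝ) ≤ ‖v‖ := norm_nonneg v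
    refine le_of_sq_le_sq ?_ (by positivity)
    have hC₁0 : 0 ≤ C₁ := (norm_nonneg _).trans (hC₁ y (hsub hy))
    rw [mul_pow, Real.sq_sqrt (by positivity), div_mul_eq_mul_div, le_div_iff₀ hc]
    nlinarith
  · exact ((hsm y hy).differentiableWithinAt (by simp)).hasFDerivWithinAt.mono inter_subset_left
  · have hy' := hKt y (hsub hy)
    have ht' : chartExpr J x₀ y₀ (f i) y ∈ (extChartAt J y₀).target := hC (hmem y hy)
    refine (hasFDerivWithinAt_of_isometry (t := range J) (G := _root_.coordMetric J b x₀)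
      (H := _root_.coordMetric J b y₀) J.uniqueDiffOn hy.1
      (J.range_subset_closure_interior hy.1) (mod_cast contDiffWithinAt_infty.1 (hsm y hy) 2) ?_ ?_
      (hb.coordMetric_pos hy') (hb.coordMetric_pos ht') (fun v w => hb.symm _ _ _) ?_ ?_).mono
        inter_subset_left
    · exact (((hb.smooth x₀) y hy').differentiableWithinAt (by simp)).mono_of_mem_nhdsWithin
        (range_mem_nhdsWithin_target J hy')
    · exact (((hb.smooth y₀) _ ht').differentiableWithinAt (by simp)).mono_of_mem_nhdsWithin
        (range_mem_nhdsWithin_target J ht')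
    · filter_upwards [eventually_chart_mem J (f := f i) (y₀ := y₀) hy'
        hfi.contMDiff.continuous.continuousAt (hsrc y (hsub hy)).1] with z hz
      exact extChartAt_target_subset_range y₀ ((extChartAt J y₀).map_source hz.2)
    · filter_upwards [eventually_chart_mem J (f := f i) (y₀ := y₀) hy'
        hfi.contMDiff.continuous.continuousAt (hsrc y (hsub hy)).1] with z hz
      exact fun v w => hfi.coordMetric hz.1 hz.2 v w

end Charts

/-! ### Smooth families of maps of a manifold -/

section Families

universe u v

variable {E : Type u} [NormedAddCommGroup E] [NormedSpace ℝ E]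
  {H : Type*} [TopologicalSpace H] (J : ModelWithCorners ℝ E H)
  {N : Type*} [TopologicalSpace N] [ChartedSpace H N]
  {P : Type v} [TopologicalSpace P]

/-- A family of maps, smooth with all derivatives jointly continuous in the point and the
parameter. -/
structure IsSmoothFamily (f : P → N → N) : Prop where
  continuous : Continuous fun w : P × N => f w.1 w.2
  exists_paramDiff : ∀ (x₀ y₀ : N) (p₀ : P) (y₁ : E), y₁ ∈ (extChartAt J x₀).target →
    f p₀ ((extChartAt J x₀).symm y₁) ∈ (extChartAt J y₀).source →
    ∃ O : Set (P × E), IsOpen O ∧ (p₀, y₁) ∈ O ∧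
      (∀ w ∈ O, w.2 ∈ range J → w.2 ∈ (extChartAt J x₀).target ∧
        f w.1 ((extChartAt J x₀).symm w.2) ∈ (extChartAt J y₀).source) ∧
      ∀ n, ParamDiff (range J) O n fun w => chartExpr J x₀ y₀ (f w.1) w.2

variable {J}

variable [IsManifold J ∞ N]

theorem IsSmoothFamily.contMDiff {f : P → N → N} (hf : IsSmoothFamily J f) (p : P) :
    ContMDiff J J ∞ (f p) := by
  intro x
  obtain ⟨O, hO, hm, -, hn⟩ := hf.exists_paramDiff x (f p x) p (extChartAt J x x)
    (mem_extChartAt_target x) (by simp)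
  have hc : Continuous (f p) := hf.continuous.comp (Continuous.prodMk_right p)
  have key := contMDiffAt_of_chartExpr J (x₀ := x) (y₀ := f p x) (f := f p) (n := ∞) le_rfl
    (mem_extChartAt_target x) hc.continuousAt (by simp)
  rw [(extChartAt J x).left_inv (mem_extChartAt_source x)] at key
  refine key (contDiffWithinAt_infty.2 fun n => ?_)
  have h := (hn n).contDiffOn_slice hO J.uniqueDiffOn p (extChartAt J x x)
    ⟨mem_range_self _, hm⟩
  refine h.mono_of_mem_nhdsWithin (inter_mem self_mem_nhdsWithin (nhdsWithin_le_nhds ?_))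
  exact (hO.preimage (Continuous.prodMk_right p)).mem_nhds hm

variable [FiniteDimensional ℝ E] {b : N → E →L[ℝ] E →L[ℝ] ℝ}

omit [FiniteDimensional ℝ E] in
theorem SolvesIsometry.mono {B B' C : Set E} {Γ₁ Γ₂ : E → E →L[ℝ] E →L[ℝ] E} {R : ℝ} {u : E → E}
    {A : E → E →L[ℝ] E} (h : SolvesIsometry B C Γ₁ Γ₂ R u A) (hB : B' ⊆ B) :
    SolvesIsometry B' C Γ₁ Γ₂ R u A :=
  ⟨fun y hy => h.mem y (hB hy), fun y hy => h.norm_le y (hB hy),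
    fun y hy => (h.fst y (hB hy)).mono hB, fun y hy => (h.snd y (hB hy)).mono hB⟩

omit [FiniteDimensional ℝ E] in
theorem IsSmoothMetric.paramDiff_christoffel [FiniteDimensional ℝ E] (hb : IsSmoothMetric J b)
    (x₀ : N) {O : Set (P × E)} (hO : IsOpen O) {n : ℕ} {u : P × E → E}
    (hu : ParamDiff (range J) O n u)
    (hO' : ∀ w ∈ O, w.2 ∈ range J → u w ∈ (extChartAt J x₀).target) :
    ParamDiff (range J) O n fun w => christoffel (range J) (coordMetric J b x₀) (u w) := by
  have ht : (extChartAt J x₀).target = range J ∩ J.symm ⁻¹' (chartAt H x₀).target := by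
    rw [extChartAt_target, inter_comm]
  have hsm : ContDiffOn ℝ ∞ (christoffel (range J) (coordMetric J b x₀))
      (range J ∩ J.symm ⁻¹' (chartAt H x₀).target) := by
    rw [← ht]
    exact contDiffOn_christoffel J.uniqueDiffOn
      (fun x hx => range_mem_nhdsWithin_target J hx) (extChartAt_target_subset_range x₀)
      (hb.smooth x₀) fun x hx => hb.coordMetric_pos hx
  exact ParamDiff.contDiffOn_comp J.uniqueDiffOn
    ((chartAt H x₀).open_target.preimage J.continuous_symm) (contDiffOn_infty.1 hsm n) hu hO
    fun w hw hws => ht ▸ hO' w hw hws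

omit [NormedSpace ℝ E] [FiniteDimensional ℝ E] in
theorem nhdsWithin_inter_ball_mem {s : Set E} {y z : E} {r : ℝ} (hz : z ∈ s ∩ Metric.ball y r) :
    s ∩ Metric.ball y r ∈ 𝓝[s] z :=
  inter_mem self_mem_nhdsWithin (nhdsWithin_le_nhds (Metric.isOpen_ball.mem_nhds hz.2))

/-- A family solving the equation for isometries is smooth. -/
theorem IsSmoothMetric.paramDiff (hb : IsSmoothMetric J b) {x₀ y₀ : N} {V : Set P} (hV : IsOpen V)
    {y₁ : E} {r : ℝ} {C : Set E} {R : ℝ} {u : P → E → E} {A : P → E → E →L[ℝ] E}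
    (hB : range J ∩ Metric.ball y₁ r ⊆ (extChartAt J x₀).target)
    (hC : C ⊆ (extChartAt J y₀).target)
    (h : ∀ p ∈ V, SolvesIsometry (range J ∩ Metric.ball y₁ r) C
      (christoffel (range J) (coordMetric J b x₀)) (christoffel (range J) (coordMetric J b y₀)) R
      (u p) (A p))
    (hu : ContinuousOn (fun w : P × E => u w.1 w.2)
      ((V ×ˢ Metric.ball y₁ r) ∩ Prod.snd ⁻¹' range J))
    (hA : ContinuousOn (fun w : P × E => A w.1 w.2)
      ((V ×ˢ Metric.ball y₁ r) ∩ Prod.snd ⁻¹' range J)) (n : ℕ) :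
    ParamDiff (range J) (V ×ˢ Metric.ball y₁ r) n fun w => u w.1 w.2 := by
  have hO : IsOpen (V ×ˢ Metric.ball y₁ r) := hV.prod Metric.isOpen_ball
  refine (ParamDiff.bootstrap (u := fun w : P × E => u w.1 w.2) (A := fun w : P × E => A w.1 w.2)
    (Φ := fun w => isometrySnd (christoffel (range J) (coordMetric J b x₀) w.2)
      (christoffel (range J) (coordMetric J b y₀) (u w.1 w.2)) (A w.1 w.2)) hu hA ?_ ?_ ?_ n).1
  · exact fun w hw hws => ((h w.1 hw.1).fst w.2 ⟨hws, hw.2⟩).mono_of_mem_nhdsWithin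
      (nhdsWithin_inter_ball_mem ⟨hws, hw.2⟩)
  · exact fun w hw hws => ((h w.1 hw.1).snd w.2 ⟨hws, hw.2⟩).mono_of_mem_nhdsWithin
      (nhdsWithin_inter_ball_mem ⟨hws, hw.2⟩)
  · intro n hun hAn
    refine ParamDiff.isometrySnd ?_ ?_ hAn
    · exact hb.paramDiff_christoffel x₀ hO ParamDiff.snd fun w hw hws => hB ⟨hws, hw.2⟩
    · exact hb.paramDiff_christoffel y₀ hO hun fun w hw hws => hC ((h w.1 hw.1).mem _ ⟨hws, hw.2⟩)

/-- A jointly continuous family of isometries is smooth. -/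
theorem IsSmoothMetric.isSmoothFamily (hb : IsSmoothMetric J b) {f : P → N → N}
    (hc : Continuous fun w : P × N => f w.1 w.2) (hf : ∀ p, PreservesMetric J b (f p)) :
    IsSmoothFamily J f := by
  refine ⟨hc, fun x₀ y₀ p₀ y₁ hy₁ hq => ?_⟩
  have hlim : Tendsto (fun w : P × N => f w.1 w.2) (𝓝 p₀ ×ˢ 𝓝 ((extChartAt J x₀).symm y₁))
      (𝓝 (f p₀ ((extChartAt J x₀).symm y₁))) := by
    rw [← nhds_prod_eq]
    exact hc.tendsto (p₀, (extChartAt J x₀).symm y₁)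
  obtain ⟨r, hr, Kb, C, R, hKb, hC, hKt, hCt, hBK, hev⟩ := exists_solvesIsometry hb hy₁ hq
    (Eventually.of_forall hf) hlim
  obtain ⟨V, hV, hVo, hpV⟩ := eventually_nhds_iff.1 hev
  have hBc : Convex ℝ (range J ∩ Metric.ball y₁ r) := J.convex_range.inter (convex_ball _ _)
  have h₁ : ContinuousOn (christoffel (range J) (coordMetric J b x₀)) Kb :=
    (contDiffOn_christoffel J.uniqueDiffOn
      (fun x hx => range_mem_nhdsWithin_target J hx) (extChartAt_target_subset_range x₀)
      (hb.smooth x₀) fun x hx => hb.coordMetric_pos hx).continuousOn.mono hKt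
  have h₂ : ContinuousOn (christoffel (range J) (coordMetric J b y₀)) C :=
    (contDiffOn_christoffel J.uniqueDiffOn
      (fun x hx => range_mem_nhdsWithin_target J hx) (extChartAt_target_subset_range y₀)
      (hb.smooth y₀) fun x hx => hb.coordMetric_pos hx).continuousOn.mono hCt
  have hu : ContinuousOn (fun w : P × E => chartExpr J x₀ y₀ (f w.1) w.2)
      ((V ×ˢ Metric.ball y₁ r) ∩ Prod.snd ⁻¹' range J) := by
    intro w hw
    have hwB : w.2 ∈ Kb := hBK ⟨hw.2, hw.1.2⟩
    have e1 : ContinuousAt (extChartAt J x₀).symm w.2 := continuousAt_extChartAt_symm'' (hKt hwB)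
    have e2 : ContinuousAt (extChartAt J y₀) (f w.1 ((extChartAt J x₀).symm w.2)) :=
      continuousAt_extChartAt' ((hV w.1 hw.1.1).1 _ hwB)
    have e3 : ContinuousAt (fun w : P × E => f w.1 ((extChartAt J x₀).symm w.2)) w :=
      hc.continuousAt.comp (f := fun w : P × E => (w.1, (extChartAt J x₀).symm w.2))
        (continuousAt_fst.prodMk (e1.comp continuousAt_snd))
    exact (ContinuousAt.comp (x := w) (g := extChartAt J y₀)
      (f := fun w : P × E => f w.1 ((extChartAt J x₀).symm w.2)) e2 e3).continuousWithinAt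
  refine ⟨V ×ˢ Metric.ball y₁ r, hVo.prod Metric.isOpen_ball, ⟨hpV, Metric.mem_ball_self hr⟩,
    fun w hw hws => ⟨hKt (hBK ⟨hws, hw.2⟩), (hV w.1 hw.1).1 _ (hBK ⟨hws, hw.2⟩)⟩, fun n => ?_⟩
  refine hb.paramDiff hVo (C := C) (R := R) (fun y hy => hKt (hBK hy)) hCt
    (A := fun p => fderivWithin ℝ (chartExpr J x₀ y₀ (f p)) (range J))
    (fun p hp => (hV p hp).2) hu ?_ n
  obtain ⟨L, hL0, hL⟩ := SolvesIsometry.exists_lipschitz (R := R) hBc hBK hKb hC h₁ h₂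
  have hpt : ∀ p₁ ∈ V, ∀ z ∈ range J ∩ Metric.ball y₁ r,
      Tendsto (fun p => fderivWithin ℝ (chartExpr J x₀ y₀ (f p)) (range J) z) (𝓝 p₁)
        (𝓝 (fderivWithin ℝ (chartExpr J x₀ y₀ (f p₁)) (range J) z)) := by
    intro p₁ hp₁ z hz
    refine (tendsto_iff_ultrafilter _ _ _).2 fun 𝒰 h𝒰 => ?_
    have hev𝒰 : ∀ᶠ p in (𝒰 : Filter P), p ∈ V := h𝒰 (hVo.mem_nhds hp₁)
    obtain ⟨A', hA', hlim'⟩ := SolvesIsometry.exists_limit 𝒰 hBc hBK hKb hC h₁ h₂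
      (v := chartExpr J x₀ y₀ (f p₁)) (hev𝒰.mono fun p hp => (hV p hp).2) (fun y hy => by
        have := hu (p₁, y) ⟨⟨hp₁, hy.2⟩, hy.1⟩
        refine this.tendsto.comp (tendsto_nhdsWithin_iff.2 ⟨?_, ?_⟩)
          (f := fun p : P => (p, y))
        · exact ((Continuous.prodMk_left y).tendsto p₁).mono_left h𝒰
        · exact hev𝒰.mono fun p hp => ⟨⟨hp, hy.2⟩, hy.1⟩)
    have hA'z : A' z = fderivWithin ℝ (chartExpr J x₀ y₀ (f p₁)) (range J) z :=
      (J.uniqueDiffOn.inter Metric.isOpen_ball z hz).eq (hA'.fst z hz) ((hV p₁ hp₁).2.fst z hz)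
    rw [← hA'z]
    exact hlim' z hz
  intro w hw
  refine ContinuousWithinAt.mono (t := V ×ˢ (range J ∩ Metric.ball y₁ r)) ?_
    fun a ha => ⟨ha.1.1, ha.2, ha.1.2⟩
  rw [ContinuousWithinAt, tendsto_iff_norm_sub_tendsto_zero]
  have hw' : w.2 ∈ range J ∩ Metric.ball y₁ r := ⟨hw.2, hw.1.2⟩
  have hz1 : Tendsto (fun a : P × E => L * ‖a.2 - w.2‖ +
      ‖fderivWithin ℝ (chartExpr J x₀ y₀ (f a.1)) (range J) w.2 -
        fderivWithin ℝ (chartExpr J x₀ y₀ (f w.1)) (range J) w.2‖) (𝓝 w) (𝓝 0) := by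
    have t1 : Tendsto (fun a : P × E => L * ‖a.2 - w.2‖) (𝓝 w) (𝓝 0) := by
      have : Continuous fun a : P × E => L * ‖a.2 - w.2‖ := by fun_prop
      simpa using this.tendsto w
    have t2 := tendsto_iff_norm_sub_tendsto_zero.1 (hpt w.1 hw.1.1 w.2 hw')
    simpa using t1.add (t2.comp (continuous_fst.tendsto w))
  refine squeeze_zero' (Eventually.of_forall fun _ => norm_nonneg _) ?_
    (hz1.mono_left nhdsWithin_le_nhds)
  filter_upwards [self_mem_nhdsWithin] with a ha
  refine (norm_sub_le_norm_sub_add_norm_sub _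
    (fderivWithin ℝ (chartExpr J x₀ y₀ (f a.1)) (range J) w.2) _).trans ?_
  gcongr
  exact (hL _ _ (hV a.1 ha.1).2 w.2 hw' a.2 ha.2).1

omit [FiniteDimensional ℝ E] in
theorem coordMetric_self (x₀ : N) : coordMetric J b x₀ (extChartAt J x₀ x₀) = b x₀ := by
  ext v w
  rw [coordMetric_apply, chartSymmDeriv_self, (extChartAt J x₀).left_inv (mem_extChartAt_source x₀)]
  rfl

/-- Limits of isometries are isometries. -/
theorem IsSmoothMetric.preservesMetric_of_tendsto (hb : IsSmoothMetric J b) {ι : Type*}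
    (𝒰 : Ultrafilter ι) {f : ι → N → N} {F : N → N} (hF : Continuous F)
    (hf : ∀ i, PreservesMetric J b (f i))
    (hlim : ∀ x, Tendsto (fun p : ι × N => f p.1 p.2) ((𝒰 : Filter ι) ×ˢ 𝓝 x) (𝓝 (F x))) :
    PreservesMetric J b F := by
  have main : ∀ x, ContMDiffAt J J ∞ F x ∧
      ∀ v w, b (F x) (modelDeriv J F x v) (modelDeriv J F x w) = b x v w := by
    intro x
    have hxs : (extChartAt J x).symm (extChartAt J x x) = x := by simp
    have hxt : extChartAt J x x ∈ (extChartAt J x).target := mem_extChartAt_target x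
    obtain ⟨r₀, hr₀, Kb, C, R, hKb, hC, hKt, hCt, hBK₀, hev₀⟩ := exists_solvesIsometry
      (x₀ := x) (y₀ := F x) (q := F x) (𝓛 := 𝒰) hb hxt (mem_extChartAt_source _)
      (Eventually.of_forall hf) (by rw [hxs]; exact hlim x)
    obtain ⟨r₁, hr₁, hsrc⟩ := Metric.mem_nhdsWithin_iff.1 (eventually_chart_mem J (x₀ := x)
      (y₀ := F x) (f := F) hxt hF.continuousAt (by simp))
    set r := min r₀ r₁ with hr
    have hrpos : 0 < r := lt_min hr₀ hr₁
    have hsub : range J ∩ Metric.ball (extChartAt J x x) r ⊆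
        range J ∩ Metric.ball (extChartAt J x x) r₀ :=
      inter_subset_inter_right _ (Metric.ball_subset_ball (min_le_left _ _))
    have hBK := hsub.trans hBK₀
    have hsrc' : ∀ y ∈ range J ∩ Metric.ball (extChartAt J x x) r,
        F ((extChartAt J x).symm y) ∈ (extChartAt J (F x)).source := fun y hy =>
      (hsrc ⟨Metric.ball_subset_ball (min_le_right _ _) hy.2, hy.1⟩).2
    have hBc : Convex ℝ (range J ∩ Metric.ball (extChartAt J x x) r) :=
      J.convex_range.inter (convex_ball _ _)
    have h₁ : ContinuousOn (christoffel (range J) (coordMetric J b x)) Kb :=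
      (contDiffOn_christoffel J.uniqueDiffOn
        (fun x hx => range_mem_nhdsWithin_target J hx) (extChartAt_target_subset_range _)
        (hb.smooth _) fun x hx => hb.coordMetric_pos hx).continuousOn.mono hKt
    have h₂ : ContinuousOn (christoffel (range J) (coordMetric J b (F x))) C :=
      (contDiffOn_christoffel J.uniqueDiffOn
        (fun x hx => range_mem_nhdsWithin_target J hx) (extChartAt_target_subset_range _)
        (hb.smooth _) fun x hx => hb.coordMetric_pos hx).continuousOn.mono hCt
    have hulim : ∀ y ∈ range J ∩ Metric.ball (extChartAt J x x) r,
        Tendsto (fun i => chartExpr J x (F x) (f i) y) 𝒰 (𝓝 (chartExpr J x (F x) F y)) := by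
      intro y hy
      have e1 : Tendsto (fun i => f i ((extChartAt J x).symm y)) 𝒰
          (𝓝 (F ((extChartAt J x).symm y))) :=
        (hlim ((extChartAt J x).symm y)).comp (tendsto_id.prodMk
          (tendsto_const_nhds (x := (extChartAt J x).symm y)))
      exact (continuousAt_extChartAt' (hsrc' y hy)).tendsto.comp e1
    obtain ⟨A', hA', hA'lim⟩ := SolvesIsometry.exists_limit 𝒰 hBc hBK hKb hC h₁ h₂
      (hev₀.mono fun i hi => hi.2.mono hsub) hulim
    have hmem : extChartAt J x x ∈ range J ∩ Metric.ball (extChartAt J x x) r :=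
      ⟨mem_range_self _, Metric.mem_ball_self hrpos⟩
    have hpd := fun n => hb.paramDiff (P := Unit) (V := univ) isOpen_univ
      (u := fun _ => chartExpr J x (F x) F) (A := fun _ => A') (C := C) (R := R)
      (x₀ := x) (y₀ := F x) (fun y hy => hKt (hBK hy)) hCt (fun _ _ => hA')
      (fun w hw => ((hA'.fst w.2 ⟨hw.2, hw.1.2⟩).continuousWithinAt.comp
        continuousWithinAt_snd fun a ha => ⟨ha.2, ha.1.2⟩))
      (fun w hw => ((hA'.snd w.2 ⟨hw.2, hw.1.2⟩).continuousWithinAt.comp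
        continuousWithinAt_snd fun a ha => ⟨ha.2, ha.1.2⟩)) n
    have hsm : ContDiffWithinAt ℝ ∞ (chartExpr J x (F x) F) (range J) (extChartAt J x x) := by
      refine contDiffWithinAt_infty.2 fun n => ?_
      have h := (hpd n).contDiffOn_slice (isOpen_univ.prod Metric.isOpen_ball) J.uniqueDiffOn ()
        (extChartAt J x x) ⟨hmem.1, mem_univ _, hmem.2⟩
      refine h.mono_of_mem_nhdsWithin (inter_mem self_mem_nhdsWithin (nhdsWithin_le_nhds ?_))
      filter_upwards [Metric.isOpen_ball.mem_nhds hmem.2] with z hz using ⟨mem_univ _, hz⟩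
    have hcm := contMDiffAt_of_chartExpr J (x₀ := x) (y₀ := F x) le_rfl hxt hF.continuousAt
      (by simp) hsm
    rw [hxs] at hcm
    refine ⟨hcm, fun v w => ?_⟩
    have hder : fderivWithin ℝ (chartExpr J x (F x) F) (range J) (extChartAt J x x) =
        A' (extChartAt J x x) :=
      ((hA'.fst _ hmem).mono_of_mem_nhdsWithin (nhdsWithin_inter_ball_mem hmem)).fderivWithin
        (J.uniqueDiffOn _ hmem.1)
    have hchain := modelDeriv_comp_chartSymmDeriv J (x₀ := x) (y₀ := F x) (f := F) hxt
      (by rw [hxs]; exact hcm.mdifferentiableAt (by simp)) (by simp)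
    have hval : chartExpr J x (F x) F (extChartAt J x x) = extChartAt J (F x) (F x) := by
      simp [chartExpr]
    rw [hval, chartSymmDeriv_self, chartSymmDeriv_self, hxs, ContinuousLinearMap.comp_id,
      ContinuousLinearMap.id_comp, hder] at hchain
    rw [hchain]
    have hG : Tendsto (fun i => coordMetric J b (F x) (chartExpr J x (F x) (f i) (extChartAt J x x)))
        𝒰 (𝓝 (b (F x))) := by
      rw [← coordMetric_self (J := J) (b := b) (F x), ← hval]
      refine ((hb.smooth (F x)).continuousOn _ ?_).tendsto.comp
        (tendsto_nhdsWithin_iff.2 ⟨hulim _ hmem, ?_⟩)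
      · rw [hval]; exact mem_extChartAt_target _
      · exact hev₀.mono fun i hi => hCt (hi.2.mem _ (hsub hmem))
    have happ : ∀ v, Tendsto (fun i => fderivWithin ℝ (chartExpr J x (F x) (f i)) (range J)
        (extChartAt J x x) v) 𝒰 (𝓝 (A' (extChartAt J x x) v)) := fun v =>
      ((ContinuousLinearMap.apply ℝ E v).continuous.tendsto _).comp (hA'lim _ hmem)
    have hL1 := Filter.Tendsto.clm_bilin (.id ℝ (E →L[ℝ] ℝ))
      (Filter.Tendsto.clm_bilin (.id ℝ (E →L[ℝ] E →L[ℝ] ℝ)) hG (happ v)) (happ w)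
    simp only [ContinuousLinearMap.id_apply] at hL1
    refine tendsto_nhds_unique hL1 (tendsto_const_nhds.congr' ?_)
    filter_upwards [hev₀] with i hi
    rw [(hf i).coordMetric hxt (hi.1 _ (hBK hmem)), coordMetric_self]
  exact ⟨fun x => (main x).1, fun x => (main x).2⟩

end Families

/-! ### Compactness of the isometry group -/

section IsometryGroup

universe u

variable {E : Type u} [NormedAddCommGroup E] [NormedSpace ℝ E]
  {H : Type*} [TopologicalSpace H] {I : ModelWithCorners ℝ E H}
  {M : Type*} [TopologicalSpace M] [ChartedSpace H M] [IsManifold I ∞ M]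
  (g : ContMDiffRiemannianMetric I ∞ E (fun x : M => TangentSpace I x))

/-- The values of a Riemannian metric, as bilinear forms on the model space. -/
def metricForm (x : M) : E →L[ℝ] E →L[ℝ] ℝ := g.inner x

theorem isSmoothMetric_metricForm [FiniteDimensional ℝ E] : IsSmoothMetric I (metricForm g) := by
  have hM1 : IsManifold I 1 M := .of_le (n := ∞) (by simp)
  refine ⟨fun x v w => g.symm x v w, fun x v hv => g.pos x v hv, fun x₀ => ?_⟩
  have h1 := (Trivialization.contMDiffOn_section_baseSet_iff (n := ∞) (IB := I)
    (trivializationAt (E →L[ℝ] E →L[ℝ] ℝ)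
      (fun x : M => TangentSpace I x →L[ℝ] TangentSpace I x →L[ℝ] Bundle.Trivial M ℝ x) x₀)
    (s := fun x => g.inner x)).1 g.contMDiff.contMDiffOn
  have h2 := h1.comp (contMDiffOn_extChartAt_symm (n := ∞) (I := I) x₀) (fun y hy => by
    have := (extChartAt I x₀).map_target hy
    simpa [hom_trivializationAt_baseSet] using this)
  rw [contMDiffOn_iff_contDiffOn] at h2
  refine h2.congr fun y hy => ?_
  have hx : (extChartAt I x₀).symm y ∈ (chartAt H x₀).source := by
    simpa using (extChartAt I x₀).map_target hy
  have hb : (extChartAt I x₀).symm y ∈ (trivializationAt E (TangentSpace I) x₀).baseSet := by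
    simpa using hx
  have hsymm : ∀ v, (trivializationAt E (TangentSpace I) x₀).symm ((extChartAt I x₀).symm y) v =
      chartSymmDeriv I x₀ y v := by
    intro v
    have := TangentBundle.symmL_trivializationAt (I := I) hx
    rw [(extChartAt I x₀).right_inv hy] at this
    exact (Trivialization.symmL_apply (R := ℝ) _ hb v).symm.trans
      (congrArg (fun L : E →L[ℝ] E => L v) this)
  ext v w
  simp only [Function.comp_apply, hom_trivializationAt_apply]
  rw [inCoordinates_apply_eq₂ hb hb (mem_univ _), hsymm, hsymm]
  simp
  rfl

variable {g} in
theorem IsIsometry.preservesMetric {f : M ≃ₜ M} (hf : IsIsometry g f) :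
    PreservesMetric I (metricForm g) f :=
  ⟨hf.contMDiff, fun x v w => hf.inner_map x v w⟩

/-- The Riemannian distance induces the topology and is not increased by isometries. -/
theorem exists_invariant_edist [FiniteDimensional ℝ E] [RegularSpace M] :
    ∃ d : M → M → ENNReal, (∀ x, ∀ s ∈ 𝓝 x, ∃ c > 0, {y | d x y < c} ⊆ s) ∧
      (∀ x, ∀ c > 0, ∀ᶠ y in 𝓝 x, d x y < c) ∧ (∀ x y, d x y = d y x) ∧
      (∀ x y z, d x z ≤ d x y + d y z) ∧
      ∀ f, PreservesMetric I (metricForm g) f → ∀ x y, d (f x) (f y) ≤ d x y := by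
  let _ : RiemannianBundle (fun x : M => TangentSpace I x) := ⟨g.toRiemannianMetric⟩
  have hM1 : IsManifold I 1 M := .of_le (n := ∞) (by simp)
  have hcont : IsContinuousRiemannianBundle E (fun x : M => TangentSpace I x) :=
    ⟨g.inner, g.contMDiff.continuous, fun _ _ _ => rfl⟩
  have hnorm : ∀ f, PreservesMetric I (metricForm g) f → ∀ x (v : TangentSpace I x),
      ‖mfderiv I I f x v‖ₑ = ‖v‖ₑ := by
    intro f hf x v
    have h1 : ∀ (z : M) (w : TangentSpace I z), ‖w‖ = √(g.inner z w w) :=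
      fun z w => norm_eq_sqrt_real_inner w
    rw [← ofReal_norm, ← ofReal_norm, h1, h1]
    congr 2
    exact hf.map x v v
  refine ⟨riemannianEDist I, fun x s hs => setOfPred_riemannianEDist_lt_subset_nhds' I hs,
    fun x c hc => eventually_riemannianEDist_lt I x hc, fun x y => riemannianEDist_comm,
    fun x y z => riemannianEDist_triangle, fun f hf x y => ?_⟩
  refine le_of_forall_gt fun r hr => ?_
  obtain ⟨γ, h0, h1, hγ, hlt⟩ := exists_lt_of_riemannianEDist_lt hr
  have hfγ : ContMDiffOn 𝓘(ℝ, ℝ) I 1 (f ∘ γ) (Icc 0 1) :=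
    (hf.contMDiff.of_le (by simp)).comp_contMDiffOn hγ
  refine (riemannianEDist_le_pathELength hfγ (by simp [h0]) (by simp [h1]) zero_le_one).trans_lt ?_
  refine lt_of_eq_of_lt ?_ hlt
  rw [pathELength_eq_lintegral_mfderivWithin_Icc, pathELength_eq_lintegral_mfderivWithin_Icc]
  refine setLIntegral_congr_fun measurableSet_Icc fun t ht => ?_
  have hU : UniqueMDiffWithinAt 𝓘(ℝ, ℝ) (Icc (0 : ℝ) 1) t :=
    (uniqueDiffOn_Icc zero_lt_one t ht).uniqueMDiffWithinAt
  have := mfderiv_comp_mfderivWithin t (hf.contMDiff.mdifferentiable (by simp) (γ t))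
    (hγ.mdifferentiableOn (by simp) t ht) hU
  simp only [this]
  exact hnorm f hf _ _

theorem ContinuousMap.tendsto_of_forall_tendsto_prod {X Y ι : Type*} [TopologicalSpace X]
    [TopologicalSpace Y] {l : Filter ι} {f : ι → C(X, Y)} {F : C(X, Y)}
    (h : ∀ x, Tendsto (fun p : ι × X => f p.1 p.2) (l ×ˢ 𝓝 x) (𝓝 (F x))) :
    Tendsto f l (𝓝 F) := by
  rw [ContinuousMap.tendsto_nhds_compactOpen]
  intro K hK U hU hKU
  refine hK.induction_on (p := fun s => ∀ᶠ a in l, MapsTo (f a) s U) ?_ ?_ ?_ ?_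
  · exact Eventually.of_forall fun a => mapsTo_empty _ _
  · exact fun s t hst ht => ht.mono fun a ha => ha.mono_left hst
  · exact fun s t hs ht => (hs.and ht).mono fun a ha => ha.1.union ha.2
  · intro x hx
    obtain ⟨A, hA, V, hV, hAV⟩ := mem_prod_iff.1 (h x (hU.mem_nhds (hKU hx)))
    exact ⟨V, nhdsWithin_le_nhds hV, mem_of_superset hA fun a ha z hz => hAV (mk_mem_prod ha hz)⟩

variable {g}

instance [T2Space M] : T2Space (IsometryGroup g) := by
  have hc : Continuous fun f : IsometryGroup g =>
      (((f : M ≃ₜ M) : C(M, M)), ((f : M ≃ₜ M).symm : C(M, M))) := continuous_induced_dom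
  refine T2Space.of_injective_continuous (f := fun f : IsometryGroup g =>
      (((f : M ≃ₜ M) : C(M, M)), ((f : M ≃ₜ M).symm : C(M, M)))) (fun f₁ f₂ h => ?_) hc
  have h1 := congrArg Prod.fst h
  refine Subtype.ext (Homeomorph.ext fun x => ?_)
  exact congrArg (fun φ : C(M, M) => φ x) h1

theorem continuous_isometryGroup_apply [LocallyCompactSpace M] :
    Continuous fun w : IsometryGroup g × M => (w.1 : M ≃ₜ M) w.2 := by
  have hc : Continuous fun f : IsometryGroup g =>
      (((f : M ≃ₜ M) : C(M, M)), ((f : M ≃ₜ M).symm : C(M, M))) := continuous_induced_dom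
  exact ContinuousEval.continuous_eval.comp
    ((hc.fst.comp continuous_fst).prodMk continuous_snd)

instance compactSpace_isometryGroup [FiniteDimensional ℝ E] [CompactSpace M] [T2Space M] :
    CompactSpace (IsometryGroup g) := by
  obtain ⟨d, hd1, hd2, hdsymm, hdtri, hd⟩ := exists_invariant_edist g
  have hb := isSmoothMetric_metricForm g
  refine ⟨isCompact_iff_ultrafilter_le_nhds.2 fun 𝒰 _ => ?_⟩
  -- limits of equicontinuous families
  have hlim : ∀ φ : IsometryGroup g → M → M, (∀ f x y, d (φ f x) (φ f y) ≤ d x y) →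
      ∃ F : M → M, Continuous F ∧
        ∀ x, Tendsto (fun p : IsometryGroup g × M => φ p.1 p.2) ((𝒰 : Filter _) ×ˢ 𝓝 x)
          (𝓝 (F x)) := by
    intro φ hφ
    have : ∀ x, ∃ y, Tendsto (fun f => φ f x) 𝒰 (𝓝 y) := fun x => by
      obtain ⟨y, -, hy⟩ := isCompact_univ.ultrafilter_le_nhds (𝒰.map fun f => φ f x) (by simp)
      exact ⟨y, hy⟩
    choose F hF using this
    have hjoint : ∀ x, ∀ s ∈ 𝓝 (F x), ∃ V ∈ 𝓝 x, ∃ A ∈ (𝒰 : Filter (IsometryGroup g)),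
        ∀ f ∈ A, ∀ y ∈ V, φ f y ∈ s := by
      intro x s hs
      obtain ⟨c, hc, hcs⟩ := hd1 _ s hs
      have hc2 : 0 < c / 2 := ENNReal.half_pos hc.ne'
      refine ⟨_, hd2 x _ hc2, _, hF x (hd2 (F x) _ hc2), fun f hf y hy => hcs ?_⟩
      calc d (F x) (φ f y) ≤ d (F x) (φ f x) + d (φ f x) (φ f y) := hdtri _ _ _
        _ ≤ d (F x) (φ f x) + d x y := by gcongr; exact hφ f x y
        _ < c / 2 + c / 2 := ENNReal.add_lt_add hf hy
        _ = c := ENNReal.add_halves c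
    refine ⟨F, continuous_iff_continuousAt.2 fun x => ?_, fun x s hs => ?_⟩
    · intro s hs
      obtain ⟨t, ht, htc, hts⟩ := exists_mem_nhds_isClosed_subset hs
      obtain ⟨V, hV, A, hA, hAV⟩ := hjoint x t ht
      refine mem_map.2 (mem_of_superset hV fun y hy => hts ?_)
      exact htc.mem_of_tendsto (hF y) (mem_of_superset hA fun f hf => hAV f hf y hy)
    · obtain ⟨V, hV, A, hA, hAV⟩ := hjoint x s hs
      exact mem_map.2 (mem_of_superset (prod_mem_prod hA hV) fun p hp => hAV p.1 hp.1 p.2 hp.2)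
  have hpres : ∀ f : IsometryGroup g, PreservesMetric I (metricForm g) (f : M ≃ₜ M) :=
    fun f => f.2.preservesMetric
  have hpres' : ∀ f : IsometryGroup g, PreservesMetric I (metricForm g) (f : M ≃ₜ M).symm :=
    fun f => (f⁻¹).2.preservesMetric
  obtain ⟨F, hFc, hF⟩ := hlim (fun f => (f : M ≃ₜ M)) fun f => hd _ (hpres f)
  obtain ⟨F', hFc', hF'⟩ := hlim (fun f => (f : M ≃ₜ M).symm) fun f => hd _ (hpres' f)
  have hinv : ∀ (φ ψ : IsometryGroup g → M → M) (Φ Ψ : M → M),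
      (∀ x, Tendsto (fun p : IsometryGroup g × M => φ p.1 p.2) ((𝒰 : Filter _) ×ˢ 𝓝 x) (𝓝 (Φ x))) →
      (∀ x, Tendsto (fun p : IsometryGroup g × M => ψ p.1 p.2) ((𝒰 : Filter _) ×ˢ 𝓝 x) (𝓝 (Ψ x))) →
      (∀ f x, φ f (ψ f x) = x) → ∀ x, Φ (Ψ x) = x := by
    intro φ ψ Φ Ψ hφ hψ hφψ x
    have h1 : Tendsto (fun f => ψ f x) (𝒰 : Filter (IsometryGroup g)) (𝓝 (Ψ x)) :=
      (hψ x).comp (tendsto_id.prodMk (tendsto_const_nhds (x := x)))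
    have h2 := (hφ (Ψ x)).comp (tendsto_id.prodMk h1)
    refine tendsto_nhds_unique h2 (tendsto_const_nhds.congr fun f => (hφψ f x).symm)
  let e : M ≃ₜ M := ⟨⟨F, F', hinv _ _ F' F hF' hF fun f x => (f : M ≃ₜ M).symm_apply_apply x,
    hinv _ _ F F' hF hF' fun f x => (f : M ≃ₜ M).apply_symm_apply x⟩, hFc, hFc'⟩
  have hFp := hb.preservesMetric_of_tendsto 𝒰 hFc hpres hF
  have hFp' := hb.preservesMetric_of_tendsto 𝒰 hFc' hpres' hF'
  let Φ : M ≃ₘ^∞⟮I, I⟯ M := ⟨e.toEquiv, hFp.contMDiff, hFp'.contMDiff⟩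
  have he : IsIsometry g e := ⟨hFp.contMDiff, hFp'.contMDiff, fun x v w => hFp.map x v w,
    Diffeomorph.image_boundary (by simp) Φ⟩
  refine ⟨⟨e, he⟩, mem_univ _, ?_⟩
  rw [nhds_induced, ← tendsto_iff_comap, nhds_prod_eq]
  exact Tendsto.prodMk (ContinuousMap.tendsto_of_forall_tendsto_prod hF)
    (ContinuousMap.tendsto_of_forall_tendsto_prod hF')

theorem isSmoothFamily_isometryGroup [FiniteDimensional ℝ E] [LocallyCompactSpace M] :
    IsSmoothFamily I fun f : IsometryGroup g => ((f : M ≃ₜ M) : M → M) :=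
  (isSmoothMetric_metricForm g).isSmoothFamily continuous_isometryGroup_apply
    fun f => f.2.preservesMetric

end IsometryGroup

/-! ### The cotangent lift of a smooth family of maps -/

section Cotangent

/-- A family of maps with continuous expressions in charts is continuous. -/
theorem continuous_of_chartExpr {E H N P : Type*} [NormedAddCommGroup E] [NormedSpace ℝ E]
    [TopologicalSpace H] (J : ModelWithCorners ℝ E H) [TopologicalSpace N] [ChartedSpace H N]
    [TopologicalSpace P] {f : P → N → N}
    (h : ∀ (p₁ : P) (x₀ : N), ∃ (y₀ : N) (O : Set (P × E)), IsOpen O ∧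
      (p₁, extChartAt J x₀ x₀) ∈ O ∧
      (∀ w ∈ O, w.2 ∈ range J → w.2 ∈ (extChartAt J x₀).target ∧
        f w.1 ((extChartAt J x₀).symm w.2) ∈ (extChartAt J y₀).source) ∧
      ContinuousOn (fun w => chartExpr J x₀ y₀ (f w.1) w.2) (O ∩ Prod.snd ⁻¹' range J)) :
    Continuous fun w : P × N => f w.1 w.2 := by
  refine continuous_iff_continuousAt.2 fun ⟨p₁, p₀⟩ => ?_
  obtain ⟨q₀, O, hO, hm, hO', hc⟩ := h p₁ p₀
  have hr : ∀ z, extChartAt J p₀ z ∈ range J := fun z => by simp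
  have hsrc : ∀ᶠ w : P × N in 𝓝 (p₁, p₀), w.2 ∈ (extChartAt J p₀).source :=
    continuous_snd.continuousAt.eventually ((isOpen_extChartAt_source p₀).mem_nhds
      (mem_extChartAt_source p₀))
  have hpsi : ContinuousAt (fun w : P × N => (w.1, extChartAt J p₀ w.2))
      (p₁, p₀) := continuousAt_fst.prodMk
        ((continuousAt_extChartAt p₀).comp_of_eq continuousAt_snd rfl)
  have hO₂ : ∀ᶠ w : P × N in 𝓝 (p₁, p₀), (w.1, extChartAt J p₀ w.2) ∈ O :=
    hpsi.eventually (hO.mem_nhds hm)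
  have h1 : ContinuousAt (fun w : P × N =>
      chartExpr J p₀ q₀ (f w.1) (extChartAt J p₀ w.2)) (p₁, p₀) := by
    have h2 : Tendsto (fun w : P × N => (w.1, extChartAt J p₀ w.2))
        (𝓝 (p₁, p₀)) (𝓝[O ∩ Prod.snd ⁻¹' range J] (p₁, extChartAt J p₀ p₀)) :=
      tendsto_nhdsWithin_iff.2 ⟨hpsi, hO₂.mono fun w hw => ⟨hw, hr _⟩⟩
    exact (hc _ ⟨hm, hr _⟩).tendsto.comp h2
  have hval : ∀ᶠ w : P × N in 𝓝 (p₁, p₀),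
      (extChartAt J q₀).symm (chartExpr J p₀ q₀ (f w.1) (extChartAt J p₀ w.2)) = f w.1 w.2 := by
    filter_upwards [hsrc, hO₂] with w hw hwO
    have h3 := (extChartAt J p₀).left_inv hw
    rw [chartExpr, h3]
    refine (extChartAt J q₀).left_inv ?_
    have h4 := (hO' _ hwO (hr _)).2
    simp only at h4
    rwa [h3] at h4
  refine ContinuousAt.congr ?_ hval
  refine ContinuousAt.comp (g := (extChartAt J q₀).symm) ?_ h1
  refine continuousAt_extChartAt_symm'' ?_
  exact (extChartAt J q₀).map_source (hO' _ hm (hr _)).2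


universe u v

variable {E : Type u} [NormedAddCommGroup E] [NormedSpace ℝ E]
  {H : Type*} [TopologicalSpace H] {I : ModelWithCorners ℝ E H}
  {M : Type*} [TopologicalSpace M] [ChartedSpace H M] [IsManifold I ∞ M]
  {P : Type v} [TopologicalSpace P]

/-- A covector, as a linear form on the model space. -/
def modelCovector (p : CotangentBundle I M) : E →L[ℝ] ℝ := p.2

/-- A covector given by a linear form on the model space. -/
def mkCovector (x : M) (η : E →L[ℝ] ℝ) : CotangentBundle I M := ⟨x, η⟩

theorem extChartAt_cotangent_source (p₀ : CotangentBundle I M) :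
    (extChartAt (I.prod 𝓘(ℝ, E →L[ℝ] ℝ)) p₀).source =
      TotalSpace.proj ⁻¹' (extChartAt I p₀.1).source := by
  ext q
  rw [FiberBundle.extChartAt]
  simp only [PartialEquiv.trans_source, PartialEquiv.prod_source, PartialEquiv.refl_source,
    mem_inter_iff, mem_preimage, mem_prod, mem_univ, and_true, hom_trivializationAt_source]
  simp only [TangentBundle.trivializationAt_baseSet, extChartAt_source]
  exact ⟨fun h => h.2, fun h => ⟨⟨h, mem_univ _⟩, h⟩⟩

theorem extChartAt_cotangent_target (p₀ : CotangentBundle I M) :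
    (extChartAt (I.prod 𝓘(ℝ, E →L[ℝ] ℝ)) p₀).target = (extChartAt I p₀.1).target ×ˢ univ := by
  rw [FiberBundle.extChartAt_target]
  congr 1
  refine inter_eq_left.2 fun y hy => ?_
  have := (extChartAt I p₀.1).map_target hy
  simpa [hom_trivializationAt_baseSet] using this

theorem extChartAt_cotangent_apply (p₀ q : CotangentBundle I M)
    (hq : q.1 ∈ (extChartAt I p₀.1).source) :
    extChartAt (I.prod 𝓘(ℝ, E →L[ℝ] ℝ)) p₀ q =
      (extChartAt I p₀.1 q.1,
        (modelCovector q).comp (chartSymmDeriv I p₀.1 (extChartAt I p₀.1 q.1))) := by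
  have : IsManifold I 1 M := .of_le (n := ∞) (by simp)
  have h1 : trivializationAt (E →L[ℝ] ℝ)
      (fun x : M => TangentSpace I x →L[ℝ] Bundle.Trivial M ℝ x) p₀.1 q =
      (q.1, (modelCovector q).comp (chartSymmDeriv I p₀.1 (extChartAt I p₀.1 q.1))) := by
    rw [hom_trivializationAt_apply]
    have h2 := TangentBundle.symmL_trivializationAt (I := I) (x₀ := p₀.1) (x := q.1)
      (by simpa using hq)
    refine Prod.ext rfl ?_
    change ContinuousLinearMap.comp (Trivialization.continuousLinearMapAt ℝ
      (Trivial.trivialization M ℝ) q.1) (q.2.comp (Trivialization.symmL ℝ _ q.1)) = _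
    rw [h2, Trivial.continuousLinearMapAt_trivialization]
    rfl
  rw [FiberBundle.extChartAt]
  simp [h1]

theorem extChartAt_cotangent_symm_apply (p₀ : CotangentBundle I M) {w : E × (E →L[ℝ] ℝ)}
    (hw : w.1 ∈ (extChartAt I p₀.1).target) :
    (extChartAt (I.prod 𝓘(ℝ, E →L[ℝ] ℝ)) p₀).symm w =
      mkCovector ((extChartAt I p₀.1).symm w.1)
        (w.2.comp (chartDeriv I p₀.1 ((extChartAt I p₀.1).symm w.1))) := by
  set q : CotangentBundle I M := mkCovector ((extChartAt I p₀.1).symm w.1)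
        (w.2.comp (chartDeriv I p₀.1 ((extChartAt I p₀.1).symm w.1))) with hqdef
  have hq : q.1 ∈ (extChartAt I p₀.1).source := (extChartAt I p₀.1).map_target hw
  have h1 := extChartAt_cotangent_apply p₀ q hq
  have h2 : extChartAt (I.prod 𝓘(ℝ, E →L[ℝ] ℝ)) p₀ q = w := by
    rw [h1]
    have h3 : extChartAt I p₀.1 q.1 = w.1 := (extChartAt I p₀.1).right_inv hw
    refine Prod.ext h3 ?_
    rw [h3]
    change (w.2.comp _).comp _ = _
    rw [ContinuousLinearMap.comp_assoc, chartDeriv_comp_chartSymmDeriv I hw,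
      ContinuousLinearMap.comp_id]
  rw [← h2]
  exact (extChartAt (I.prod 𝓘(ℝ, E →L[ℝ] ℝ)) p₀).left_inv
    (by rw [extChartAt_cotangent_source]; exact hq)

theorem isInvertible_chartDeriv {x₀ : M} {y : E} (hy : y ∈ (extChartAt I x₀).target) :
    (chartDeriv I x₀ ((extChartAt I x₀).symm y)).IsInvertible :=
  .of_inverse (chartDeriv_comp_chartSymmDeriv I hy) (chartSymmDeriv_comp_chartDeriv I hy)

theorem inverse_chartDeriv {x₀ : M} {y : E} (hy : y ∈ (extChartAt I x₀).target) :
    (chartDeriv I x₀ ((extChartAt I x₀).symm y)).inverse = chartSymmDeriv I x₀ y :=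
  ContinuousLinearMap.inverse_eq (chartDeriv_comp_chartSymmDeriv I hy)
    (chartSymmDeriv_comp_chartDeriv I hy)

theorem isInvertible_chartSymmDeriv {x₀ : M} {y : E} (hy : y ∈ (extChartAt I x₀).target) :
    (chartSymmDeriv I x₀ y).IsInvertible :=
  .of_inverse (chartSymmDeriv_comp_chartDeriv I hy) (chartDeriv_comp_chartSymmDeriv I hy)

theorem inverse_chartSymmDeriv {x₀ : M} {y : E} (hy : y ∈ (extChartAt I x₀).target) :
    (chartSymmDeriv I x₀ y).inverse = chartDeriv I x₀ ((extChartAt I x₀).symm y) :=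
  ContinuousLinearMap.inverse_eq (chartSymmDeriv_comp_chartDeriv I hy)
    (chartDeriv_comp_chartSymmDeriv I hy)

variable {f : M → M} {x₀ y₀ : M} {y : E}

theorem isInvertible_fderivWithin_chartExpr (hy : y ∈ (extChartAt I x₀).target)
    (hf : MDifferentiableAt I I f ((extChartAt I x₀).symm y))
    (hfy : f ((extChartAt I x₀).symm y) ∈ (extChartAt I y₀).source)
    (hinv : (modelDeriv I f ((extChartAt I x₀).symm y)).IsInvertible) :
    (fderivWithin ℝ (chartExpr I x₀ y₀ f) (range I) y).IsInvertible := by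
  rw [fderivWithin_chartExpr I hy hf hfy]
  have h := isInvertible_chartDeriv (I := I) ((extChartAt I y₀).map_source hfy)
  rw [(extChartAt I y₀).left_inv hfy] at h
  exact h.comp (hinv.comp (isInvertible_chartSymmDeriv hy))

theorem inverse_fderivWithin_chartExpr (hy : y ∈ (extChartAt I x₀).target)
    (hf : MDifferentiableAt I I f ((extChartAt I x₀).symm y))
    (hfy : f ((extChartAt I x₀).symm y) ∈ (extChartAt I y₀).source)
    (hinv : (modelDeriv I f ((extChartAt I x₀).symm y)).IsInvertible) :
    (fderivWithin ℝ (chartExpr I x₀ y₀ f) (range I) y).inverse =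
      (chartDeriv I x₀ ((extChartAt I x₀).symm y)).comp
        ((modelDeriv I f ((extChartAt I x₀).symm y)).inverse.comp
          (chartSymmDeriv I y₀ (chartExpr I x₀ y₀ f y))) := by
  rw [fderivWithin_chartExpr I hy hf hfy]
  have h := isInvertible_chartDeriv (I := I) ((extChartAt I y₀).map_source hfy)
  have h' := inverse_chartDeriv (I := I) ((extChartAt I y₀).map_source hfy)
  rw [(extChartAt I y₀).left_inv hfy] at h h'
  rw [h.inverse_comp_of_left, hinv.inverse_comp_of_left, h', inverse_chartSymmDeriv hy,
    ContinuousLinearMap.comp_assoc]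
  rfl

omit [IsManifold I ∞ M] in
theorem codifferential_mkCovector (f : M → M) (x : M) (η : E →L[ℝ] ℝ) :
    codifferential I f (mkCovector x η) =
      mkCovector (f x) (η.comp (modelDeriv I f x).inverse) := rfl

/-- The expression of the codifferential in charts. -/
theorem chartExpr_codifferential (p₀ q₀ : CotangentBundle I M) {w : E × (E →L[ℝ] ℝ)}
    (hw : w.1 ∈ (extChartAt I p₀.1).target)
    (hf : MDifferentiableAt I I f ((extChartAt I p₀.1).symm w.1))
    (hfw : f ((extChartAt I p₀.1).symm w.1) ∈ (extChartAt I q₀.1).source)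
    (hinv : (modelDeriv I f ((extChartAt I p₀.1).symm w.1)).IsInvertible) :
    chartExpr (I.prod 𝓘(ℝ, E →L[ℝ] ℝ)) p₀ q₀ (codifferential I f) w =
      (chartExpr I p₀.1 q₀.1 f w.1,
        w.2.comp (fderivWithin ℝ (chartExpr I p₀.1 q₀.1 f) (range I) w.1).inverse) := by
  rw [inverse_fderivWithin_chartExpr hw hf hfw hinv, chartExpr,
    extChartAt_cotangent_symm_apply p₀ hw, codifferential_mkCovector,
    extChartAt_cotangent_apply q₀ _ hfw]
  rfl

/-- The codifferentials of a smooth family of local diffeomorphisms are a smooth family. -/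
theorem IsSmoothFamily.codifferential [CompleteSpace E] {f : P → M → M} (hf : IsSmoothFamily I f)
    (hinv : ∀ p x, (modelDeriv I (f p) x).IsInvertible) :
    IsSmoothFamily (I.prod 𝓘(ℝ, E →L[ℝ] ℝ)) fun p => codifferential I (f p) := by
  have hrange : range (I.prod 𝓘(ℝ, E →L[ℝ] ℝ)) = range I ×ˢ univ := by
    rw [modelWithCorners_prod_coe, range_prodMap]; simp
  have hmd : ∀ p, MDifferentiable I I (f p) :=
    fun p => (hf.contMDiff p).mdifferentiable (by simp)
  have key : ∀ (p₀ q₀ : CotangentBundle I M) (p₁ : P) (w₁ : E × (E →L[ℝ] ℝ)),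
      w₁.1 ∈ (extChartAt I p₀.1).target →
      f p₁ ((extChartAt I p₀.1).symm w₁.1) ∈ (extChartAt I q₀.1).source →
      ∃ O : Set (P × (E × (E →L[ℝ] ℝ))), IsOpen O ∧ (p₁, w₁) ∈ O ∧
        (∀ w ∈ O, w.2.1 ∈ range I → w.2.1 ∈ (extChartAt I p₀.1).target ∧
          f w.1 ((extChartAt I p₀.1).symm w.2.1) ∈ (extChartAt I q₀.1).source) ∧
        ∀ n, ParamDiff (range (I.prod 𝓘(ℝ, E →L[ℝ] ℝ))) O n fun w =>
          chartExpr (I.prod 𝓘(ℝ, E →L[ℝ] ℝ)) p₀ q₀ (_root_.codifferential I (f w.1)) w.2 := by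
    intro p₀ q₀ p₁ w₁ h₁ h₂
    obtain ⟨O, hO, hm, hO', hn⟩ := hf.exists_paramDiff p₀.1 q₀.1 p₁ w₁.1 h₁ h₂
    set O₁ : Set (P × (E × (E →L[ℝ] ℝ))) := (fun w => (w.1, w.2.1)) ⁻¹' O
    have hO₁ : IsOpen O₁ := hO.preimage (by fun_prop)
    refine ⟨O₁, hO₁, hm, fun w hw hws => hO' (w.1, w.2.1) hw hws, fun n => ?_⟩
    rw [hrange]
    have hfst : ∀ m, ParamDiff (range I ×ˢ (univ : Set (E →L[ℝ] ℝ))) O₁ m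
        fun w : P × (E × (E →L[ℝ] ℝ)) => w.2.1 :=
      fun m => ParamDiff.snd.clm (ContinuousLinearMap.fst ℝ E (E →L[ℝ] ℝ))
    have hsnd : ∀ m, ParamDiff (range I ×ˢ (univ : Set (E →L[ℝ] ℝ))) O₁ m
        fun w : P × (E × (E →L[ℝ] ℝ)) => w.2.2 :=
      fun m => ParamDiff.snd.clm (ContinuousLinearMap.snd ℝ E (E →L[ℝ] ℝ))
    have hu := (hn n).comp (hfst n) hO₁ fun w hw hws => ⟨hw, hws.1⟩
    have hD := ((((hn (n + 1)).fderivWithin I.uniqueDiffOn hO).inverse hO fun w hw hws =>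
      isInvertible_fderivWithin_chartExpr (hO' w hw hws).1 (hmd _ _) (hO' w hw hws).2
        (hinv _ _))).comp (hfst n) hO₁ fun w hw hws => ⟨hw, hws.1⟩
    have hη := ParamDiff.bilin (ContinuousLinearMap.compL ℝ E E ℝ) (hsnd n) hD
    refine (hu.prodMk hη).congr hO₁ fun w hw hws => ?_
    have := hO' (w.1, w.2.1) hw hws.1
    exact chartExpr_codifferential p₀ q₀ this.1 (hmd _ _) this.2 (hinv _ _)
  have hext : ∀ (p₀ q₀ : CotangentBundle I M) (p₁ : P) (w₁ : E × (E →L[ℝ] ℝ)),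
      w₁ ∈ (extChartAt (I.prod 𝓘(ℝ, E →L[ℝ] ℝ)) p₀).target →
      _root_.codifferential I (f p₁) ((extChartAt (I.prod 𝓘(ℝ, E →L[ℝ] ℝ)) p₀).symm w₁) ∈
        (extChartAt (I.prod 𝓘(ℝ, E →L[ℝ] ℝ)) q₀).source →
      ∃ O : Set (P × (E × (E →L[ℝ] ℝ))), IsOpen O ∧ (p₁, w₁) ∈ O ∧
        (∀ w ∈ O, w.2 ∈ range (I.prod 𝓘(ℝ, E →L[ℝ] ℝ)) →
          w.2 ∈ (extChartAt (I.prod 𝓘(ℝ, E →L[ℝ] ℝ)) p₀).target ∧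
          _root_.codifferential I (f w.1) ((extChartAt (I.prod 𝓘(ℝ, E →L[ℝ] ℝ)) p₀).symm w.2) ∈
            (extChartAt (I.prod 𝓘(ℝ, E →L[ℝ] ℝ)) q₀).source) ∧
        ∀ n, ParamDiff (range (I.prod 𝓘(ℝ, E →L[ℝ] ℝ))) O n fun w =>
          chartExpr (I.prod 𝓘(ℝ, E →L[ℝ] ℝ)) p₀ q₀ (_root_.codifferential I (f w.1)) w.2 := by
    intro p₀ q₀ p₁ w₁ h₁ h₂
    rw [extChartAt_cotangent_target] at h₁
    rw [extChartAt_cotangent_symm_apply p₀ h₁.1, extChartAt_cotangent_source] at h₂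
    obtain ⟨O, hO, hm, hO', hn⟩ := key p₀ q₀ p₁ w₁ h₁.1 h₂
    refine ⟨O, hO, hm, fun w hw hws => ?_, hn⟩
    rw [hrange] at hws
    obtain ⟨h3, h4⟩ := hO' w hw hws.1
    rw [extChartAt_cotangent_target, extChartAt_cotangent_symm_apply p₀ h3,
      extChartAt_cotangent_source]
    exact ⟨⟨h3, mem_univ _⟩, h4⟩
  refine ⟨continuous_of_chartExpr (I.prod 𝓘(ℝ, E →L[ℝ] ℝ))
    (N := CotangentBundle I M) (f := fun p => _root_.codifferential I (f p)) fun p₁ p₀ => ?_, fun p₀ q₀ p₁ w₁ => hext p₀ q₀ p₁ w₁⟩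
  obtain ⟨O, hO, hm, hO', hn⟩ := hext p₀ (_root_.codifferential I (f p₁) p₀) p₁ _
    (mem_extChartAt_target p₀) (by
      rw [(extChartAt _ p₀).left_inv (mem_extChartAt_source _)]; exact mem_extChartAt_source _)
  exact ⟨_, O, hO, hm, hO', (hn 0).continuousOn⟩

omit [IsManifold I ∞ M] in
theorem codifferential_id : codifferential I (id : M → M) = id := by
  funext p
  have h : modelDeriv I (id : M → M) p.1 = .id ℝ E := mfderiv_id
  change mkCovector p.1 ((modelCovector p).comp (modelDeriv I (id : M → M) p.1).inverse) = p
  rw [h, ContinuousLinearMap.inverse_id, ContinuousLinearMap.comp_id]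
  rfl

omit [IsManifold I ∞ M] in
theorem codifferential_comp {f₁ f₂ : M → M} (h₁ : MDifferentiable I I f₁)
    (h₂ : MDifferentiable I I f₂) (hinv : ∀ x, (modelDeriv I f₁ x).IsInvertible) :
    codifferential I (f₁ ∘ f₂) = codifferential I f₁ ∘ codifferential I f₂ := by
  funext p
  have h : modelDeriv I (f₁ ∘ f₂) p.1 =
      (modelDeriv I f₁ (f₂ p.1)).comp (modelDeriv I f₂ p.1) :=
    mfderiv_comp p.1 (h₁ _) (h₂ _)
  change mkCovector _ ((modelCovector p).comp (modelDeriv I (f₁ ∘ f₂) p.1).inverse) =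
    mkCovector _ (((modelCovector p).comp (modelDeriv I f₂ p.1).inverse).comp
      (modelDeriv I f₁ (f₂ p.1)).inverse)
  rw [h, (hinv _).inverse_comp_of_left, ContinuousLinearMap.comp_assoc]
  rfl

omit [IsManifold I ∞ M] in
theorem isInvertible_modelDeriv {f f' : M → M} (hf : MDifferentiable I I f)
    (hf' : MDifferentiable I I f') (h : ∀ x, f' (f x) = x) (h' : ∀ x, f (f' x) = x) (x : M) :
    (modelDeriv I f x).IsInvertible := by
  have key : ∀ {k k' : M → M}, MDifferentiable I I k → MDifferentiable I I k' →
      (∀ x, k' (k x) = x) → ∀ x, (modelDeriv I k' (k x)).comp (modelDeriv I k x) = .id ℝ E := by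
    intro k k' hk hk' hkk x
    have h1 : modelDeriv I (k' ∘ k) x = (modelDeriv I k' (k x)).comp (modelDeriv I k x) :=
      mfderiv_comp x (hk' _) (hk _)
    rw [← h1, show k' ∘ k = id from funext hkk]
    exact mfderiv_id
  refine .of_inverse (g := modelDeriv I f' (f x)) ?_ (key hf hf' h x)
  have := key hf' hf h' (f x)
  rwa [h] at this

end Cotangent

/-! ### Smooth actions -/

/-- A smooth action of a topological group on a manifold, with all derivatives jointly continuous
in the point and the group element. -/
structure IsSmoothAction {E : Type*} [NormedAddCommGroup E] [NormedSpace ℝ E]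
    {H : Type*} [TopologicalSpace H] (J : ModelWithCorners ℝ E H)
    {N : Type*} [TopologicalSpace N] [ChartedSpace H N]
    {G : Type*} [Group G] [TopologicalSpace G] (act : G → N → N) : Prop where
  one : act 1 = id
  mul : ∀ a b, act (a * b) = act a ∘ act b
  smooth : IsSmoothFamily J act

section CotangentActions

variable {E : Type*} [NormedAddCommGroup E] [NormedSpace ℝ E] [FiniteDimensional ℝ E]
  {H : Type*} [TopologicalSpace H] {I : ModelWithCorners ℝ E H}
  {M : Type*} [TopologicalSpace M] [ChartedSpace H M] [IsManifold I ∞ M]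
  {g : ContMDiffRiemannianMetric I ∞ E (fun x : M => TangentSpace I x)}

omit [FiniteDimensional ℝ E] in
theorem IsometryGroup.mdifferentiable (f : IsometryGroup g) : MDifferentiable I I (f : M ≃ₜ M) :=
  f.2.contMDiff.mdifferentiable (by simp)

omit [FiniteDimensional ℝ E] in
theorem IsometryGroup.isInvertible_modelDeriv (f : IsometryGroup g) (x : M) :
    (modelDeriv I (f : M ≃ₜ M) x).IsInvertible :=
  _root_.isInvertible_modelDeriv f.mdifferentiable (f⁻¹).mdifferentiable
    (f : M ≃ₜ M).symm_apply_apply (f : M ≃ₜ M).apply_symm_apply x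

theorem isSmoothAction_cotangentAction [LocallyCompactSpace M] :
    IsSmoothAction (I.prod 𝓘(ℝ, E →L[ℝ] ℝ)) (cotangentAction (g := g)) where
  one := codifferential_id
  mul a b := codifferential_comp a.mdifferentiable b.mdifferentiable a.isInvertible_modelDeriv
  smooth := isSmoothFamily_isometryGroup.codifferential fun f => f.isInvertible_modelDeriv

/-! ### The boundary -/

variable {E' : Type*} [NormedAddCommGroup E'] [NormedSpace ℝ E']
  {H' : Type*} [TopologicalSpace H'] {I' : ModelWithCorners ℝ E' H'}
  {X : Type*} [TopologicalSpace X] [ChartedSpace H' X]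

omit [FiniteDimensional ℝ E] [IsManifold I ∞ M] in
theorem Manifold.IsImmersionAt.injective_mfderiv [I'.Boundaryless] {ι : X → M} {x : X}
    (h : IsImmersionAt I' I ∞ ι x) : Function.Injective (mfderiv I' I ι x) := by
  have hd : MDifferentiableAt I' I ι x := h.contMDiffAt.mdifferentiableAt (by simp)
  set e := h.domChart.extend I' with he
  set e' := h.codChart.extend I with he'
  have hcod : MDifferentiableAt I 𝓘(ℝ, E) e' (ι x) :=
    (h.codChart.contMDiffAt_extend h.codChart_mem_maximalAtlas
      h.mem_codChart_source).mdifferentiableAt (by simp)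
  have hex : e x ∈ e.target := e.map_source (by simpa [he] using h.mem_domChart_source)
  have het : e.target ∈ 𝓝 (e x) := (h.domChart.isOpen_extend_target).mem_nhds hex
  have hdom : MDifferentiableAt 𝓘(ℝ, E') I' e.symm (e x) := by
    refine ((contMDiffOn_extend_symm h.domChart_mem_maximalAtlas).contMDiffAt ?_).mdifferentiableAt
      (by simp)
    rw [← OpenPartialHomeomorph.extend_target']
    exact het
  have hev : ∀ᶠ z in 𝓝 x, e' (ι z) = h.equiv (e z, 0) := by
    filter_upwards [h.domChart.open_source.mem_nhds h.mem_domChart_source] with z hz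
    have hz' : z ∈ e.source := by simpa [he] using hz
    have := h.writtenInCharts (e.map_source hz')
    simp only [Function.comp_apply] at this
    rwa [e.left_inv hz'] at this
  set r : E → X := fun y => e.symm (h.equiv.symm y).1
  have hr0 : (h.equiv.symm (e' (ι x))).1 = e x := by rw [hev.self_of_nhds]; simp
  have hr : MDifferentiableAt 𝓘(ℝ, E) I' r (e' (ι x)) := by
    refine MDifferentiableAt.comp (I' := 𝓘(ℝ, E')) (e' (ι x))
      (g := e.symm) (f := fun y => (h.equiv.symm y).1) ?_ ?_
    · rw [hr0]; exact hdom
    · exact DifferentiableAt.mdifferentiableAt (by fun_prop)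
  have hid : (r ∘ (e' ∘ ι)) =ᶠ[𝓝 x] id := by
    filter_upwards [hev, h.domChart.open_source.mem_nhds h.mem_domChart_source] with z hz hzs
    simp only [r, Function.comp_apply, hz, id]
    simp only [ContinuousLinearEquiv.symm_apply_apply]
    exact e.left_inv (by simpa [he] using hzs)
  have h1 := hid.mfderiv_eq (I := I') (I' := I')
  rw [mfderiv_id, mfderiv_comp x hr (hcod.comp x hd), mfderiv_comp x hcod hd] at h1
  refine fun v w hvw => ?_
  have hv := congrArg (fun L : E' →L[ℝ] E' => L v) h1
  have hw := congrArg (fun L : E' →L[ℝ] E' => L w) h1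
  refine hv.symm.trans (Eq.trans ?_ hw)
  exact congrArg (fun u => mfderiv 𝓘(ℝ, E) I' r (e' (ι x)) (mfderiv I 𝓘(ℝ, E) e' (ι x) u)) hvw

variable (I I') in
/-- The pullback of a metric under a map. -/
def pullbackMetric (ι : X → M) (b : M → E →L[ℝ] E →L[ℝ] ℝ) (x : X) : E' →L[ℝ] E' →L[ℝ] ℝ :=
  (b (ι x)).bilinearComp (mfderiv I' I ι x) (mfderiv I' I ι x)

omit [FiniteDimensional ℝ E] in
theorem mfderiv_comp_chartSymmDeriv [IsManifold I' ∞ X] {ι : X → M} (hι : ContMDiff I' I ∞ ι)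
    {x₀ : X} {m₀ : M} {y : E'} (hy : y ∈ (extChartAt I' x₀).target)
    (hιy : ι ((extChartAt I' x₀).symm y) ∈ (extChartAt I m₀).source) (v : E') :
    (mfderiv I' I ι ((extChartAt I' x₀).symm y) (chartSymmDeriv I' x₀ y v) : E) =
      chartSymmDeriv I m₀ (extChartAt I m₀ (ι ((extChartAt I' x₀).symm y)))
        (fderivWithin ℝ (fun z => extChartAt I m₀ (ι ((extChartAt I' x₀).symm z))) (range I') y
          v) := by
  have : IsManifold I 1 M := .of_le (n := ∞) (by simp)
  have : IsManifold I' 1 X := .of_le (n := ∞) (by simp)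
  have hU : UniqueMDiffWithinAt 𝓘(ℝ, E') (range I') y :=
    I'.uniqueMDiffOn _ (extChartAt_target_subset_range x₀ hy)
  have h1 : MDifferentiableWithinAt 𝓘(ℝ, E') I' (extChartAt I' x₀).symm (range I') y :=
    mdifferentiableWithinAt_extChartAt_symm hy
  have h2 : MDifferentiableAt I 𝓘(ℝ, E) (extChartAt I m₀) (ι ((extChartAt I' x₀).symm y)) :=
    mdifferentiableAt_extChartAt (by simpa using hιy)
  have hd := hι.mdifferentiable (by simp) ((extChartAt I' x₀).symm y)
  have e1 : mfderivWithin 𝓘(ℝ, E') I (ι ∘ (extChartAt I' x₀).symm) (range I') y =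
      (mfderiv I' I ι ((extChartAt I' x₀).symm y)).comp
        (mfderivWithin 𝓘(ℝ, E') I' (extChartAt I' x₀).symm (range I') y) :=
    mfderiv_comp_mfderivWithin y hd h1 hU
  have e2 := mfderiv_comp_mfderivWithin (g := extChartAt I m₀)
    (f := ι ∘ (extChartAt I' x₀).symm) (s := range I') y h2 (hd.comp_mdifferentiableWithinAt y h1)
    hU
  rw [e1, mfderivWithin_eq_fderivWithin] at e2
  have h5 := chartSymmDeriv_comp_chartDeriv I (x₀ := m₀)
    ((extChartAt I m₀).map_source hιy)
  rw [(extChartAt I m₀).left_inv hιy] at h5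
  have e3 := congrArg (fun L : E' →L[ℝ] E => L v) e2
  have h6 := congrArg (fun L : E →L[ℝ] E =>
    L (mfderiv I' I ι ((extChartAt I' x₀).symm y) (chartSymmDeriv I' x₀ y v))) h5
  refine h6.symm.trans ?_
  exact congrArg (chartSymmDeriv I m₀ (extChartAt I m₀ (ι ((extChartAt I' x₀).symm y)))) e3.symm

omit [FiniteDimensional ℝ E] in
theorem IsSmoothMetric.pullbackMetric [IsManifold I' ∞ X] [FiniteDimensional ℝ E']
    [I'.Boundaryless] {ι : X → M} (hι : IsImmersion I' I ∞ ι) {b : M → E →L[ℝ] E →L[ℝ] ℝ}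
    (hb : IsSmoothMetric I b) : IsSmoothMetric I' (pullbackMetric I I' ι b) := by
  have hsm : ContMDiff I' I ∞ ι := hι.contMDiff
  refine ⟨fun x v w => hb.symm _ _ _, fun x v hv => hb.pos _ _ ?_, fun x₀ => ?_⟩
  · intro h
    exact hv ((hι.isImmersionAt x).injective_mfderiv (h.trans (map_zero _).symm))
  · refine contDiffOn_clm_apply.2 fun v => contDiffOn_clm_apply.2 fun w y hy => ?_
    set m₀ := ι ((extChartAt I' x₀).symm y) with hm₀
    set φ : E' → E := fun z => extChartAt I m₀ (ι ((extChartAt I' x₀).symm z)) with hφ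
    have hsub : (extChartAt I' x₀).target ⊆ range I' := extChartAt_target_subset_range x₀
    have hev : ∀ᶠ z in 𝓝[(extChartAt I' x₀).target] y,
        ι ((extChartAt I' x₀).symm z) ∈ (extChartAt I m₀).source :=
      ((hsm.continuous.continuousAt.comp (continuousAt_extChartAt_symm'' hy)).eventually
        ((isOpen_extChartAt_source m₀).mem_nhds (mem_extChartAt_source m₀))).filter_mono
          nhdsWithin_le_nhds
    have hφc : ContDiffWithinAt ℝ ∞ φ (range I') y := by
      have h := (contMDiffAt_iff_of_mem_source (x := x₀) (y := m₀)
        (by simpa using (extChartAt I' x₀).map_target hy) (mem_chart_source H m₀)).1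
          (hsm ((extChartAt I' x₀).symm y))
      rw [(extChartAt I' x₀).right_inv hy] at h
      exact h.2
    have hDφ : ContDiffWithinAt ℝ ∞ (_root_.fderivWithin ℝ φ (range I')) (range I') y :=
      hφc.fderivWithin_right I'.uniqueDiffOn (by simp) (hsub hy)
    have hB : ContDiffWithinAt ℝ ∞ (fun z => coordMetric I b m₀ (φ z))
        ((extChartAt I' x₀).target ∩ φ ⁻¹' (extChartAt I m₀).target) y :=
      ContDiffWithinAt.comp (g := coordMetric I b m₀) y
        (hb.smooth m₀ _ (mem_extChartAt_target m₀)) (hφc.mono (inter_subset_left.trans hsub)) inter_subset_right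
    have hB' : ContDiffWithinAt ℝ ∞ (fun z => coordMetric I b m₀ (φ z))
        (extChartAt I' x₀).target y := by
      refine hB.mono_of_mem_nhdsWithin (inter_mem self_mem_nhdsWithin ?_)
      exact hev.mono fun z hz => (extChartAt I m₀).map_source hz
    have h1 := ((hB'.clm_apply ((hDφ.mono hsub).clm_apply contDiffWithinAt_const)).clm_apply
      ((hDφ.mono hsub).clm_apply contDiffWithinAt_const) : ContDiffWithinAt ℝ ∞ (fun z =>
        coordMetric I b m₀ (φ z) (_root_.fderivWithin ℝ φ (range I') z v)
          (_root_.fderivWithin ℝ φ (range I') z w)) _ y)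
    have key : ∀ z ∈ (extChartAt I' x₀).target,
        ι ((extChartAt I' x₀).symm z) ∈ (extChartAt I m₀).source →
        coordMetric I' (_root_.pullbackMetric I I' ι b) x₀ z v w =
          coordMetric I b m₀ (φ z) (_root_.fderivWithin ℝ φ (range I') z v)
          (_root_.fderivWithin ℝ φ (range I') z w) := by
      intro z hz hzs
      rw [coordMetric_apply, coordMetric_apply, ← mfderiv_comp_chartSymmDeriv hsm hz hzs v,
        ← mfderiv_comp_chartSymmDeriv hsm hz hzs w, hφ]
      simp only [(extChartAt I m₀).left_inv hzs]
      rfl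
    refine h1.congr_of_eventuallyEq ?_ (key y hy (mem_extChartAt_source m₀))
    filter_upwards [hev, self_mem_nhdsWithin] with z hz hz'
    exact key z hz' hz

omit [FiniteDimensional ℝ E] [IsManifold I ∞ M] [ChartedSpace H M] [ChartedSpace H' X]
  [TopologicalSpace X] [TopologicalSpace M] in
theorem boundaryMap_spec {ι : X → M} {f : M → M} (hf : MapsTo f (range ι) (range ι)) (x : X) :
    ι (boundaryMap ι f x) = f (ι x) := by
  have h : ∃ y, ι y = f (ι x) := hf (mem_range_self x)
  rw [boundaryMap, dif_pos h]
  exact h.choose_spec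

omit [FiniteDimensional ℝ E] [TopologicalSpace X] in
theorem IsometryGroup.mapsTo_boundary {ι : X → M} (hX : range ι = I.boundary M)
    (f : IsometryGroup g) : MapsTo (f : M ≃ₜ M) (range ι) (range ι) := by
  rw [hX]
  exact mapsTo_iff_image_subset.2 f.2.boundary.subset

omit [FiniteDimensional ℝ E] in
theorem continuous_boundaryMap [LocallyCompactSpace M] {ι : X → M} (hι : IsEmbedding ι)
    (hX : range ι = I.boundary M) :
    Continuous fun w : IsometryGroup g × X => boundaryMap ι (w.1 : M ≃ₜ M) w.2 := by
  refine hι.continuous_iff.2 ?_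
  have : (ι ∘ fun w : IsometryGroup g × X => boundaryMap ι (w.1 : M ≃ₜ M) w.2) =
      fun w => (w.1 : M ≃ₜ M) (ι w.2) :=
    funext fun w => boundaryMap_spec (w.1.mapsTo_boundary hX) w.2
  rw [this]
  exact continuous_isometryGroup_apply.comp
    (continuous_fst.prodMk (hι.continuous.comp continuous_snd))

omit [FiniteDimensional ℝ E] in
theorem IsometryGroup.contMDiff_boundaryMap [LocallyCompactSpace M] [IsManifold I' ∞ X]
    {ι : X → M} (hι : IsSmoothEmbedding I' I ∞ ι) (hX : range ι = I.boundary M)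
    (f : IsometryGroup g) : ContMDiff I' I' ∞ (boundaryMap ι (f : M ≃ₜ M)) := by
  intro x
  refine (ContMDiffAt.iff_comp_isImmersionAt (hι.isImmersion.isImmersionAt _)).2 ⟨?_, ?_⟩
  · exact ((continuous_boundaryMap hι.isEmbedding hX).comp
      (Continuous.prodMk_right f)).continuousAt
  · have : ι ∘ boundaryMap ι (f : M ≃ₜ M) = (f : M ≃ₜ M) ∘ ι :=
      funext fun x => boundaryMap_spec (f.mapsTo_boundary hX) x
    rw [this]
    exact (f.2.contMDiff.comp hι.isImmersion.contMDiff) x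

omit [FiniteDimensional ℝ E] in
theorem IsometryGroup.preservesMetric_boundaryMap [LocallyCompactSpace M] [IsManifold I' ∞ X]
    {ι : X → M} (hι : IsSmoothEmbedding I' I ∞ ι) (hX : range ι = I.boundary M)
    (f : IsometryGroup g) :
    PreservesMetric I' (pullbackMetric I I' ι (metricForm g)) (boundaryMap ι (f : M ≃ₜ M)) := by
  refine ⟨f.contMDiff_boundaryMap hι hX, fun x v w => ?_⟩
  have hιd : MDifferentiable I' I ι := hι.isImmersion.contMDiff.mdifferentiable (by simp)
  have hbd : MDifferentiable I' I' (boundaryMap ι (f : M ≃ₜ M)) :=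
    (f.contMDiff_boundaryMap hι hX).mdifferentiable (by simp)
  have hcomp : ι ∘ boundaryMap ι (f : M ≃ₜ M) = (f : M ≃ₜ M) ∘ ι :=
    funext fun x => boundaryMap_spec (f.mapsTo_boundary hX) x
  have h1 : mfderiv I' I (ι ∘ boundaryMap ι (f : M ≃ₜ M)) x =
      (mfderiv I' I ι (boundaryMap ι (f : M ≃ₜ M) x)).comp
        (mfderiv I' I' (boundaryMap ι (f : M ≃ₜ M)) x) := mfderiv_comp x (hιd _) (hbd _)
  have h2 : mfderiv I' I ((f : M ≃ₜ M) ∘ ι) x =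
      (mfderiv I I (f : M ≃ₜ M) (ι x)).comp (mfderiv I' I ι x) :=
    mfderiv_comp x (f.mdifferentiable _) (hιd _)
  have key : ∀ u : E', (mfderiv I' I ι (boundaryMap ι (f : M ≃ₜ M) x)
      (modelDeriv I' (boundaryMap ι (f : M ≃ₜ M)) x u) : E) =
      modelDeriv I (f : M ≃ₜ M) (ι x) (mfderiv I' I ι x u) := by
    intro u
    have e1 := congrArg (fun L : E' →L[ℝ] E => L u) h1
    have e2 := congrArg (fun L : E' →L[ℝ] E => L u) h2
    have e3 : (mfderiv I' I (ι ∘ boundaryMap ι (f : M ≃ₜ M)) x : E' →L[ℝ] E) =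
      mfderiv I' I ((f : M ≃ₜ M) ∘ ι) x := by rw [hcomp]
    exact e1.symm.trans ((congrArg (fun L : E' →L[ℝ] E => L u) e3).trans e2)
  have hm := f.2.preservesMetric.map (ι x) (mfderiv I' I ι x v) (mfderiv I' I ι x w)
  refine Eq.trans ?_ hm
  change metricForm g (ι (boundaryMap ι (f : M ≃ₜ M) x)) _ _ = _
  erw [key v, key w, boundaryMap_spec (f.mapsTo_boundary hX) x]

theorem isSmoothAction_boundaryCotangentAction [LocallyCompactSpace M] [IsManifold I' ∞ X]
    [FiniteDimensional ℝ E'] [I'.Boundaryless]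
    {ι : X → M} (hι : IsSmoothEmbedding I' I ∞ ι) (hX : range ι = I.boundary M) :
    IsSmoothAction (I'.prod 𝓘(ℝ, E' →L[ℝ] ℝ)) (boundaryCotangentAction (g := g) I' ι) := by
  have hinj := hι.isEmbedding.injective
  have hone : boundaryMap ι ((1 : IsometryGroup g) : M ≃ₜ M) = id := funext fun x =>
    hinj (boundaryMap_spec ((1 : IsometryGroup g).mapsTo_boundary hX) x)
  have hmul : ∀ a b : IsometryGroup g, boundaryMap ι ((a * b : IsometryGroup g) : M ≃ₜ M) =
      boundaryMap ι (a : M ≃ₜ M) ∘ boundaryMap ι (b : M ≃ₜ M) := fun a b => funext fun x => hinj <| by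
    rw [boundaryMap_spec ((a * b).mapsTo_boundary hX) x, Function.comp_apply,
      boundaryMap_spec (a.mapsTo_boundary hX), boundaryMap_spec (b.mapsTo_boundary hX)]
    rfl
  have hmd : ∀ a : IsometryGroup g, MDifferentiable I' I' (boundaryMap ι (a : M ≃ₜ M)) :=
    fun a => (a.contMDiff_boundaryMap hι hX).mdifferentiable (by simp)
  have hinv : ∀ (a : IsometryGroup g) x,
      (modelDeriv I' (boundaryMap ι (a : M ≃ₜ M)) x).IsInvertible := fun a =>
    isInvertible_modelDeriv (hmd a) (hmd a⁻¹)
      (fun x => by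
        have := congrFun (hmul a⁻¹ a) x
        rw [inv_mul_cancel, hone] at this
        exact this.symm)
      (fun x => by
        have := congrFun (hmul a a⁻¹) x
        rw [mul_inv_cancel, hone] at this
        exact this.symm)
  refine ⟨?_, fun a b => ?_, ?_⟩
  · unfold boundaryCotangentAction
    rw [hone]
    exact codifferential_id
  · unfold boundaryCotangentAction
    rw [hmul]
    exact codifferential_comp (hmd a) (hmd b) (hinv a)
  · exact (((isSmoothMetric_metricForm g).pullbackMetric hι.isImmersion).isSmoothFamily
      (continuous_boundaryMap hι.isEmbedding hX)
      fun f => f.preservesMetric_boundaryMap hι hX).codifferential hinv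

end CotangentActions

/-! ### Groups of polynomial growth -/

section Growth

variable {Γ : Type*} [Group Γ] {S : Finset Γ}

theorem HasPolynomialGrowth.exists_summable (h : HasPolynomialGrowth S) :
    ∃ r : ℕ, Summable fun γ : Γ => ((1 + (wordLength S γ : ℝ)) ^ r)⁻¹ := by
  classical
  obtain ⟨C, d, hC⟩ := h
  have hbase : Summable fun n : ℕ => (C : ℝ) * (1 / ((n : ℝ) + 1) ^ 2) := by
    have h := (summable_nat_add_iff (f := fun n : ℕ => 1 / (n : ℝ) ^ 2) 1).2
      (Real.summable_one_div_nat_pow.2 one_lt_two)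
    exact Summable.mul_left _ (by simpa using h)
  refine ⟨d + 2, summable_of_sum_le (c := ∑' n : ℕ, (C : ℝ) * (1 / ((n : ℝ) + 1) ^ 2))
    (fun γ => by positivity) fun u => ?_⟩
  set t := u.image (wordLength S)
  rw [← Finset.sum_fiberwise_of_maps_to (t := t) (g := wordLength S)
    fun γ hγ => Finset.mem_image_of_mem _ hγ]
  refine le_trans (Finset.sum_le_sum fun n _ => ?_)
    (hbase.sum_le_tsum t fun n _ => by positivity)
  have hcard : ((u.filter fun γ => wordLength S γ = n).card : ℝ) ≤ C * ((n : ℝ) + 1) ^ d := by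
    have h1 : (((u.filter fun γ => wordLength S γ = n) : Set Γ)).encard ≤
        ((C * (n + 1) ^ d : ℕ) : ℕ∞) :=
      (encard_le_encard fun γ hγ => by
        simp only [Finset.coe_filter, mem_ofPred_eq] at hγ
        exact hγ.2.le).trans (hC n)
    rw [encard_coe_eq_coe_finsetCard] at h1
    exact_mod_cast h1
  calc ∑ γ ∈ u with wordLength S γ = n, ((1 + (wordLength S γ : ℝ)) ^ (d + 2))⁻¹
      = ∑ γ ∈ u with wordLength S γ = n, ((1 + (n : ℝ)) ^ (d + 2))⁻¹ :=
        Finset.sum_congr rfl fun γ hγ => by rw [(Finset.mem_filter.1 hγ).2]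
    _ = (u.filter fun γ => wordLength S γ = n).card * ((1 + (n : ℝ)) ^ (d + 2))⁻¹ := by
        rw [Finset.sum_const, nsmul_eq_mul]
    _ ≤ (C * ((n : ℝ) + 1) ^ d) * ((1 + (n : ℝ)) ^ (d + 2))⁻¹ := by gcongr
    _ = C * (1 / ((n : ℝ) + 1) ^ 2) := by
        rw [add_comm (n : ℝ) 1, pow_add]
        field_simp

theorem HasPolynomialGrowth.countable (h : HasPolynomialGrowth S) : Countable Γ := by
  obtain ⟨r, hr⟩ := h.exists_summable
  have h1 := hr.countable_support
  have h2 : Function.support (fun γ : Γ => ((1 + (wordLength S γ : ℝ)) ^ r)⁻¹) = univ :=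
    eq_univ_of_forall fun γ => by
      have : (0 : ℝ) < ((1 + (wordLength S γ : ℝ)) ^ r)⁻¹ := by positivity
      exact this.ne'
  rw [h2] at h1
  exact countable_univ_iff.1 h1

theorem HasPolynomialGrowth.tendsto_wordLength (h : HasPolynomialGrowth S) :
    Tendsto (wordLength S) cofinite atTop := by
  obtain ⟨C, d, hC⟩ := h
  refine tendsto_atTop.2 fun n => ?_
  have hfin : {γ : Γ | wordLength S γ ≤ n}.Finite :=
    finite_of_encard_le_coe (hC n)
  refine mem_cofinite.2 (hfin.subset fun γ hγ => ?_)
  simp only [mem_compl_iff, mem_ofPred_eq, not_le] at hγ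
  exact hγ.le

end Growth

/-! ### Alternating forms -/

section Alternating

variable {E F : Type*} [NormedAddCommGroup E] [NormedSpace ℝ E] [NormedAddCommGroup F]
  [NormedSpace ℝ F] {k l : ℕ}

theorem norm_alternatization_le (f : ContinuousMultilinearMap ℝ (fun _ : Fin k => E) ℂ) :
    ‖ContinuousMultilinearMap.alternatization f‖ ≤ k.factorial * ‖f‖ := by
  refine ContinuousAlternatingMap.opNorm_le_bound _ (by positivity) fun v => ?_
  rw [ContinuousMultilinearMap.alternatization_apply_apply]
  refine (norm_sum_le _ _).trans ?_
  have : ∀ σ : Equiv.Perm (Fin k), ‖Equiv.Perm.sign σ • f (v ∘ σ)‖ ≤ ‖f‖ * ∏ i, ‖v i‖ := by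
    intro σ
    have h1 : ‖Equiv.Perm.sign σ • f (v ∘ σ)‖ = ‖f (v ∘ σ)‖ := by
      rcases Int.units_eq_one_or (Equiv.Perm.sign σ) with h | h <;> simp [h]
    rw [h1, ← Equiv.prod_comp σ fun i => ‖v i‖]
    exact f.le_opNorm _
  refine (Finset.sum_le_sum fun σ _ => this σ).trans_eq ?_
  simp [Finset.card_univ, Fintype.card_perm, mul_assoc]

/-- The projection of multilinear forms onto alternating forms. -/
def alternatizationCLM (E : Type*) [NormedAddCommGroup E] [NormedSpace ℝ E] (k : ℕ) :
    ContinuousMultilinearMap ℝ (fun _ : Fin k => E) ℂ →L[ℝ] E [⋀^Fin k]→L[ℝ] ℂ :=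
  LinearMap.mkContinuous
    { toFun f := ContinuousMultilinearMap.alternatization f
      map_add' f g := map_add _ f g
      map_smul' c f := by
        ext v
        simp [ContinuousMultilinearMap.alternatization_apply_apply, Finset.mul_sum,
          Units.smul_def, mul_left_comm] }
    k.factorial norm_alternatization_le

theorem alternatizationCLM_coe (α : E [⋀^Fin k]→L[ℝ] ℂ) :
    alternatizationCLM E k α.toContinuousMultilinearMap = (k.factorial : ℝ) • α := by
  ext v
  change ContinuousMultilinearMap.alternatization α.toContinuousMultilinearMap v = _
  rw [ContinuousMultilinearMap.alternatization_apply_apply]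
  have : ∀ σ : Equiv.Perm (Fin k),
      Equiv.Perm.sign σ • α (v ∘ σ) = α v := fun σ => by
    change Equiv.Perm.sign σ • α.toAlternatingMap (v ∘ σ) = α v
    rw [AlternatingMap.map_perm, smul_smul, Int.units_mul_self, one_smul]
    rfl
  simp [this, Finset.card_univ, Fintype.card_perm]

theorem contDiff_compContinuousLinearMap {n : ℕ∞ω} :
    ContDiff ℝ n fun p : (F [⋀^Fin k]→L[ℝ] ℂ) × (E →L[ℝ] F) =>
      p.1.compContinuousLinearMap p.2 := by
  have h1 : ContDiff ℝ n fun p : (F [⋀^Fin k]→L[ℝ] ℂ) × (E →L[ℝ] F) =>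
      ContinuousMultilinearMap.compContinuousLinearMapContinuousMultilinear ℝ (fun _ : Fin k => E)
        (fun _ => F) ℂ (fun _ => p.2)
        (ContinuousAlternatingMap.toContinuousMultilinearMapCLM ℝ p.1) := by
    refine ContDiff.clm_apply ?_ ((ContinuousLinearMap.contDiff _).comp contDiff_fst)
    exact (ContinuousMultilinearMap.contDiff _).comp (contDiff_pi.2 fun _ => contDiff_snd)
  have h2 := contDiff_const.smul ((alternatizationCLM E k).contDiff.comp h1) (n := n)
    (f := fun _ => ((k.factorial : ℝ)⁻¹))
  convert h2 using 2 with p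
  have h3 := alternatizationCLM_coe (p.1.compContinuousLinearMap p.2)
  have h4 : (k.factorial : ℝ)⁻¹ • (alternatizationCLM E k
      (p.1.compContinuousLinearMap p.2).toContinuousMultilinearMap) =
      p.1.compContinuousLinearMap p.2 := by
    rw [h3, smul_smul, inv_mul_cancel₀ (by positivity), one_smul]
  exact h4.symm

theorem norm_wedge_le (α : E [⋀^Fin k]→L[ℝ] ℂ) (β : E [⋀^Fin l]→L[ℝ] ℂ) :
    ‖wedge α β‖ ≤ (k + l).factorial * (‖α‖ * ‖β‖) := by
  have h1 : ‖prodMultilinear α β‖ ≤ ‖α‖ * ‖β‖ := by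
    refine ContinuousMultilinearMap.opNorm_le_bound (by positivity) fun v => ?_
    change ‖α (fun i => v (finSumFinEquiv (Sum.inl i))) *
      β (fun i => v (finSumFinEquiv (Sum.inr i)))‖ ≤ _
    rw [norm_mul, ← Equiv.prod_comp finSumFinEquiv fun i => ‖v i‖, Fintype.prod_sum_type]
    calc _ ≤ (‖α‖ * _) * (‖β‖ * _) := mul_le_mul (α.le_opNorm _) (β.le_opNorm _)
          (norm_nonneg _) (by positivity)
      _ = _ := by ring
  have h2 : ((k.factorial * l.factorial : ℝ)⁻¹) ≤ 1 :=
    inv_le_one_of_one_le₀ (by exact_mod_cast Nat.mul_pos k.factorial_pos l.factorial_pos)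
  have h3 := (norm_alternatization_le (prodMultilinear α β)).trans
    (mul_le_mul_of_nonneg_left h1 (by positivity))
  rw [wedge, norm_smul, Real.norm_of_nonneg (by positivity)]
  exact (mul_le_of_le_one_left (norm_nonneg _) h2).trans h3

end Alternating

section Wedge

variable {V W : Type*} [AddCommGroup V] [Module ℝ V] [TopologicalSpace V]
  [AddCommGroup W] [Module ℝ W] [TopologicalSpace W] {k l : ℕ}

theorem wedge_apply (α : V [⋀^Fin k]→L[ℝ] ℂ) (β : V [⋀^Fin l]→L[ℝ] ℂ) (v : Fin (k + l) → V) :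
    wedge α β v = ((k.factorial * l.factorial : ℝ)⁻¹) • ∑ σ : Equiv.Perm (Fin (k + l)),
      Equiv.Perm.sign σ • (α (fun i => v (σ (Fin.castAdd l i))) *
        β (fun i => v (σ (Fin.natAdd k i)))) := by
  rw [wedge, ContinuousAlternatingMap.smul_apply,
    ContinuousMultilinearMap.alternatization_apply_apply]
  rfl

theorem wedge_compContinuousLinearMap (α : V [⋀^Fin k]→L[ℝ] ℂ) (β : V [⋀^Fin l]→L[ℝ] ℂ)
    (A : W →L[ℝ] V) : (wedge α β).compContinuousLinearMap A =
      wedge (α.compContinuousLinearMap A) (β.compContinuousLinearMap A) := by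
  ext v
  rw [ContinuousAlternatingMap.compContinuousLinearMap_apply, wedge_apply, wedge_apply]
  rfl

theorem wedge_congr {α α' : V [⋀^Fin k]→L[ℝ] ℂ} {β β' : V [⋀^Fin l]→L[ℝ] ℂ} {s : Set V}
    (hα : ∀ w : Fin k → V, (∀ i, w i ∈ s) → α w = α' w)
    (hβ : ∀ w : Fin l → V, (∀ i, w i ∈ s) → β w = β' w) {v : Fin (k + l) → V}
    (hv : ∀ i, v i ∈ s) : wedge α β v = wedge α' β' v := by
  rw [wedge_apply, wedge_apply]
  congr 1
  refine Finset.sum_congr rfl fun σ _ => ?_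
  rw [hα _ fun i => hv _, hβ _ fun i => hv _]

theorem val_finRotate_pow_apply (n k : ℕ) (i : Fin (n + 1)) :
    ((finRotate (n + 1) ^ k) i : ℕ) = (i + k) % (n + 1) := by
  induction k with
  | zero => simp [Nat.mod_eq_of_lt i.2]
  | succ k ih =>
    rw [pow_succ', Equiv.Perm.mul_apply, finRotate_apply, Fin.val_add, ih]
    simp [add_assoc]

theorem sign_finAddFlip (k l : ℕ) :
    Equiv.Perm.sign ((finAddFlip : Fin (l + k) ≃ Fin (k + l)).trans (finCongr (add_comm k l))) =
      (-1) ^ (k * l) := by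
  by_cases h0 : l + k = 0
  · obtain ⟨rfl, rfl⟩ : l = 0 ∧ k = 0 := by omega
    rfl
  obtain ⟨n, h⟩ := Nat.exists_eq_succ_of_ne_zero h0
  rw [Nat.succ_eq_add_one] at h
  have key : (finAddFlip : Fin (l + k) ≃ Fin (k + l)).trans (finCongr (add_comm k l)) =
      (finCongr h).trans ((finRotate (n + 1) ^ k : Equiv.Perm _).trans (finCongr h.symm)) := by
    ext i
    obtain ⟨i, hi⟩ := i
    simp only [Equiv.trans_apply, finCongr_apply, Fin.val_cast, val_finRotate_pow_apply,
      Fin.cast_mk]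
    by_cases hil : i < l
    · rw [finAddFlip_apply_mk_left hil, Nat.mod_eq_of_lt (by omega)]
      exact add_comm _ _
    · rw [finAddFlip_apply_mk_right (by omega), ← h, show i + k = (i - l) + (l + k) by omega,
        Nat.add_mod_right, Nat.mod_eq_of_lt (by omega)]
  rw [key, Equiv.Perm.sign_trans_trans]
  have h1 : (finCongr h).trans (finCongr h.symm) = 1 := by ext; simp
  rw [h1, map_one, mul_one, map_pow, sign_finRotate, Nat.add_sub_cancel, ← pow_mul]
  have h2 : n + 1 = l + k := h.symm
  refine (Int.units_pow_eq_pow_mod_two _ _).trans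
    (Eq.trans ?_ (Int.units_pow_eq_pow_mod_two _ _).symm)
  congr 1
  rcases k with - | k
  · simp
  · obtain rfl : n = l + k := by omega
    have h3 : Even (k * (k + 1)) := Nat.even_mul_succ_self k
    rw [show (l + k) * (k + 1) = (k + 1) * l + k * (k + 1) by ring, Nat.add_mod,
      Nat.even_iff.1 h3]
    simp

theorem wedge_comm (α : V [⋀^Fin k]→L[ℝ] ℂ) (β : V [⋀^Fin l]→L[ℝ] ℂ) (v : Fin (k + l) → V) :
    wedge α β v = (-1) ^ (k * l) * wedge β α (v ∘ Fin.cast (add_comm l k)) := by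
  set c : Fin (l + k) ≃ Fin (k + l) := finCongr (add_comm l k)
  set f : Fin (l + k) ≃ Fin (k + l) := finAddFlip
  have hsign : ∀ σ : Equiv.Perm (Fin (k + l)),
      Equiv.Perm.sign (f.trans (σ.trans c.symm)) = Equiv.Perm.sign σ * (-1) ^ (k * l) := fun σ => by
    rw [Equiv.Perm.sign_trans_trans, ← sign_finAddFlip]
    rfl
  let e : Equiv.Perm (Fin (k + l)) ≃ Equiv.Perm (Fin (l + k)) :=
    { toFun σ := f.trans (σ.trans c.symm)
      invFun τ := f.symm.trans (τ.trans c)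
      left_inv σ := by ext; simp
      right_inv τ := by ext; simp }
  rw [wedge_apply, wedge_apply, ← e.sum_comp, mul_smul_comm, mul_comm (k.factorial : ℝ),
    Finset.mul_sum]
  congr 1
  refine Finset.sum_congr rfl fun σ _ => ?_
  have h1 : ∀ j, c (e σ (Fin.castAdd k j)) = σ (Fin.natAdd k j) := fun j => by
    simp [e, f]
  have h2 : ∀ i, c (e σ (Fin.natAdd l i)) = σ (Fin.castAdd l i) := fun i => by
    simp [e, f]
  have h3 : Equiv.Perm.sign (e σ) = Equiv.Perm.sign σ * (-1) ^ (k * l) := hsign σ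
  have h4 : (fun j => (v ∘ Fin.cast (add_comm l k)) (e σ (Fin.castAdd k j))) =
      fun j => v (σ (Fin.natAdd k j)) := funext fun j => congrArg v (h1 j)
  have h5 : (fun i => (v ∘ Fin.cast (add_comm l k)) (e σ (Fin.natAdd l i))) =
      fun i => v (σ (Fin.castAdd l i)) := funext fun i => congrArg v (h2 i)
  rw [h3, h4, h5, mul_comm (β _)]
  rcases Nat.even_or_odd (k * l) with h | h
  · simp [h.neg_one_pow]
  · simp [h.neg_one_pow]

end Wedge

/-! ### Rapidly decreasing families -/

section Decay

universe u v

/-- A copy of a type, with the discrete topology. -/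
def DiscreteCopy (Γ : Type*) : Type _ := Γ

instance {Γ : Type*} : TopologicalSpace (DiscreteCopy Γ) := ⊥

instance {Γ : Type*} : DiscreteTopology (DiscreteCopy Γ) := ⟨rfl⟩

/-- The points of the one-point compactification given by the elements of a discrete set. -/
def discretePoint {Γ : Type*} (γ : Γ) : OnePoint (DiscreteCopy Γ) :=
  OnePoint.some (X := DiscreteCopy Γ) γ

/-- The extension of a family by zero at infinity. -/
def extendZero {Γ F : Type*} [Zero F] (f : Γ → F) (α : OnePoint (DiscreteCopy Γ)) : F :=
  α.elim 0 f

@[simp]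
theorem extendZero_infty {Γ F : Type*} [Zero F] (f : Γ → F) : extendZero f OnePoint.infty = 0 := rfl

@[simp]
theorem extendZero_coe {Γ F : Type*} [Zero F] (f : Γ → F) (γ : DiscreteCopy Γ) :
    extendZero f γ = f γ := rfl

@[simp]
theorem extendZero_discretePoint {Γ F : Type*} [Zero F] (f : Γ → F) (γ : Γ) :
    extendZero f (discretePoint γ) = f γ := rfl

variable {Γ : Type*} {E F : Type u} [NormedAddCommGroup E] [NormedSpace ℝ E]
  [NormedAddCommGroup F] [NormedSpace ℝ F]

theorem isOpen_singleton_coe_onePoint (γ : DiscreteCopy Γ) :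
    IsOpen ({(γ : OnePoint (DiscreteCopy Γ))} : Set (OnePoint (DiscreteCopy Γ))) := by
  rw [← image_singleton]
  exact OnePoint.isOpen_image_coe.2 (isOpen_discrete _)

omit [NormedSpace ℝ E] in
theorem continuousOn_extendZero {ℓ : Γ → ℕ} (hℓ : Tendsto ℓ cofinite atTop) {s U : Set E}
    [ProperSpace E] (hs : IsClosed s) (hU : IsOpen U) {f : Γ → E → F}
    (hf : ∀ γ, ContinuousOn (f γ) (s ∩ U))
    (hdecay : ∀ K : Set E, IsCompact K → K ⊆ s ∩ U → ∀ n : ℕ, ∃ C : ℝ, ∀ γ, ∀ y ∈ K,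
      ‖f γ y‖ * (1 + (ℓ γ : ℝ)) ^ n ≤ C) (n : ℕ) :
    ContinuousOn (fun w : OnePoint (DiscreteCopy Γ) × E =>
      extendZero (fun γ => (1 + (ℓ γ : ℝ)) ^ n • f γ w.2) w.1)
      ((univ ×ˢ U) ∩ Prod.snd ⁻¹' s) := by
  rintro ⟨α, y⟩ ⟨⟨-, hyU⟩, hys⟩
  simp only [mem_preimage] at hys hyU
  induction α using OnePoint.rec with
  | coe γ =>
    have h1 : ContinuousWithinAt (fun w : OnePoint (DiscreteCopy Γ) × E =>
        (1 + (ℓ γ : ℝ)) ^ n • f γ w.2) ((univ ×ˢ U) ∩ Prod.snd ⁻¹' s) (↑γ, y) := by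
      refine ContinuousWithinAt.const_smul ?_ _
      exact ContinuousWithinAt.comp (g := f γ) (t := s ∩ U) (hf γ y ⟨hys, hyU⟩)
        continuous_snd.continuousWithinAt fun w hw => ⟨hw.2, hw.1.2⟩
    refine h1.congr_of_eventuallyEq ?_ (by simp)
    refine eventually_nhdsWithin_of_eventually_nhds ?_
    have h2 : ∀ᶠ w : OnePoint (DiscreteCopy Γ) × E in 𝓝 (↑γ, y), w.1 = γ :=
      continuous_fst.continuousAt.eventually
        ((isOpen_singleton_coe_onePoint γ).mem_nhds (mem_singleton _))
    filter_upwards [h2] with w hw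
    rw [hw, extendZero_coe]
  | infty =>
    obtain ⟨r, hr, hrU⟩ := Metric.nhds_basis_closedBall.mem_iff.1 (hU.mem_nhds hyU)
    obtain ⟨C, hC⟩ := hdecay (Metric.closedBall y r ∩ s) ((isCompact_closedBall y r).inter_right hs)
      (fun z hz => ⟨hz.2, hrU hz.1⟩) (n + 1)
    rw [ContinuousWithinAt, extendZero_infty, Metric.tendsto_nhds]
    intro ε hε
    have h1 : ∀ᶠ γ in cofinite, C / ε < 1 + (ℓ γ : ℝ) := by
      have := (tendsto_natCast_atTop_atTop (R := ℝ)).comp hℓ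
      exact (tendsto_atTop_add_const_left _ 1 this).eventually_gt_atTop _
    have h2 : ∀ᶠ α : OnePoint (DiscreteCopy Γ) in 𝓝 OnePoint.infty,
        α ∉ ((↑) : DiscreteCopy Γ → OnePoint (DiscreteCopy Γ)) ''
          {γ : Γ | ¬ C / ε < 1 + (ℓ γ : ℝ)} := by
      refine (OnePoint.isOpen_compl_image_coe.2 ⟨isClosed_discrete _, ?_⟩).mem_nhds (by simp)
      exact Set.Finite.isCompact h1
    have h3 : ∀ᶠ w : OnePoint (DiscreteCopy Γ) × E in
        𝓝[(univ ×ˢ U) ∩ Prod.snd ⁻¹' s] (OnePoint.infty, y), w.2 ∈ Metric.closedBall y r ∩ s := by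
      refine (eventually_nhdsWithin_of_eventually_nhds ?_).and
        (eventually_mem_nhdsWithin.mono fun w hw => hw.2)
      exact continuous_snd.continuousAt.eventually (Metric.closedBall_mem_nhds y hr)
    have h4 : ∀ᶠ w : OnePoint (DiscreteCopy Γ) × E in
        𝓝[(univ ×ˢ U) ∩ Prod.snd ⁻¹' s] (OnePoint.infty, y), w.1 ∉
          ((↑) : DiscreteCopy Γ → OnePoint (DiscreteCopy Γ)) ''
          {γ : Γ | ¬ C / ε < 1 + (ℓ γ : ℝ)} :=
      eventually_nhdsWithin_of_eventually_nhds ((continuous_fst.tendsto (OnePoint.infty, y)).eventually h2)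
    filter_upwards [h3, h4] with w hw hw'
    obtain ⟨α, z⟩ := w
    induction α using OnePoint.rec with
    | infty => simpa using hε
    | coe γ =>
      have hγ : C / ε < 1 + (ℓ γ : ℝ) := by
        by_contra hcon
        exact hw' ⟨γ, hcon, rfl⟩
      have h5 := hC γ z hw
      rw [extendZero_coe, dist_zero_right, norm_smul, Real.norm_of_nonneg (by positivity)]
      rw [pow_succ] at h5
      rw [div_lt_iff₀ hε] at hγ
      have hpos : (0 : ℝ) < 1 + (ℓ γ : ℝ) := by positivity
      refine lt_of_mul_lt_mul_right ?_ hpos.le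
      calc _ = ‖f γ z‖ * ((1 + (ℓ γ : ℝ)) ^ n * (1 + (ℓ γ : ℝ))) := by ring
        _ ≤ C := h5
        _ < _ := by linarith

/-- A rapidly decreasing family of smooth functions, multiplied by powers of the length, extends to
a smooth family on the one-point compactification of the index set. -/
theorem paramDiff_extendZero {ℓ : Γ → ℕ} (hℓ : Tendsto ℓ cofinite atTop) {s U : Set E}
    [ProperSpace E] (hs : IsClosed s) (hsu : UniqueDiffOn ℝ s) (hU : IsOpen U) {f : Γ → E → F}
    (hf : ∀ γ, ContDiffOn ℝ ∞ (f γ) (s ∩ U))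
    (hdecay : ∀ K : Set E, IsCompact K → K ⊆ s ∩ U → ∀ i n : ℕ, ∃ C : ℝ, ∀ γ, ∀ y ∈ K,
      ‖iteratedFDerivWithin ℝ i (f γ) s y‖ * (1 + (ℓ γ : ℝ)) ^ n ≤ C) (n m : ℕ) :
    ParamDiff s (univ ×ˢ U) m (fun w : OnePoint (DiscreteCopy Γ) × E =>
      extendZero (fun γ => (1 + (ℓ γ : ℝ)) ^ n • f γ w.2) w.1) := by
  induction m generalizing F with
  | zero =>
    exact continuousOn_extendZero hℓ hs hU (fun γ => (hf γ).continuousOn)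
      (fun K hK hKs n => by simpa using hdecay K hK hKs 0 n) n
  | succ m ih =>
    refine ⟨continuousOn_extendZero hℓ hs hU (fun γ => (hf γ).continuousOn)
      (fun K hK hKs n => by simpa using hdecay K hK hKs 0 n) n,
      fun w => extendZero (fun γ => (1 + (ℓ γ : ℝ)) ^ n • fderivWithin ℝ (f γ) s w.2) w.1, ?_,
      ih (f := fun γ => fderivWithin ℝ (f γ) s) ?_ ?_⟩
    · rintro ⟨α, y⟩ ⟨-, hyU⟩ hys
      induction α using OnePoint.rec with
      | infty => simpa using hasFDerivWithinAt_const (0 : F) y s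
      | coe γ =>
        have h1 : DifferentiableWithinAt ℝ (f γ) s y :=
          ((hf γ).differentiableOn (by simp) y ⟨hys, hyU⟩).mono_of_mem_nhdsWithin
            (inter_mem self_mem_nhdsWithin (nhdsWithin_le_nhds (hU.mem_nhds hyU)))
        exact h1.hasFDerivWithinAt.const_smul _
    · intro γ
      refine ((hf γ).fderivWithin (m := ∞) (hsu.inter hU) (by simp)).congr fun y hy => ?_
      exact (fderivWithin_inter (hU.mem_nhds hy.2)).symm
    · intro K hK hKs i n
      obtain ⟨C, hC⟩ := hdecay K hK hKs (i + 1) n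
      refine ⟨C, fun γ y hy => ?_⟩
      rw [norm_iteratedFDerivWithin_fderivWithin hsu (hKs hy).1]
      exact hC γ y hy

end Decay

/-! ### Pullbacks of rapidly decreasing families of forms -/

section Pullback

universe u v

variable {E : Type u} [NormedAddCommGroup E] [NormedSpace ℝ E]
  {H : Type*} [TopologicalSpace H] {J : ModelWithCorners ℝ E H}
  {N : Type*} [TopologicalSpace N] [ChartedSpace H N] {k : ℕ}

/-- The value of a form at a point, as a form on the model space. -/
def DiffForm.modelForm (θ : DiffForm J N k) (p : N) : E [⋀^Fin k]→L[ℝ] ℂ := θ p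

theorem DiffForm.modelForm_pullback (θ : DiffForm J N k) (f : N → N) (p : N) :
    (θ.pullback f).modelForm p =
      (θ.modelForm (f p)).compContinuousLinearMap (modelDeriv J f p) := rfl

theorem DiffForm.localRep_eq (θ : DiffForm J N k) (p₀ : N) (y : E) :
    θ.localRep p₀ y = (θ.modelForm ((extChartAt J p₀).symm y)).compContinuousLinearMap
      (chartSymmDeriv J p₀ y) := rfl

theorem DiffForm.pullback_pullback (θ : DiffForm J N k) {f₁ f₂ : N → N}
    (h₁ : MDifferentiable J J f₁) (h₂ : MDifferentiable J J f₂) :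
    (θ.pullback f₁).pullback f₂ = θ.pullback (f₁ ∘ f₂) := by
  funext p
  have h : modelDeriv J (f₁ ∘ f₂) p = (modelDeriv J f₁ (f₂ p)).comp (modelDeriv J f₂ p) :=
    mfderiv_comp p (h₁ _) (h₂ _)
  change ((θ.pullback f₁).pullback f₂).modelForm p = (θ.pullback (f₁ ∘ f₂)).modelForm p
  rw [modelForm_pullback, modelForm_pullback, modelForm_pullback, h]
  rfl

variable [IsManifold J ∞ N]

theorem DiffForm.localRep_self (θ : DiffForm J N k) (p : N) :
    θ.localRep p (extChartAt J p p) = θ.modelForm p := by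
  rw [localRep_eq, chartSymmDeriv_self, (extChartAt J p).left_inv (mem_extChartAt_source p)]
  rfl

theorem DiffForm.localRep_pullback (θ : DiffForm J N k) {f : N → N} {p₀ q₀ : N} {y : E}
    (hy : y ∈ (extChartAt J p₀).target)
    (hf : MDifferentiableAt J J f ((extChartAt J p₀).symm y))
    (hfy : f ((extChartAt J p₀).symm y) ∈ (extChartAt J q₀).source) :
    (θ.pullback f).localRep p₀ y =
      (θ.localRep q₀ (chartExpr J p₀ q₀ f y)).compContinuousLinearMap
        (fderivWithin ℝ (chartExpr J p₀ q₀ f) (range J) y) := by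
  have h4 : (extChartAt J q₀).symm (chartExpr J p₀ q₀ f y) = f ((extChartAt J p₀).symm y) :=
    (extChartAt J q₀).left_inv hfy
  have h := modelDeriv_comp_chartSymmDeriv J hy hf hfy
  rw [localRep_eq, localRep_eq, h4, modelForm_pullback]
  ext v
  simp only [ContinuousAlternatingMap.compContinuousLinearMap_apply]
  congr 1
  funext i
  exact congrArg (fun L : E →L[ℝ] E => L (v i)) h

omit [IsManifold J ∞ N] in
theorem extChartAt_target_eq (p₀ : N) :
    (extChartAt J p₀).target = range J ∩ J.symm ⁻¹' (chartAt H p₀).target := by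
  rw [extChartAt_target, inter_comm]

omit [IsManifold J ∞ N] in
theorem isOpen_preimage_chartAt_target (p₀ : N) : IsOpen (J.symm ⁻¹' (chartAt H p₀).target) :=
  (chartAt H p₀).open_target.preimage J.continuous_symm

variable {Γ : Type v} [Group Γ] {S : Finset Γ} {θ : Γ → DiffForm J N k}

/-- A rapidly decreasing family of smooth forms, without any condition on the supports. -/
structure IsRapidlyDecreasing (S : Finset Γ) (θ : Γ → DiffForm J N k) : Prop where
  smooth : ∀ γ, (θ γ).IsSmooth
  rapid_decay : ∀ (p₀ : N) (K : Set E), IsCompact K → K ⊆ (extChartAt J p₀).target →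
    ∀ i n : ℕ, ∃ C : ℝ, ∀ γ, ∀ y ∈ K,
      ‖iteratedFDerivWithin ℝ i ((θ γ).localRep p₀) (range J) y‖ *
        (1 + (wordLength S γ : ℝ)) ^ n ≤ C

omit [IsManifold J ∞ N] in
theorem IsCrossedForm.isRapidlyDecreasing (hθ : IsCrossedForm S θ) : IsRapidlyDecreasing S θ :=
  ⟨hθ.smooth, hθ.rapid_decay⟩

omit [IsManifold J ∞ N] in
theorem IsRapidlyDecreasing.paramDiff_localRep [FiniteDimensional ℝ E] (hθ : IsRapidlyDecreasing S θ)
    (hS : Tendsto (wordLength S) cofinite atTop) (p₀ : N) (n m : ℕ) :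
    ParamDiff (range J) (univ ×ˢ (J.symm ⁻¹' (chartAt H p₀).target)) m
      (fun w : OnePoint (DiscreteCopy Γ) × E =>
        extendZero (fun γ => (1 + (wordLength S γ : ℝ)) ^ n • (θ γ).localRep p₀ w.2) w.1) := by
  have : ProperSpace E := FiniteDimensional.proper_real E
  refine paramDiff_extendZero hS J.isClosed_range J.uniqueDiffOn
    (isOpen_preimage_chartAt_target p₀) (fun γ => ?_) (fun K hK hKs => ?_) n m
  · rw [← extChartAt_target_eq]
    exact hθ.smooth γ p₀
  · rw [← extChartAt_target_eq] at hKs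
    exact hθ.rapid_decay p₀ K hK hKs

variable {G : Type*} [TopologicalSpace G] {act : G → N → N}

/-- The expressions in the chart at `p₀` of the pullbacks of a rapidly decreasing family of forms,
multiplied by powers of the length. -/
def weightedPullback (S : Finset Γ) (θ : Γ → DiffForm J N k) (act : G → N → N) (n : ℕ) (p₀ : N)
    (w : (OnePoint (DiscreteCopy Γ) × G) × E) : E [⋀^Fin k]→L[ℝ] ℂ :=
  extendZero (fun γ => (1 + (wordLength S γ : ℝ)) ^ n •
    ((θ γ).pullback (act w.1.2)).localRep p₀ w.2) w.1.1

theorem IsRapidlyDecreasing.paramDiff_weightedPullback [FiniteDimensional ℝ E] (hθ : IsRapidlyDecreasing S θ)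
    (hS : Tendsto (wordLength S) cofinite atTop) (hact : IsSmoothFamily J act) (n : ℕ) (p₀ : N)
    (m : ℕ) :
    ParamDiff (range J) (univ ×ˢ (J.symm ⁻¹' (chartAt H p₀).target)) m
      (weightedPullback S θ act n p₀) := by
  refine ParamDiff.of_local J.uniqueDiffOn fun ⟨⟨α, a⟩, y⟩ hw hys => ?_
  have hy : y ∈ (extChartAt J p₀).target := by
    rw [extChartAt_target_eq]; exact ⟨hys, hw.2⟩
  set q₀ := act a ((extChartAt J p₀).symm y)
  obtain ⟨O, hO, hm, hO', hn⟩ := hact.exists_paramDiff p₀ q₀ a y hy (mem_extChartAt_source q₀)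
  have hq : Continuous fun w : OnePoint (DiscreteCopy Γ) × G => w.2 := continuous_snd
  set O₁ : Set ((OnePoint (DiscreteCopy Γ) × G) × E) := Prod.map Prod.snd id ⁻¹' O
  have hO₁ : IsOpen O₁ := hO.preimage (hq.prodMap continuous_id)
  refine ⟨O₁, hO₁.mem_nhds hm, ?_⟩
  have hmd : ∀ b, MDifferentiable J J (act b) :=
    fun b => (hact.contMDiff b).mdifferentiable (by simp)
  have hu : ∀ m, ParamDiff (range J) O₁ m
      fun w : (OnePoint (DiscreteCopy Γ) × G) × E => chartExpr J p₀ q₀ (act w.1.2) w.2 :=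
    fun m => (hn m).reparam hq
  have hD := (hu (m + 1)).fderivWithin J.uniqueDiffOn hO₁
  have hL := ((hθ.paramDiff_localRep hS q₀ n m).reparam
    (q := fun w : OnePoint (DiscreteCopy Γ) × G => w.1) continuous_fst).comp (hu m) hO₁
    fun w hw hws => by
      have h1 := (hO' (w.1.2, w.2) hw hws).2
      have h2 := (extChartAt J q₀).map_source h1
      rw [extChartAt_target_eq] at h2
      exact ⟨⟨mem_univ _, h2.2⟩, h2.1⟩
  refine (ParamDiff.contDiffOn_comp uniqueDiffOn_univ isOpen_univ
    (contDiff_compContinuousLinearMap (E := E) (F := E) (k := k)).contDiffOn (hL.prodMk hD) hO₁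
    fun _ _ _ => ⟨mem_univ _, mem_univ _⟩).congr hO₁ fun w hw hws => ?_
  obtain ⟨h1, h2⟩ := hO' (w.1.2, w.2) hw hws
  obtain ⟨⟨β, b⟩, z⟩ := w
  induction β using OnePoint.rec with
  | infty => ext v; simp [weightedPullback]
  | coe γ =>
    simp only [weightedPullback, extendZero_coe]
    rw [(θ γ).localRep_pullback h1 (hmd b _) h2]
    ext v
    simp

theorem IsRapidlyDecreasing.continuousOn_weightedPullback [FiniteDimensional ℝ E]
    (hθ : IsRapidlyDecreasing S θ) (hS : Tendsto (wordLength S) cofinite atTop)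
    (hact : IsSmoothFamily J act) (n : ℕ) (p₀ : N) {y : E} (hy : y ∈ (extChartAt J p₀).target) :
    Continuous fun w : OnePoint (DiscreteCopy Γ) × G => weightedPullback S θ act n p₀ (w, y) := by
  rw [extChartAt_target_eq] at hy
  exact continuousOn_univ.1 ((hθ.paramDiff_weightedPullback hS hact n p₀ 0).continuousOn.comp
    (Continuous.prodMk_left y).continuousOn fun w _ => ⟨⟨mem_univ _, hy.2⟩, hy.1⟩)

omit [TopologicalSpace G] in
theorem weightedPullback_self (n : ℕ) (p : N) (γ : Γ) (a : G) :
    weightedPullback S θ act n p ((discretePoint γ, a), extChartAt J p p) =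
      (1 + (wordLength S γ : ℝ)) ^ n • ((θ γ).pullback (act a)).modelForm p := by
  rw [weightedPullback, extendZero_discretePoint, DiffForm.localRep_self]

theorem IsRapidlyDecreasing.continuous_pullback [FiniteDimensional ℝ E] (hθ : IsRapidlyDecreasing S θ)
    (hS : Tendsto (wordLength S) cofinite atTop) (hact : IsSmoothFamily J act) (γ : Γ) (p : N) :
    Continuous fun a => ((θ γ).pullback (act a)).modelForm p := by
  have h := (hθ.continuousOn_weightedPullback hS hact 0 p (mem_extChartAt_target p)).comp
    (Continuous.prodMk_right (X := OnePoint (DiscreteCopy Γ)) (Y := G)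
      (discretePoint γ))
  refine h.congr fun a => ?_
  simp only [Function.comp_apply]
  rw [weightedPullback_self]
  simp

theorem IsRapidlyDecreasing.exists_pullback_le [FiniteDimensional ℝ E] [CompactSpace G]
    (hθ : IsRapidlyDecreasing S θ) (hS : Tendsto (wordLength S) cofinite atTop)
    (hact : IsSmoothFamily J act) (p : N) (n : ℕ) :
    ∃ C : ℝ, 0 ≤ C ∧ ∀ γ a, ‖((θ γ).pullback (act a)).modelForm p‖ ≤
      C * ((1 + (wordLength S γ : ℝ)) ^ n)⁻¹ := by
  obtain ⟨C, hC⟩ := isCompact_univ.exists_bound_of_continuousOn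
    (hθ.continuousOn_weightedPullback hS hact n p (mem_extChartAt_target p)).continuousOn
  refine ⟨max C 0, le_max_right _ _, fun γ a => ?_⟩
  have h := (hC (discretePoint γ, a) (mem_univ _)).trans (le_max_left C 0)
  rw [weightedPullback_self, norm_smul, Real.norm_of_nonneg (by positivity)] at h
  rwa [← div_eq_mul_inv, le_div_iff₀' (by positivity)]

end Pullback

/-! ### The averaged traces -/

section Trace

universe u

variable {E : Type u} [NormedAddCommGroup E] [NormedSpace ℝ E]
  {H : Type*} [TopologicalSpace H] {J : ModelWithCorners ℝ E H}
  {N : Type*} [TopologicalSpace N] [ChartedSpace H N] {k l : ℕ}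

/-- Tangent vectors to the fixed point submanifold, as vectors of the model space. -/
def modelVectors {φ : N → N} {p : N} (v : Fin k → FixedTangent J φ p) (i : Fin k) : E :=
  (v i : TangentSpace J p)

theorem modelDeriv_modelVectors {φ : N → N} {p : N} (v : Fin k → FixedTangent J φ p) (i : Fin k) :
    modelDeriv J φ p (modelVectors v i) = modelVectors v i :=
  congrArg (fun t : TangentBundle J N => (t.2 : E)) (v i).2

theorem DiffForm.pullback_id (θ : DiffForm J N k) : θ.pullback id = θ := by
  funext p
  have h : modelDeriv J (id : N → N) p = .id ℝ E := mfderiv_id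
  change (θ.pullback id).modelForm p = θ.modelForm p
  rw [modelForm_pullback, h]
  rfl

/-- Exchanging the factors of `γ' = γ₁ γ₂` gives the conjugate element `γ₂ γ₁`. -/
def swapFactors {Γ : Type*} [Group Γ] (γ : Γ) :
    {γ' : Γ // IsConj γ γ'} × Γ ≃ {γ' : Γ // IsConj γ γ'} × Γ :=
  Function.Involutive.toPerm (fun q => (⟨q.2⁻¹ * q.1 * q.2, q.1.2.trans
      (isConj_iff.2 ⟨q.2⁻¹, by rw [inv_inv]⟩)⟩, q.2⁻¹ * q.1)) fun q => by
    refine Prod.ext (Subtype.ext ?_) ?_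
    · change (q.2⁻¹ * q.1)⁻¹ * (q.2⁻¹ * q.1 * q.2) * (q.2⁻¹ * q.1) = q.1
      group
    · change (q.2⁻¹ * q.1)⁻¹ * (q.2⁻¹ * q.1 * q.2) = q.2
      group

theorem Continuous.alternatingMap_apply {Y : Type*} [TopologicalSpace Y]
    {f : Y → E [⋀^Fin k]→L[ℝ] ℂ} (hf : Continuous f) (v : Fin k → E) :
    Continuous fun y => f y v :=
  (ContinuousAlternatingMap.apply ℝ E ℂ v).continuous.comp hf

theorem Continuous.wedge_apply {Y : Type*} [TopologicalSpace Y]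
    {f : Y → E [⋀^Fin k]→L[ℝ] ℂ} {f' : Y → E [⋀^Fin l]→L[ℝ] ℂ} (hf : Continuous f)
    (hf' : Continuous f') (v : Fin (k + l) → E) : Continuous fun y => wedge (f y) (f' y) v := by
  simp only [_root_.wedge_apply]
  have h1 := fun v => hf.alternatingMap_apply v
  have h2 := fun v => hf'.alternatingMap_apply v
  fun_prop

variable {G : Type*} [Group G] [TopologicalSpace G] [IsTopologicalGroup G] {act : G → N → N}

section Action

variable [IsManifold J ∞ N] (hact : IsSmoothAction J act)

include hact

omit [IsTopologicalGroup G] in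
theorem IsSmoothAction.mdifferentiable (a : G) : MDifferentiable J J (act a) :=
  (hact.smooth.contMDiff a).mdifferentiable (by simp)

omit [IsTopologicalGroup G] in
theorem IsSmoothAction.pullback_pullback (θ : DiffForm J N k) (a b : G) :
    (θ.pullback (act a)).pullback (act b) = θ.pullback (act (a * b)) := by
  rw [DiffForm.pullback_pullback _ (hact.mdifferentiable a) (hact.mdifferentiable b), hact.mul]

omit [IsTopologicalGroup G] in
theorem IsSmoothAction.modelDeriv_inv {a : G} {p : N} (hp : act a p = p) {v : E}
    (hv : modelDeriv J (act a) p v = v) : modelDeriv J (act a⁻¹) p v = v := by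
  have h : modelDeriv J (act a⁻¹ ∘ act a) p =
      (modelDeriv J (act a⁻¹) (act a p)).comp (modelDeriv J (act a) p) :=
    mfderiv_comp p (hact.mdifferentiable _ _) (hact.mdifferentiable _ _)
  have h1 : modelDeriv J (id : N → N) p = .id ℝ E := mfderiv_id
  rw [← hact.mul, inv_mul_cancel, hact.one, h1, hp] at h
  have h2 := congrArg (fun L : E →L[ℝ] E => L v) h
  simp only [ContinuousLinearMap.comp_apply, hv] at h2
  exact h2.symm

omit [IsTopologicalGroup G] [IsManifold J ∞ N] in
theorem IsSmoothAction.inv_apply {a : G} {p : N} (hp : act a p = p) : act a⁻¹ p = p := by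
  have h := congrFun (hact.mul a⁻¹ a) p
  rw [inv_mul_cancel, hact.one, Function.comp_apply, hp] at h
  exact h.symm

omit [IsTopologicalGroup G] in
/-- Forms on the fixed point submanifold of `a` are invariant under `a⁻¹`. -/
theorem IsSmoothAction.modelForm_pullback_mul_inv (θ : DiffForm J N k) {a : G} {p : N}
    (hp : act a p = p) (b : G) {v : Fin k → E} (hv : ∀ i, modelDeriv J (act a) p (v i) = v i) :
    (θ.pullback (act (b * a⁻¹))).modelForm p v = (θ.pullback (act b)).modelForm p v := by
  rw [← hact.pullback_pullback, DiffForm.modelForm_pullback, hact.inv_apply hp,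
    ContinuousAlternatingMap.compContinuousLinearMap_apply]
  congr 1
  funext i
  exact hact.modelDeriv_inv hp (hv i)

omit [IsTopologicalGroup G] in
theorem IsSmoothAction.restrict_pullback_pullback (θ : DiffForm J N k) (a b c : G)
    (p : Function.fixedPoints (act c)) (v : Fin k → FixedTangent J (act c) (p : N)) :
    ((θ.pullback (act a)).pullback (act b)).restrict (act c) p v =
      (θ.pullback (act (a * b))).modelForm p (modelVectors v) := by
  rw [hact.pullback_pullback]
  rfl

end Action

variable [CompactSpace G] [T2Space G] {Γ : Subgroup G}

omit [CompactSpace G] in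
theorem isClosed_closureCentralizer (γ : Γ) : IsClosed (closureCentralizer γ : Set G) :=
  Γ.isClosed_topologicalClosure.inter (Set.isClosed_centralizer _)

instance compactSpace_closureCentralizer (γ : Γ) : CompactSpace (closureCentralizer γ) :=
  isCompact_iff_compactSpace.1 (isClosed_closureCentralizer γ).isCompact

omit [CompactSpace G] [T2Space G] in
theorem closureCentralizer.commute {γ : Γ} (h : closureCentralizer γ) :
    (γ : G) * h = h * γ :=
  Subgroup.mem_centralizer_iff.1 h.2.2 _ rfl

omit [CompactSpace G] [T2Space G] in
theorem IsConjugator.inv_mul_mem {γ γ' : Γ} {z₁ z₂ : G} (h₁ : IsConjugator γ γ' z₁)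
    (h₂ : IsConjugator γ γ' z₂) : z₂⁻¹ * z₁ ∈ closureCentralizer γ := by
  refine ⟨Γ.topologicalClosure.mul_mem (Γ.topologicalClosure.inv_mem h₂.1) h₁.1, Subgroup.mem_centralizer_iff.2 fun g hg => ?_⟩
  rw [mem_singleton_iff.1 hg]
  have h := h₁.2.symm.trans h₂.2
  calc (γ : G) * (z₂⁻¹ * z₁) = z₂⁻¹ * (z₂ * γ * z₂⁻¹) * z₁ := by group
    _ = z₂⁻¹ * (z₁ * γ * z₁⁻¹) * z₁ := by rw [h]
    _ = z₂⁻¹ * z₁ * γ := by group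

variable [MeasurableSpace G] [BorelSpace G]

omit [CompactSpace G] [T2Space G] in
/-- Integrals over the cosets of the centralizer do not depend on the conjugating elements. -/
theorem IsConjugator.integral_eq {γ γ' : Γ} {z₁ z₂ : G} (h₁ : IsConjugator γ γ' z₁)
    (h₂ : IsConjugator γ γ' z₂) (μ : Measure (closureCentralizer γ)) [μ.IsMulLeftInvariant]
    (f : G → ℂ) :
    ∫ h : closureCentralizer γ, f (z₁ * h) ∂μ = ∫ h : closureCentralizer γ, f (z₂ * h) ∂μ := by
  rw [← integral_mul_left_eq_self (fun h : closureCentralizer γ => f (z₂ * h))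
    ⟨_, h₁.inv_mul_mem h₂⟩]
  refine integral_congr_ae (Eventually.of_forall fun h => ?_)
  simp [mul_assoc]

theorem Continuous.integrable_of_isHaarMeasure {γ : Γ} {μ : Measure (closureCentralizer γ)}
    [μ.IsHaarMeasure] {F : Type*} [NormedAddCommGroup F] {f : closureCentralizer γ → F}
    (hf : Continuous f) : Integrable f μ :=
  hf.integrable_of_hasCompactSupport (HasCompactSupport.of_compactSpace _)

variable [IsManifold J ∞ N] [FiniteDimensional ℝ E] {S : Finset Γ}
  {γ : Γ} {μ : Measure (closureCentralizer γ)} [μ.IsHaarMeasure]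
  (hact : IsSmoothAction J act)

include hact

omit [CompactSpace G] [T2Space G] [FiniteDimensional ℝ E] in
theorem tauSummand_eq (θ : Γ → DiffForm J N k) (γ' : Γ) {z₁ z₂ : G}
    (h₁ : IsConjugator γ γ' z₁) (h₂ : IsConjugator γ γ' z₂) :
    tauSummand act γ μ θ γ' z₁ = tauSummand act γ μ θ γ' z₂ := by
  funext p v
  simp only [tauSummand, hact.restrict_pullback_pullback]
  exact h₁.integral_eq h₂ μ fun a => ((θ γ').pullback (act a)).modelForm p (modelVectors v)

omit [T2Space G] [BorelSpace G] [CompactSpace G] [MeasurableSpace G] in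
theorem IsRapidlyDecreasing.continuous_modelForm {θ : Γ → DiffForm J N k} (hθ : IsRapidlyDecreasing S θ)
    (hS : Tendsto (wordLength S) cofinite atTop) (γ' : Γ) (z : G) (p : N) :
    Continuous fun h : closureCentralizer γ =>
      ((θ γ').pullback (act (z * h))).modelForm p :=
  (hθ.continuous_pullback hS hact.smooth γ' p).comp (by fun_prop)

theorem IsRapidlyDecreasing.tauConverges {θ : Γ → DiffForm J N k} (hθ : IsRapidlyDecreasing S θ)
    (hΓ : HasPolynomialGrowth S) (z : Γ → G) : TauConverges act γ μ z θ := by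
  intro p v
  have hS := hΓ.tendsto_wordLength
  obtain ⟨r, hr⟩ := hΓ.exists_summable
  obtain ⟨C, hC0, hC⟩ := hθ.exists_pullback_le hS hact.smooth (p : N) r
  simp only [hact.restrict_pullback_pullback, tauSummand]
  refine ⟨fun γ' => Continuous.integrable_of_isHaarMeasure
    ((ContinuousAlternatingMap.apply ℝ E ℂ (modelVectors v)).continuous.comp
      (hθ.continuous_modelForm hact hS γ' (z γ') p)), ?_⟩
  refine Summable.of_norm_bounded
    (g := fun γ' : {γ' : Γ // IsConj γ γ'} => ((1 + (wordLength S γ' : ℝ)) ^ r)⁻¹ *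
      (C * (∏ i, ‖modelVectors v i‖) * μ.real univ)) ?_ fun γ' => ?_
  · exact (hr.comp_injective Subtype.val_injective).mul_right _
  · refine (norm_integral_le_of_norm_le_const (C := C * ((1 + (wordLength S γ' : ℝ)) ^ r)⁻¹ *
      ∏ i, ‖modelVectors v i‖) (Eventually.of_forall fun h => ?_)).trans_eq (by ring)
    exact (ContinuousAlternatingMap.le_opNorm _ _).trans
      (mul_le_mul_of_nonneg_right (hC γ' _) (by positivity))

/-! ### The trace property -/

variable {ω₁ : Γ → DiffForm J N k} {ω₂ : Γ → DiffForm J N l}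

omit [IsTopologicalGroup G] [T2Space G] [BorelSpace G] [CompactSpace G] [MeasurableSpace G] [FiniteDimensional ℝ E] in
theorem modelForm_wedge_pullback (γ₁ γ₂ : Γ) (a : G) (p : N) :
    (wedge ((ω₁ γ₁).modelForm (act a p))
      (((ω₂ γ₂).pullback (act ((γ₁⁻¹ : Γ) : G))).modelForm (act a p))).compContinuousLinearMap
        (modelDeriv J (act a) p) =
      wedge (((ω₁ γ₁).pullback (act a)).modelForm p)
        (((ω₂ γ₂).pullback (act ((γ₁⁻¹ : Γ) * a))).modelForm p) := by
  rw [wedge_compContinuousLinearMap, ← hact.pullback_pullback]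
  rfl

omit [IsTopologicalGroup G] [T2Space G] [BorelSpace G] [MeasurableSpace G] in
theorem exists_norm_wedge_le (h₁ : IsRapidlyDecreasing S ω₁) (h₂ : IsRapidlyDecreasing S ω₂)
    (hS : Tendsto (wordLength S) cofinite atTop) (p : N) (r : ℕ) :
    ∃ C : ℝ, 0 ≤ C ∧ ∀ (γ₁ γ₂ : Γ) (a b : G),
      ‖wedge (((ω₁ γ₁).pullback (act a)).modelForm p) (((ω₂ γ₂).pullback (act b)).modelForm p)‖ ≤
        C * (((1 + (wordLength S γ₁ : ℝ)) ^ r)⁻¹ * ((1 + (wordLength S γ₂ : ℝ)) ^ r)⁻¹) := by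
  obtain ⟨C₁, hC₁0, hC₁⟩ := h₁.exists_pullback_le hS hact.smooth p r
  obtain ⟨C₂, hC₂0, hC₂⟩ := h₂.exists_pullback_le hS hact.smooth p r
  refine ⟨(k + l).factorial * (C₁ * C₂), by positivity, fun γ₁ γ₂ a b => ?_⟩
  calc _ ≤ _ := norm_wedge_le _ _
    _ ≤ (k + l).factorial * ((C₁ * ((1 + (wordLength S γ₁ : ℝ)) ^ r)⁻¹) *
        (C₂ * ((1 + (wordLength S γ₂ : ℝ)) ^ r)⁻¹)) := by
      gcongr
      exacts [hC₁ _ _, hC₂ _ _]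
    _ = _ := by ring

omit [IsTopologicalGroup G] [T2Space G] [BorelSpace G] [MeasurableSpace G] in
theorem summable_modelForm_wedge (h₁ : IsRapidlyDecreasing S ω₁) (h₂ : IsRapidlyDecreasing S ω₂)
    (hΓ : HasPolynomialGrowth S) (γ₀ : Γ) (p : N) :
    Summable fun γ₁ : Γ => wedge ((ω₁ γ₁).modelForm p)
      (((ω₂ (γ₁⁻¹ * γ₀)).pullback (act ((γ₁⁻¹ : Γ) : G))).modelForm p) := by
  obtain ⟨r, hr⟩ := hΓ.exists_summable
  obtain ⟨C, hC0, hC⟩ := exists_norm_wedge_le hact h₁ h₂ hΓ.tendsto_wordLength p r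
  refine Summable.of_norm_bounded (hr.mul_left C) fun γ₁ => ?_
  have h := hC γ₁ (γ₁⁻¹ * γ₀) 1 ((γ₁⁻¹ : Γ) : G)
  rw [hact.one, DiffForm.pullback_id] at h
  refine h.trans (mul_le_mul_of_nonneg_left (mul_le_of_le_one_right (by positivity) ?_) hC0)
  exact inv_le_one_of_one_le₀ (one_le_pow₀ (by simp))

omit [IsTopologicalGroup G] [T2Space G] [BorelSpace G] [MeasurableSpace G] in
theorem modelForm_crossedMul_pullback (h₁ : IsRapidlyDecreasing S ω₁) (h₂ : IsRapidlyDecreasing S ω₂)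
    (hΓ : HasPolynomialGrowth S) (γ₀ : Γ) (a : G) (p : N) (v : Fin (k + l) → E) :
    ((crossedMul act ω₁ ω₂ γ₀).pullback (act a)).modelForm p v =
      ∑' γ₁ : Γ, wedge (((ω₁ γ₁).pullback (act a)).modelForm p)
        (((ω₂ (γ₁⁻¹ * γ₀)).pullback (act ((γ₁⁻¹ : Γ) * a))).modelForm p) v := by
  have h := summable_modelForm_wedge hact h₁ h₂ hΓ γ₀ (act a p)
  have h' : (crossedMul act ω₁ ω₂ γ₀).modelForm (act a p) =
      ∑' γ₁ : Γ, wedge ((ω₁ γ₁).modelForm (act a p))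
        (((ω₂ (γ₁⁻¹ * γ₀)).pullback (act ((γ₁⁻¹ : Γ) : G))).modelForm (act a p)) := rfl
  rw [DiffForm.modelForm_pullback, h', ContinuousAlternatingMap.compContinuousLinearMap_apply,
    ContinuousAlternatingMap.tsum_eval h]
  refine tsum_congr fun γ₁ => ?_
  rw [← modelForm_wedge_pullback hact]
  rfl

variable (act μ ω₁ ω₂) in
/-- The contribution of a pair of group elements to the trace of a product. -/
def pairTrace (z : G) (p : N) (v : Fin (k + l) → E) (γ₁ γ₂ : Γ) : ℂ :=
  ∫ h : closureCentralizer γ, wedge (((ω₁ γ₁).pullback (act (z * h))).modelForm p)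
    (((ω₂ γ₂).pullback (act ((γ₁⁻¹ : Γ) * (z * h)))).modelForm p) v ∂μ

theorem tau_crossedMul (h₁ : IsRapidlyDecreasing S ω₁) (h₂ : IsRapidlyDecreasing S ω₂)
    (hΓ : HasPolynomialGrowth S) (z : Γ → G) :
    TauConverges act γ μ z (crossedMul act ω₁ ω₂) ∧ ∀ p v,
      tau act γ μ z (crossedMul act ω₁ ω₂) p v =
        ∑' q : {γ' : Γ // IsConj γ γ'} × Γ,
          pairTrace act μ ω₁ ω₂ (z q.1) p (modelVectors v) q.2 (q.2⁻¹ * q.1) := by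
  have hS := hΓ.tendsto_wordLength
  have := hΓ.countable
  obtain ⟨r, hr⟩ := hΓ.exists_summable
  rw [TauConverges, ← forall_and]
  intro p
  rw [← forall_and]
  intro v
  obtain ⟨C, hC0, hC⟩ := exists_norm_wedge_le hact h₁ h₂ hS (p : N) r
  set w := modelVectors v
  set P := ∏ i, ‖w i‖
  set c : Γ → ℝ := fun γ => ((1 + (wordLength S γ : ℝ)) ^ r)⁻¹ with hc
  have hc0 : ∀ γ, 0 ≤ c γ := fun γ => by positivity
  have hc1 : ∀ γ, c γ ≤ 1 := fun γ => inv_le_one_of_one_le₀ (one_le_pow₀ (by simp))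
  have hC' : ∀ (γ₁ γ₂ : Γ) (a b : G),
      ‖wedge (((ω₁ γ₁).pullback (act a)).modelForm p) (((ω₂ γ₂).pullback (act b)).modelForm p) w‖ ≤
        C * (c γ₁ * c γ₂) * P := fun γ₁ γ₂ a b =>
    (ContinuousAlternatingMap.le_opNorm _ _).trans
      (mul_le_mul_of_nonneg_right (hC γ₁ γ₂ a b) (by positivity))
  have hcont : ∀ (z : G) (γ₁ γ₂ : Γ), Continuous fun h : closureCentralizer γ =>
      wedge (((ω₁ γ₁).pullback (act (z * h))).modelForm p)
        (((ω₂ γ₂).pullback (act ((γ₁⁻¹ : Γ) * (z * h)))).modelForm p) w := by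
    intro z γ₁ γ₂
    have e1 := h₁.continuous_modelForm (γ := γ) hact hS γ₁ z p
    have e2 := h₂.continuous_modelForm (γ := γ) hact hS γ₂ ((γ₁⁻¹ : Γ) * z) p
    simp only [mul_assoc] at e2
    exact e1.wedge_apply e2 w
  have hsum : ∀ γ' : Γ, Summable fun γ₁ : Γ => C * (c γ₁ * c (γ₁⁻¹ * γ')) * P := fun γ' => by
    refine Summable.mul_right _ (Summable.mul_left _ ?_)
    exact hr.of_nonneg_of_le (fun γ₁ => mul_nonneg (hc0 _) (hc0 _))
      fun γ₁ => mul_le_of_le_one_right (hc0 _) (hc1 _)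
  have hsum2 : Summable fun q : {γ' : Γ // IsConj γ γ'} × Γ =>
      C * (c q.2 * c (q.2⁻¹ * q.1)) * P := by
    refine Summable.mul_right _ (Summable.mul_left _ ?_)
    have h := hr.mul_of_nonneg hr hc0 hc0
    refine h.comp_injective (i := fun q : {γ' : Γ // IsConj γ γ'} × Γ => (q.2, q.2⁻¹ * q.1))
      fun q q' hqq => ?_
    simp only [Prod.mk.injEq] at hqq
    obtain ⟨h1, h2⟩ := hqq
    rw [h1] at h2
    exact Prod.ext (Subtype.ext (mul_left_cancel h2)) h1
  have hpair : Summable fun q : {γ' : Γ // IsConj γ γ'} × Γ =>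
      pairTrace act μ ω₁ ω₂ (z q.1) p w q.2 (q.2⁻¹ * q.1) := by
    refine Summable.of_norm_bounded (hsum2.mul_right (μ.real univ)) fun q => ?_
    exact norm_integral_le_of_norm_le_const (Eventually.of_forall fun h => hC' _ _ _ _)
  have hint : ∀ γ' : Γ, HasSum (fun γ₁ : Γ => pairTrace act μ ω₁ ω₂ (z γ') p w γ₁ (γ₁⁻¹ * γ'))
      (∫ h : closureCentralizer γ, ((crossedMul act ω₁ ω₂ γ').pullback
        (act (z γ' * h))).modelForm p w ∂μ) := fun γ' => by
    simp only [modelForm_crossedMul_pullback hact h₁ h₂ hΓ]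
    refine hasSum_integral_of_summable_integral_norm
      (fun γ₁ => Continuous.integrable_of_isHaarMeasure (hcont _ _ _)) ?_
    refine ((hsum γ').mul_right (μ.real univ)).of_nonneg_of_le
      (fun γ₁ => integral_nonneg fun h => norm_nonneg _) fun γ₁ => ?_
    refine (Real.le_norm_self _).trans (norm_integral_le_of_norm_le_const
      (Eventually.of_forall fun h => ?_))
    rw [norm_norm]
    exact hC' _ _ _ _
  have hts : ∀ γ' : {γ' : Γ // IsConj γ γ'},
      tauSummand act γ μ (crossedMul act ω₁ ω₂) γ' (z γ') p v =
        ∑' γ₁ : Γ, pairTrace act μ ω₁ ω₂ (z γ') p w γ₁ (γ₁⁻¹ * γ') := fun γ' => by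
    simp only [tauSummand, hact.restrict_pullback_pullback]
    exact (hint γ').tsum_eq.symm
  refine ⟨⟨fun γ' => ?_, ?_⟩, ?_⟩
  · simp only [hact.restrict_pullback_pullback, modelForm_crossedMul_pullback hact h₁ h₂ hΓ]
    exact Continuous.integrable_of_isHaarMeasure
      (continuous_tsum (fun γ₁ => hcont _ _ _) (hsum γ') fun γ₁ h => hC' _ _ _ _)
  · simp only [hts]
    exact hpair.prod
  · simp only [tau, hts]
    exact hpair.tsum_prod.symm

/-- The graded trace property. -/
theorem tau_crossedMul_comm (h₁ : IsRapidlyDecreasing S ω₁) (h₂ : IsRapidlyDecreasing S ω₂)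
    (hΓ : HasPolynomialGrowth S) {z : Γ → G}
    (hz : ∀ γ' : Γ, IsConj γ γ' → IsConjugator γ γ' (z γ')) (p : Function.fixedPoints (act γ))
    (v : Fin (k + l) → FixedTangent J (act γ) (p : N)) :
    tau act γ μ z (crossedMul act ω₁ ω₂) p v =
      (-1) ^ (k * l) * tau act γ μ z (crossedMul act ω₂ ω₁) p (v ∘ Fin.cast (add_comm l k)) := by
  rw [(tau_crossedMul hact h₁ h₂ hΓ z).2, (tau_crossedMul hact h₂ h₁ hΓ z).2, ← tsum_mul_left]
  refine Eq.trans ?_ ((swapFactors γ).tsum_eq _)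
  refine tsum_congr fun ⟨⟨γ', hγ'⟩, γ₁⟩ => ?_
  set γ₂ := γ₁⁻¹ * γ'
  have hz' := hz γ' hγ'
  have hprod : γ₁⁻¹ * γ' * γ₁ = γ₂ * γ₁ := rfl
  have hconj : IsConjugator γ (γ₂ * γ₁) ((γ₁⁻¹ : Γ) * z γ') := by
    refine ⟨Γ.topologicalClosure.mul_mem (Γ.le_topologicalClosure (γ₁⁻¹ : Γ).2) hz'.1, ?_⟩
    simp only [γ₂, Subgroup.coe_mul, hz'.2, Subgroup.coe_inv]
    group
  have hzz := hz (γ₂ * γ₁) (hγ'.trans (isConj_iff.2 ⟨γ₁⁻¹, by simp [γ₂]⟩))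
  change pairTrace act μ ω₁ ω₂ (z γ') p _ γ₁ γ₂ = _ * pairTrace act μ ω₂ ω₁ (z (γ₂ * γ₁)) p _ γ₂
    (γ₂⁻¹ * (γ₂ * γ₁))
  rw [inv_mul_cancel_left]
  have hp : act γ p = p := p.2
  have e1 : pairTrace act μ ω₂ ω₁ (z (γ₂ * γ₁)) p
      (modelVectors (v ∘ Fin.cast (add_comm l k))) γ₂ γ₁ =
      pairTrace act μ ω₂ ω₁ ((γ₁⁻¹ : Γ) * z γ') p
        (modelVectors (v ∘ Fin.cast (add_comm l k))) γ₂ γ₁ :=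
    hzz.integral_eq hconj μ fun a => wedge (((ω₂ γ₂).pullback (act a)).modelForm p)
      (((ω₁ γ₁).pullback (act ((γ₂⁻¹ : Γ) * a))).modelForm p) _
  rw [e1, pairTrace, pairTrace, ← integral_const_mul]
  refine integral_congr_ae (Eventually.of_forall fun h => ?_)
  have e2 : ((γ₂⁻¹ : Γ) : G) * ((γ₁⁻¹ : Γ) * z γ' * h) = z γ' * h * (γ : G)⁻¹ := by
    have h3 : (((γ₁ * γ₂ : Γ) : Γ) : G) = z γ' * γ * (z γ')⁻¹ := by
      rw [← hz'.2]; simp [γ₂]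
    have h4 : ((γ₂⁻¹ : Γ) : G) * ((γ₁⁻¹ : Γ) : G) = (z γ' * γ * (z γ')⁻¹)⁻¹ := by
      rw [← h3]; simp
    have h5 := closureCentralizer.commute h
    rw [← mul_assoc, ← mul_assoc, h4]
    calc _ = z γ' * ((γ : G)⁻¹ * h) := by group
      _ = z γ' * (h * (γ : G)⁻¹) := by
        rw [inv_mul_eq_iff_eq_mul.2]
        rw [← mul_assoc, h5, mul_assoc, mul_inv_cancel, mul_one]
      _ = _ := by group
  simp only [e2]
  rw [wedge_comm, mul_assoc]
  congr 1
  refine wedge_congr (s := {u : E | modelDeriv J (act γ) p u = u}) (fun w hw => rfl)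
    (fun w hw => (hact.modelForm_pullback_mul_inv _ hp _ hw).symm) fun i => ?_
  exact modelDeriv_modelVectors v _

end Trace

/-! ### The exterior derivative -/

section ExtDeriv

theorem ContinuousLinearMap.exists_norm_iteratedFDerivWithin_comp_fderivWithin_le
    {E F F' : Type*} [NormedAddCommGroup E] [NormedSpace ℝ E] [NormedAddCommGroup F]
    [NormedSpace ℝ F] [NormedAddCommGroup F'] [NormedSpace ℝ F'] (L : (E →L[ℝ] F) →L[ℝ] F') :
    ∃ c : ℝ, 0 ≤ c ∧ ∀ (f : E → F) (s : Set E) (y : E), ContDiffWithinAt ℝ ∞ f s y →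
      UniqueDiffOn ℝ s → y ∈ s → ∀ i : ℕ,
        ‖iteratedFDerivWithin ℝ i (fun y => L (fderivWithin ℝ f s y)) s y‖ ≤
          c * ‖iteratedFDerivWithin ℝ (i + 1) f s y‖ := by
  refine ⟨‖L‖, norm_nonneg L, fun f s y h hs hy i => ?_⟩
  have h3 := L.norm_iteratedFDerivWithin_comp_left
    (h.fderivWithin_right (m := ∞) hs (by simp) hy) hs hy (n := i) (by exact_mod_cast le_top)
  rwa [norm_iteratedFDerivWithin_fderivWithin hs hy] at h3

theorem ContinuousLinearMap.contDiffWithinAt_comp_fderivWithin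
    {E F F' : Type*} [NormedAddCommGroup E] [NormedSpace ℝ E] [NormedAddCommGroup F]
    [NormedSpace ℝ F] [NormedAddCommGroup F'] [NormedSpace ℝ F'] (L : (E →L[ℝ] F) →L[ℝ] F')
    {f : E → F} {s : Set E} {y : E} (h : ContDiffWithinAt ℝ ∞ f s y) (hs : UniqueDiffOn ℝ s)
    (hy : y ∈ s) : ContDiffWithinAt ℝ ∞ (fun y => L (fderivWithin ℝ f s y)) s y :=
  L.contDiff.comp_contDiffWithinAt (h.fderivWithin_right (m := ∞) hs (by simp) hy)

variable {E F : Type*} [NormedAddCommGroup E] [NormedSpace ℝ E] [NormedAddCommGroup F]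
  [NormedSpace ℝ F] {k : ℕ} {α : E → E [⋀^Fin k]→L[ℝ] F} {s : Set E} {y : E}

instance instNormedAddCommGroupAlternatingDeriv :
    NormedAddCommGroup (E →L[ℝ] E [⋀^Fin k]→L[ℝ] F) :=
  ContinuousLinearMap.toNormedAddCommGroup

instance instNormedSpaceAlternatingDeriv : NormedSpace ℝ (E →L[ℝ] E [⋀^Fin k]→L[ℝ] F) :=
  ContinuousLinearMap.toNormedSpace

theorem ContDiffWithinAt.extDerivWithin (h : ContDiffWithinAt ℝ ∞ α s y) (hs : UniqueDiffOn ℝ s)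
    (hy : y ∈ s) : ContDiffWithinAt ℝ ∞ (extDerivWithin α s) s y :=
  (ContinuousAlternatingMap.alternatizeUncurryFinCLM ℝ E F
    (n := k)).contDiffWithinAt_comp_fderivWithin h hs hy

variable (E F k) in
theorem exists_norm_iteratedFDerivWithin_extDerivWithin_le : ∃ c : ℝ, 0 ≤ c ∧
    ∀ (α : E → E [⋀^Fin k]→L[ℝ] F) (s : Set E) (y : E), ContDiffWithinAt ℝ ∞ α s y →
      UniqueDiffOn ℝ s → y ∈ s → ∀ i : ℕ, ‖iteratedFDerivWithin ℝ i (extDerivWithin α s) s y‖ ≤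
        c * ‖iteratedFDerivWithin ℝ (i + 1) α s y‖ :=
  (ContinuousAlternatingMap.alternatizeUncurryFinCLM ℝ E F
    (n := k)).exists_norm_iteratedFDerivWithin_comp_fderivWithin_le

theorem integral_alternatizeUncurryFin [CompleteSpace F] {P : Type*} [MeasurableSpace P]
    {ν : Measure P} {f : P → E →L[ℝ] E [⋀^Fin k]→L[ℝ] F} (hf : Integrable f ν) :
    ∫ p, ContinuousAlternatingMap.alternatizeUncurryFin (f p) ∂ν =
      ContinuousAlternatingMap.alternatizeUncurryFin (∫ p, f p ∂ν) :=
  (ContinuousAlternatingMap.alternatizeUncurryFinCLM ℝ E F (n := k)).integral_comp_comm hf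

end ExtDeriv

section ExtD

universe u v

variable {E : Type u} [NormedAddCommGroup E] [NormedSpace ℝ E]
  {H : Type*} [TopologicalSpace H] {J : ModelWithCorners ℝ E H}
  {N : Type*} [TopologicalSpace N] [ChartedSpace H N] {k : ℕ}

theorem DiffForm.IsSmooth.contDiffWithinAt {θ : DiffForm J N k} (hθ : θ.IsSmooth) {p₀ : N} {y : E}
    (hy : y ∈ (extChartAt J p₀).target) : ContDiffWithinAt ℝ ∞ (θ.localRep p₀) (range J) y := by
  refine (hθ p₀ y hy).mono_of_mem_nhdsWithin ?_
  exact extChartAt_target_mem_nhdsWithin_of_mem hy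

variable [IsManifold J ∞ N]

theorem DiffForm.modelForm_extD (θ : DiffForm J N k) (p : N) :
    θ.extD.modelForm p = extDerivWithin (θ.localRep p) (range J) (extChartAt J p p) := by
  have h : mfderiv J 𝓘(ℝ, E) (extChartAt J p) p = ContinuousLinearMap.id ℝ E := chartDeriv_self J p
  change ContinuousAlternatingMap.compContinuousLinearMap _ _ = _
  rw [h]
  rfl

theorem DiffForm.extDerivWithin_localRep_pullback {θ : DiffForm J N k} (hθ : θ.IsSmooth)
    {f : N → N} (hf : ContMDiff J J ∞ f) {p₀ q₀ : N} {y : E} (hy : y ∈ (extChartAt J p₀).target)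
    (hfy : f ((extChartAt J p₀).symm y) ∈ (extChartAt J q₀).source) :
    extDerivWithin ((θ.pullback f).localRep p₀) (range J) y =
      (extDerivWithin (θ.localRep q₀) (range J) (chartExpr J p₀ q₀ f y)).compContinuousLinearMap
        (fderivWithin ℝ (chartExpr J p₀ q₀ f) (range J) y) := by
  have hyr : y ∈ range J := extChartAt_target_subset_range p₀ hy
  have h1 : (θ.pullback f).localRep p₀ =ᶠ[𝓝[range J] y] fun y =>
      (θ.localRep q₀ (chartExpr J p₀ q₀ f y)).compContinuousLinearMap
        (fderivWithin ℝ (chartExpr J p₀ q₀ f) (range J) y) := by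
    have hc : ContinuousOn (fun y => f ((extChartAt J p₀).symm y)) (extChartAt J p₀).target :=
      hf.continuous.comp_continuousOn (continuousOn_extChartAt_symm p₀)
    have h2 : ∀ᶠ z in 𝓝[(extChartAt J p₀).target] y,
        f ((extChartAt J p₀).symm z) ∈ (extChartAt J q₀).source :=
      (hc y hy).eventually ((isOpen_extChartAt_source q₀).mem_nhds hfy)
    have h3 : 𝓝[(extChartAt J p₀).target] y = 𝓝[range J] y := nhdsWithin_extChartAt_target_eq_of_mem hy
    rw [← h3]
    filter_upwards [h2, self_mem_nhdsWithin] with z hz hzt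
    exact θ.localRep_pullback hzt (hf.mdifferentiable (by simp) _) hz
  rw [h1.extDerivWithin_eq (h1.self_of_nhdsWithin hyr)]
  refine extDerivWithin_pullback (r := ∞) (t := range J) ?_ ?_ ?_ J.uniqueDiffOn ?_ hyr ?_
  · exact (hθ.contDiffWithinAt ((extChartAt J q₀).map_source hfy)).differentiableWithinAt (by simp)
  · exact chartExpr_contDiffWithinAt J le_rfl hy hf.contMDiffAt hfy
  · rw [minSmoothness_of_isRCLikeNormedField]
    exact WithTop.coe_le_coe.2 le_top
  · exact J.range_subset_closure_interior hyr
  · exact fun z _ => mem_range_self _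

theorem DiffForm.localRep_extD {θ : DiffForm J N k} (hθ : θ.IsSmooth) {p₀ : N} {y : E}
    (hy : y ∈ (extChartAt J p₀).target) :
    θ.extD.localRep p₀ y = extDerivWithin (θ.localRep p₀) (range J) y := by
  set p := (extChartAt J p₀).symm y
  have hp : id p ∈ (extChartAt J p).source := mem_extChartAt_source p
  have h := extDerivWithin_localRep_pullback hθ contMDiff_id hy hp
  have h2 := modelDeriv_comp_chartSymmDeriv J (f := (id : N → N)) hy mdifferentiableAt_id hp
  have h3 : modelDeriv J (id : N → N) p = .id ℝ E := mfderiv_id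
  have h4 : chartExpr J p₀ p id y = extChartAt J p p := rfl
  rw [h3, h4, chartSymmDeriv_self] at h2
  have h5 : fderivWithin ℝ (chartExpr J p₀ p id) (range J) y = chartSymmDeriv J p₀ y := h2.symm
  rw [DiffForm.pullback_id, h4, h5, ← modelForm_extD] at h
  rw [h, localRep_eq]

theorem DiffForm.extD_pullback {θ : DiffForm J N k} (hθ : θ.IsSmooth)
    {f : N → N} (hf : ContMDiff J J ∞ f) : (θ.pullback f).extD = θ.extD.pullback f := by
  funext p
  change (θ.pullback f).extD.modelForm p = (θ.extD.pullback f).modelForm p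
  have hy := mem_extChartAt_target (I := J) p
  have hp : f ((extChartAt J p).symm (extChartAt J p p)) ∈ (extChartAt J (f p)).source := by
    rw [extChartAt_to_inv]; exact mem_extChartAt_source (f p)
  rw [modelForm_extD, extDerivWithin_localRep_pullback hθ hf hy hp, ← localRep_self,
    θ.extD.localRep_pullback hy (hf.mdifferentiable (by simp) _) hp, localRep_extD hθ]
  exact (extChartAt J (f p)).map_source hp

theorem DiffForm.IsSmooth.extD {θ : DiffForm J N k} (hθ : θ.IsSmooth) : θ.extD.IsSmooth := by
  intro p₀
  refine ContDiffOn.congr (f := fun y => extDerivWithin (θ.localRep p₀) (range J) y) ?_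
    fun y hy => DiffForm.localRep_extD hθ hy
  exact fun y hy => ((hθ.contDiffWithinAt hy).extDerivWithin J.uniqueDiffOn
    (extChartAt_target_subset_range p₀ hy)).mono (extChartAt_target_subset_range p₀)

variable {Γ : Type v} [Group Γ] {S : Finset Γ} {θ : Γ → DiffForm J N k}

theorem IsRapidlyDecreasing.extD (hθ : IsRapidlyDecreasing S θ) :
    IsRapidlyDecreasing S fun γ => (θ γ).extD := by
  refine ⟨fun γ => (hθ.smooth γ).extD, fun p₀ K hK hKt i n => ?_⟩
  obtain ⟨C, hC⟩ := hθ.rapid_decay p₀ K hK hKt (i + 1) n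
  obtain ⟨c, hc0, hc⟩ := exists_norm_iteratedFDerivWithin_extDerivWithin_le E ℂ k
  refine ⟨c * C, fun γ y hy => ?_⟩
  have hyt := hKt hy
  have hyr := extChartAt_target_subset_range p₀ hyt
  have h1 : (θ γ).extD.localRep p₀ =ᶠ[𝓝[range J] y]
      extDerivWithin ((θ γ).localRep p₀) (range J) := by
    filter_upwards [extChartAt_target_mem_nhdsWithin_of_mem hyt] with z hz
    exact DiffForm.localRep_extD (hθ.smooth γ) hz
  rw [h1.iteratedFDerivWithin_eq (h1.self_of_nhdsWithin hyr)]
  have h3 := hc _ _ y ((hθ.smooth γ).contDiffWithinAt hyt) J.uniqueDiffOn hyr i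
  calc _ ≤ _ := mul_le_mul_of_nonneg_right h3 (by positivity)
    _ = c * (_ * _) := mul_assoc _ _ _
    _ ≤ _ := mul_le_mul_of_nonneg_left (hC γ y hy) hc0

end ExtD

/-! ### Averages -/

section Average

universe u v

variable {G : Type*} [Group G] [TopologicalSpace G] [IsTopologicalGroup G] [MeasurableSpace G]
  [BorelSpace G] {Γ : Subgroup G}

local instance : MeasurableSpace (OnePoint (DiscreteCopy Γ) × G) := borel _

local instance : BorelSpace (OnePoint (DiscreteCopy Γ) × G) := ⟨rfl⟩

/-- The measure, on the product of the compactified group with the compact group, that describes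
the averages over a conjugacy class. -/
def conjMeasure (S : Finset Γ) (r : ℕ) (γ : Γ) (μ : Measure (closureCentralizer γ)) (z : Γ → G) :
    Measure (OnePoint (DiscreteCopy Γ) × G) :=
  Measure.sum fun γ' : {γ' : Γ // IsConj γ γ'} =>
    ENNReal.ofReal ((1 + (wordLength S γ' : ℝ)) ^ r)⁻¹ •
      μ.map fun h : closureCentralizer γ => (discretePoint (γ' : Γ), z γ' * (h : G))

variable {S : Finset Γ} {r : ℕ} {γ : Γ} {μ : Measure (closureCentralizer γ)} {z : Γ → G}

omit [MeasurableSpace G] [BorelSpace G] in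
theorem continuous_discretePoint_mul (γ' : Γ) (a : G) :
    Continuous fun h : closureCentralizer γ => (discretePoint γ', a * (h : G)) := by
  fun_prop

theorem isFiniteMeasure_conjMeasure [IsFiniteMeasure μ]
    (hr : Summable fun γ : Γ => ((1 + (wordLength S γ : ℝ)) ^ r)⁻¹) :
    IsFiniteMeasure (conjMeasure S r γ μ z) := by
  refine ⟨?_⟩
  rw [conjMeasure, Measure.sum_apply _ MeasurableSet.univ]
  have h1 : ∀ γ' : {γ' : Γ // IsConj γ γ'}, (ENNReal.ofReal ((1 + (wordLength S γ' : ℝ)) ^ r)⁻¹ •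
      μ.map fun h : closureCentralizer γ => (discretePoint (γ' : Γ), z γ' * (h : G))) univ =
        ENNReal.ofReal ((1 + (wordLength S γ' : ℝ)) ^ r)⁻¹ * μ univ := fun γ' => by
    rw [Measure.smul_apply, Measure.map_apply
      (continuous_discretePoint_mul _ _).measurable MeasurableSet.univ, preimage_univ, smul_eq_mul]
  simp only [h1]
  rw [ENNReal.tsum_mul_right]
  refine ENNReal.mul_lt_top ?_ (measure_lt_top μ univ)
  exact (hr.comp_injective (i := fun γ' : {γ' : Γ // IsConj γ γ'} => (γ' : Γ))
    Subtype.val_injective).tsum_ofReal_lt_top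

theorem integral_conjMeasure {F : Type*} [NormedAddCommGroup F] [NormedSpace ℝ F] [CompleteSpace F]
    [CompactSpace G] [IsFiniteMeasure μ]
    (hr : Summable fun γ : Γ => ((1 + (wordLength S γ : ℝ)) ^ r)⁻¹)
    {f : OnePoint (DiscreteCopy Γ) × G → F} (hf : Continuous f) :
    ∫ w, f w ∂(conjMeasure S r γ μ z) = ∑' γ' : {γ' : Γ // IsConj γ γ'},
      ((1 + (wordLength S γ' : ℝ)) ^ r)⁻¹ • ∫ h, f (discretePoint (γ' : Γ), z γ' * h) ∂μ := by
  have := isFiniteMeasure_conjMeasure (γ := γ) (μ := μ) (z := z) hr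
  have h1 : Integrable f (conjMeasure S r γ μ z) :=
    hf.integrable_of_hasCompactSupport (HasCompactSupport.of_compactSpace _)
  rw [conjMeasure, integral_sum_measure h1]
  refine tsum_congr fun γ' => ?_
  rw [integral_smul_measure, ENNReal.toReal_ofReal (by positivity),
    integral_map (continuous_discretePoint_mul _ _).aemeasurable]
  exact (hf.stronglyMeasurable_of_hasCompactSupport
    (HasCompactSupport.of_compactSpace _)).aestronglyMeasurable

variable {E : Type u} [NormedAddCommGroup E] [NormedSpace ℝ E] [FiniteDimensional ℝ E]
  {H : Type*} [TopologicalSpace H] {J : ModelWithCorners ℝ E H} [J.Boundaryless]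
  {N : Type*} [TopologicalSpace N] [ChartedSpace H N] {k : ℕ} {act : G → N → N}

variable (act) in
/-- The average of a family of forms over a conjugacy class, as a form on the whole manifold. -/
def averageForm (S : Finset Γ) (r : ℕ) (γ : Γ) (μ : Measure (closureCentralizer γ)) (z : Γ → G)
    (θ : Γ → DiffForm J N k) : DiffForm J N k := fun p =>
  (∫ w, weightedPullback S θ act r p (w, extChartAt J p p) ∂(conjMeasure S r γ μ z) :
    E [⋀^Fin k]→L[ℝ] ℂ)

variable [IsManifold J ∞ N] [CompactSpace G] [IsFiniteMeasure μ]
    (hr : Summable fun γ : Γ => ((1 + (wordLength S γ : ℝ)) ^ r)⁻¹)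
    (hS : Tendsto (wordLength S) cofinite atTop)
    (hact : IsSmoothAction J act) {θ : Γ → DiffForm J N k} (hθ : IsRapidlyDecreasing S θ)

include hr hS hact hθ

omit [J.Boundaryless] in
theorem integrable_weightedPullback {p₀ : N} {y : E} (hy : y ∈ (extChartAt J p₀).target) :
    Integrable (fun w => weightedPullback S θ act r p₀ (w, y)) (conjMeasure S r γ μ z) := by
  have := isFiniteMeasure_conjMeasure (γ := γ) (μ := μ) (z := z) hr
  exact (hθ.continuousOn_weightedPullback hS hact.smooth r p₀ hy).integrable_of_hasCompactSupport
    (HasCompactSupport.of_compactSpace _)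

omit [J.Boundaryless] in
theorem localRep_averageForm (p₀ : N) (y : E) :
    (averageForm act S r γ μ z θ).localRep p₀ y =
      ∫ w, weightedPullback S θ act r p₀ (w, y) ∂(conjMeasure S r γ μ z) := by
  set p := (extChartAt J p₀).symm y
  have h1 : (averageForm act S r γ μ z θ).modelForm p =
    ∫ w, weightedPullback S θ act r p (w, extChartAt J p p) ∂(conjMeasure S r γ μ z) := rfl
  rw [DiffForm.localRep_eq, h1]
  refine ((ContinuousAlternatingMap.compContinuousLinearMapCLM
    (chartSymmDeriv J p₀ y)).integral_comp_comm
    (integrable_weightedPullback (γ := γ) (μ := μ) (z := z) hr hS hact hθ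
      (mem_extChartAt_target p))).symm.trans ?_
  refine integral_congr_ae (Eventually.of_forall fun ⟨α, a⟩ => ?_)
  induction α using OnePoint.rec with
  | infty => exact map_zero (ContinuousAlternatingMap.compContinuousLinearMapCLM _)
  | coe γ' =>
    have h2 : weightedPullback S θ act r p ((↑γ', a), extChartAt J p p) =
        (1 + (wordLength S γ' : ℝ)) ^ r • ((θ γ').pullback (act a)).modelForm p :=
      weightedPullback_self (S := S) (θ := θ) (act := act) r p γ' a
    beta_reduce
    rw [h2, map_smul]
    rfl

theorem isSmooth_averageForm : (averageForm act S r γ μ z θ).IsSmooth := by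
  have := isFiniteMeasure_conjMeasure (γ := γ) (μ := μ) (z := z) hr
  have : ProperSpace E := FiniteDimensional.proper_real E
  intro p₀
  rw [contDiffOn_infty]
  intro m
  refine ContDiffOn.congr (f := fun y => ∫ w, weightedPullback S θ act r p₀ (w, y)
    ∂(conjMeasure S r γ μ z)) ?_ fun y _ => localRep_averageForm hr hS hact hθ p₀ y
  have h := hθ.paramDiff_weightedPullback hS hact.smooth r p₀ m
  rw [J.range_eq_univ] at h
  rw [extChartAt_target_eq, J.range_eq_univ, univ_inter]
  exact ParamDiff.contDiffOn_integral (ν := conjMeasure S r γ μ z) (isOpen_preimage_chartAt_target p₀) h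

theorem averageForm_extD (p : N) : (averageForm act S r γ μ z θ).extD p =
    averageForm act S r γ μ z (fun γ => (θ γ).extD) p := by
  have := isFiniteMeasure_conjMeasure (γ := γ) (μ := μ) (z := z) hr
  have : ProperSpace E := FiniteDimensional.proper_real E
  change (averageForm act S r γ μ z θ).extD.modelForm p =
    ∫ w, weightedPullback S (fun γ => (θ γ).extD) act r p (w, extChartAt J p p)
      ∂(conjMeasure S r γ μ z)
  set y := extChartAt J p p
  have hy : y ∈ (extChartAt J p).target := mem_extChartAt_target p
  set U := J.symm ⁻¹' (chartAt H p).target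
  have hU : IsOpen U := isOpen_preimage_chartAt_target p
  have hUt : U = (extChartAt J p).target := by
    rw [extChartAt_target_eq, J.range_eq_univ, univ_inter]
  obtain ⟨hc, f', hf', hn⟩ := hθ.paramDiff_weightedPullback hS hact.smooth r p 1
  simp only [J.range_eq_univ, preimage_univ, inter_univ] at hc hf' hn
  have hn' : ContinuousOn f' (univ ×ˢ U) := by simpa using hn.continuousOn
  have hf'' : ∀ w : (OnePoint (DiscreteCopy Γ) × G) × E, w.2 ∈ U →
      HasFDerivAt (fun y => weightedPullback S θ act r p (w.1, y)) (f' w) w.2 := fun w hw => by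
    have := hf' w ⟨mem_univ _, hw⟩ (mem_univ _)
    rwa [hasFDerivWithinAt_univ] at this
  have hd := ParamDiff.hasFDerivAt_integral (ν := conjMeasure S r γ μ z) hU hc hf'' hn'
    (hUt ▸ hy : y ∈ U)
  rw [DiffForm.modelForm_extD, J.range_eq_univ, extDerivWithin_univ, extDeriv]
  have h1 : (averageForm act S r γ μ z θ).localRep p =ᶠ[𝓝 y] fun y =>
      ∫ w, weightedPullback S θ act r p (w, y) ∂(conjMeasure S r γ μ z) :=
    Eventually.of_forall fun x => localRep_averageForm hr hS hact hθ p x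
  rw [h1.fderiv_eq, hd.fderiv]
  have hint : Integrable (fun w => f' (w, y)) (conjMeasure S r γ μ z) :=
    Continuous.integrable_of_hasCompactSupport (continuousOn_univ.1 (hn'.comp
      (Continuous.prodMk_left y).continuousOn fun w _ => ⟨mem_univ _, hUt ▸ hy⟩))
      (HasCompactSupport.of_compactSpace _)
  rw [← integral_alternatizeUncurryFin hint]
  refine integral_congr_ae (Eventually.of_forall fun ⟨α, a⟩ => ?_)
  have h2 := (hf'' ((α, a), y) (hUt ▸ hy)).fderiv
  simp only [← h2]
  induction α using OnePoint.rec with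
  | infty =>
    have h3 : (fun y => weightedPullback S θ act r p ((OnePoint.infty, a), y)) = fun _ => 0 := rfl
    rw [h3, fderiv_fun_const]
    exact map_zero (ContinuousAlternatingMap.alternatizeUncurryFinCLM ℝ E ℂ)
  | coe γ' =>
    have h3 : (fun y => weightedPullback S θ act r p ((↑γ', a), y)) =
      (1 + (wordLength S γ' : ℝ)) ^ r • ((θ γ').pullback (act a)).localRep p := rfl
    have h4 : weightedPullback S (fun γ => (θ γ).extD) act r p ((↑γ', a), y) =
        (1 + (wordLength S γ' : ℝ)) ^ r • ((θ γ').extD.pullback (act a)).modelForm p :=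
      weightedPullback_self (S := S) (θ := fun γ => (θ γ).extD) (act := act) r p γ' a
    rw [h4, h3, ← DiffForm.extD_pullback (hθ.smooth γ') (hact.smooth.contMDiff a),
      DiffForm.modelForm_extD, J.range_eq_univ, extDerivWithin_univ, ← extDeriv_smul]
    rfl

omit [J.Boundaryless] in
theorem restrict_averageForm (p : Function.fixedPoints (act γ)) :
    (averageForm act S r γ μ z θ).restrict (act γ) p = tau act γ μ z θ p := by
  funext v
  have h1 : (averageForm act S r γ μ z θ).restrict (act γ) p v =
    (∫ w, weightedPullback S θ act r (p : N) (w, extChartAt J (p : N) p)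
      ∂(conjMeasure S r γ μ z)) (modelVectors v) := rfl
  have hp := mem_extChartAt_target (I := J) (p : N)
  have hcont := hθ.continuousOn_weightedPullback hS hact.smooth r (p : N) hp
  rw [h1, tau]
  refine ((ContinuousAlternatingMap.apply ℝ E ℂ (modelVectors v)).integral_comp_comm
    (integrable_weightedPullback hr hS hact hθ hp)).symm.trans ?_
  refine (integral_conjMeasure hr (hcont.alternatingMap_apply (modelVectors v))).trans ?_
  refine tsum_congr fun γ' => ?_
  simp only [tauSummand, hact.restrict_pullback_pullback]
  rw [← integral_smul]
  refine integral_congr_ae (Eventually.of_forall fun h => ?_)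
  have h2 := weightedPullback_self (S := S) (θ := θ) (act := act) r (p : N) γ' (z γ' * h)
  simp only [h2, ContinuousAlternatingMap.smul_apply]
  rw [smul_smul, inv_mul_cancel₀ (by positivity), one_smul]

theorem hasExtD_tau : (tau act γ μ z θ).HasExtD (tau act γ μ z fun γ => (θ γ).extD) :=
  fun _ => ⟨univ, univ_mem, averageForm act S r γ μ z θ, isSmooth_averageForm hr hS hact hθ,
    fun q _ => ⟨restrict_averageForm hr hS hact hθ q, by
      rw [← restrict_averageForm hr hS hact hθ.extD q]
      funext v
      exact congrArg (fun α : E [⋀^Fin (k + 1)]→L[ℝ] ℂ => α (modelVectors v))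
        (averageForm_extD hr hS hact hθ q)⟩⟩

end Average

/-! ### The regularized trace of a Green symbol -/

section HalfLine

open Complex in
theorem norm_exp_neg_I_mul (x η : ℝ) : ‖exp (-(I * x * η))‖ = 1 := by
  rw [show -(I * x * η : ℂ) = ((-(x * η) : ℝ) : ℂ) * I by push_cast; ring, norm_exp_ofReal_mul_I]

theorem IntegrableOn.fourier_mul {s : Set ℝ} {h : ℝ → ℂ} (hh : IntegrableOn h s) (η : ℝ) :
    IntegrableOn (fun x : ℝ => Complex.exp (-(Complex.I * x * η)) * h x) s := by
  refine hh.bdd_mul (c := 1) ?_ (Eventually.of_forall fun x => (norm_exp_neg_I_mul x η).le)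
  exact (by fun_prop : Continuous fun x : ℝ =>
    Complex.exp (-(Complex.I * x * η))).aestronglyMeasurable

/-- Integration by parts on a half-line. -/
theorem abs_mul_norm_fourierOn_Ioi_le {h h' : ℝ → ℂ} (hd : ∀ x, HasDerivAt h (h' x) x)
    (hi : IntegrableOn h (Ioi 0)) (hi' : IntegrableOn h' (Ioi 0)) (η : ℝ) :
    |η| * ‖fourierOn (Ioi 0) h η‖ ≤ ‖h 0‖ + ∫ x in Ioi (0 : ℝ), ‖h' x‖ := by
  set e : ℝ → ℂ := fun x => Complex.exp (-(Complex.I * x * η))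
  have he : ∀ x, HasDerivAt e (e x * -(Complex.I * η)) x := fun x => by
    have h1 : HasDerivAt (fun x : ℝ => -(Complex.I * (x : ℂ) * η)) (-(Complex.I * η)) x := by
      have := (((hasDerivAt_id x).ofReal_comp.const_mul Complex.I).mul_const (η : ℂ)).fun_neg
      simpa using this
    exact h1.cexp
  have hint1 := IntegrableOn.fourier_mul hi η
  have hint2 := IntegrableOn.fourier_mul hi' η
  have hG : ∀ x, HasDerivAt (fun x => e x * h x) (-(Complex.I * η) * (e x * h x) + e x * h' x) x :=
    fun x => ((he x).mul (hd x)).congr_deriv (by ring)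
  have hint : IntegrableOn (fun x => -(Complex.I * η) * (e x * h x) + e x * h' x) (Ioi 0) :=
    (Integrable.const_mul hint1 _).add hint2
  have h2 := integral_Ioi_of_hasDerivAt_of_tendsto (hG 0).continuousAt.continuousWithinAt
    (fun x _ => hG x) hint
    (tendsto_zero_of_hasDerivAt_of_integrableOn_Ioi (fun x _ => hG x) hint hint1)
  rw [integral_add (Integrable.const_mul hint1 _) hint2, integral_const_mul] at h2
  have h3 : Complex.I * η * fourierOn (Ioi 0) h η = h 0 + ∫ x in Ioi (0 : ℝ), e x * h' x := by
    have he0 : e 0 = 1 := by simp [e]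
    rw [he0] at h2
    simp only [fourierOn]
    linear_combination -h2
  have h4 : |η| * ‖fourierOn (Ioi 0) h η‖ = ‖Complex.I * η * fourierOn (Ioi 0) h η‖ := by simp
  rw [h4, h3]
  refine (norm_add_le _ _).trans (add_le_add_right ?_ _)
  refine (norm_integral_le_integral_norm _).trans_eq (integral_congr_ae ?_)
  exact Eventually.of_forall fun x => by simp [e, norm_exp_neg_I_mul]

theorem fourierOn_Iic_zero (h : ℝ → ℂ) (η : ℝ) :
    fourierOn (Iic 0) h η = fourierOn (Ioi 0) (fun x => h (-x)) (-η) := by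
  have := integral_comp_neg_Ioi (0 : ℝ) fun x : ℝ => Complex.exp (-(Complex.I * x * η)) * h x
  rw [neg_zero] at this
  rw [fourierOn, fourierOn, ← this]
  simp

theorem abs_mul_norm_fourierOn_Iic_le {h h' : ℝ → ℂ} (hd : ∀ x, HasDerivAt h (h' x) x)
    (hi : Integrable h) (hi' : Integrable h') (η : ℝ) :
    |η| * ‖fourierOn (Iic 0) h η‖ ≤ ‖h 0‖ + ∫ x, ‖h' x‖ := by
  have hd' : ∀ x, HasDerivAt (fun x => h (-x)) (-h' (-x)) x := fun x => by
    have h1 := (hd (-x)).scomp x (hasDerivAt_neg x)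
    rw [neg_one_smul] at h1
    exact h1
  have h1 := abs_mul_norm_fourierOn_Ioi_le hd' hi.comp_neg.integrableOn
    hi'.comp_neg.neg.integrableOn (-η)
  rw [abs_neg, ← fourierOn_Iic_zero, neg_zero] at h1
  refine h1.trans (add_le_add_right ?_ _)
  simp only [norm_neg]
  rw [← integral_neg_eq_self (fun x => ‖h' x‖)]
  exact setIntegral_le_integral hi'.comp_neg.norm (Eventually.of_forall fun x => norm_nonneg _)

end HalfLine

section Green

open LineDeriv

variable (f : SchwartzMap (ℝ × ℝ) ℂ)

theorem SchwartzMap.exists_norm_prod_le {F : Type*} [NormedAddCommGroup F] [NormedSpace ℝ F]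
    (f : SchwartzMap (ℝ × ℝ) F) :
    ∃ C, 0 ≤ C ∧ ∀ x y, ‖f (x, y)‖ ≤ C * ((1 + x ^ 2)⁻¹ * (1 + y ^ 2)⁻¹) := by
  set C := 2 ^ 4 * ((Finset.Iic (4, 0)).sup fun m => SchwartzMap.seminorm ℝ m.1 m.2) f
  have h : ∀ z, (1 + ‖z‖) ^ 4 * ‖f z‖ ≤ C := fun z => by
    have := SchwartzMap.one_add_le_sup_seminorm_apply (𝕜 := ℝ) (m := (4, 0)) (k := 4) (n := 0)
      le_rfl le_rfl f z
    rwa [norm_iteratedFDeriv_zero] at this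
  refine ⟨C, (by positivity : (0 : ℝ) ≤ _).trans (h 0), fun x y => ?_⟩
  rw [← mul_inv, ← div_eq_mul_inv, le_div_iff₀' (by positivity)]
  refine le_trans (mul_le_mul_of_nonneg_right ?_ (norm_nonneg _)) (h (x, y))
  have h1 : ∀ t : ℝ, |t| ≤ ‖(x, y)‖ → 1 + t ^ 2 ≤ (1 + ‖(x, y)‖) ^ 2 := fun t ht => by
    nlinarith [sq_abs t, abs_nonneg t]
  calc _ ≤ (1 + ‖(x, y)‖) ^ 2 * (1 + ‖(x, y)‖) ^ 2 :=
      mul_le_mul (h1 x (norm_fst_le (x, y))) (h1 y (norm_snd_le (x, y))) (by positivity)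
        (by positivity)
    _ = _ := by ring

theorem SchwartzMap.integrable_slice (x : ℝ) : Integrable fun y => f (x, y) := by
  obtain ⟨C, -, hC⟩ := f.exists_norm_prod_le
  refine Integrable.mono' ((integrable_inv_one_add_sq.const_mul (1 + x ^ 2)⁻¹).const_mul C)
    (f.continuous.comp (Continuous.prodMk_right x)).aestronglyMeasurable
    (Eventually.of_forall fun y => hC x y)

theorem SchwartzMap.hasDerivAt_fst (x y : ℝ) :
    HasDerivAt (fun x => f (x, y)) ((∂_{((1, 0) : ℝ × ℝ)} f) (x, y)) x := by
  rw [SchwartzMap.lineDerivOp_apply_eq_fderiv]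
  exact (f.differentiableAt (x := (x, y))).hasFDerivAt.comp_hasDerivAt x
    ((hasDerivAt_id x).prodMk (hasDerivAt_const x y))

theorem SchwartzMap.hasDerivAt_snd (x y : ℝ) :
    HasDerivAt (fun y => f (x, y)) ((∂_{((0, 1) : ℝ × ℝ)} f) (x, y)) y := by
  rw [SchwartzMap.lineDerivOp_apply_eq_fderiv]
  exact (f.differentiableAt (x := (x, y))).hasFDerivAt.comp_hasDerivAt y
    ((hasDerivAt_const y x).prodMk (hasDerivAt_id y))

/-- The partial Fourier transform over `y ≤ 0` is `O(1 / |η|)`. -/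
theorem SchwartzMap.exists_fourierOn_slice_le : ∃ C, 0 ≤ C ∧ ∀ x η : ℝ,
    |η| * ‖fourierOn (Iic 0) (fun y => f (x, y)) η‖ ≤ C * (1 + x ^ 2)⁻¹ := by
  obtain ⟨C, hC0, hC⟩ := f.exists_norm_prod_le
  obtain ⟨C', hC0', hC'⟩ := (∂_{((0, 1) : ℝ × ℝ)} f).exists_norm_prod_le
  set D := ∫ y : ℝ, (1 + y ^ 2)⁻¹
  have hD : 0 ≤ D := integral_nonneg fun y => by positivity
  refine ⟨C + C' * D, by positivity, fun x η => ?_⟩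
  refine (abs_mul_norm_fourierOn_Iic_le (f.hasDerivAt_snd x) (f.integrable_slice x)
    ((∂_{((0, 1) : ℝ × ℝ)} f).integrable_slice x) η).trans ?_
  rw [add_mul]
  refine add_le_add ((hC x 0).trans_eq (by simp)) ?_
  calc _ ≤ ∫ y : ℝ, C' * ((1 + x ^ 2)⁻¹ * (1 + y ^ 2)⁻¹) :=
      integral_mono ((∂_{((0, 1) : ℝ × ℝ)} f).integrable_slice x).norm
        ((integrable_inv_one_add_sq.const_mul _).const_mul _) (hC' x)
    _ = _ := by rw [integral_const_mul, integral_const_mul]; ring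

theorem SchwartzMap.hasDerivAt_fourierOn_slice (x η : ℝ) :
    HasDerivAt (fun x => fourierOn (Iic 0) (fun y => f (x, y)) η)
      (fourierOn (Iic 0) (fun y => (∂_{((1, 0) : ℝ × ℝ)} f) (x, y)) η) x := by
  obtain ⟨C, hC0, hC⟩ := (∂_{((1, 0) : ℝ × ℝ)} f).exists_norm_prod_le
  refine (hasDerivAt_integral_of_dominated_loc_of_deriv_le (𝕜 := ℝ) (s := univ)
    (μ := volume.restrict (Iic 0))
    (F := fun x y => Complex.exp (-(Complex.I * y * η)) * f (x, y))
    (F' := fun x y => Complex.exp (-(Complex.I * y * η)) * (∂_{((1, 0) : ℝ × ℝ)} f) (x, y))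
    (bound := fun y : ℝ => C * (1 + y ^ 2)⁻¹) univ_mem
    (Eventually.of_forall fun x => ?_)
    (IntegrableOn.fourier_mul (f.integrable_slice x).integrableOn η)
    (IntegrableOn.fourier_mul (h := fun y => (∂_{((1, 0) : ℝ × ℝ)} f) (x, y))
      ((∂_{((1, 0) : ℝ × ℝ)} f).integrable_slice x).integrableOn η).aestronglyMeasurable
    (Eventually.of_forall fun y x _ => ?_) (integrable_inv_one_add_sq.const_mul C).integrableOn
    (Eventually.of_forall fun y x _ => (f.hasDerivAt_fst x y).const_mul _)).2
  · exact (IntegrableOn.fourier_mul (f.integrable_slice x).integrableOn η).aestronglyMeasurable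
  · rw [norm_mul, norm_exp_neg_I_mul, one_mul]
    refine (hC x y).trans (mul_le_mul_of_nonneg_left ?_ hC0)
    exact mul_le_of_le_one_left (by positivity) (inv_le_one_of_one_le₀ (by nlinarith))

theorem SchwartzMap.integrable_fourierOn_slice (η : ℝ) :
    Integrable fun x => fourierOn (Iic 0) (fun y => f (x, y)) η := by
  have hc : Continuous fun x => fourierOn (Iic 0) (fun y => f (x, y)) η :=
    continuous_iff_continuousAt.2 fun x => (f.hasDerivAt_fourierOn_slice x η).continuousAt
  obtain ⟨C, hC0, hC⟩ := f.exists_norm_prod_le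
  refine Integrable.mono' ((integrable_inv_one_add_sq).const_mul (C * ∫ y : ℝ, (1 + y ^ 2)⁻¹))
    hc.aestronglyMeasurable (Eventually.of_forall fun x => ?_)
  calc _ ≤ ∫ y in Iic (0 : ℝ), ‖Complex.exp (-(Complex.I * y * η)) * f (x, y)‖ :=
      norm_integral_le_integral_norm _
    _ = ∫ y in Iic (0 : ℝ), ‖f (x, y)‖ := by simp [norm_exp_neg_I_mul]
    _ ≤ ∫ y, ‖f (x, y)‖ := setIntegral_le_integral (f.integrable_slice x).norm
        (Eventually.of_forall fun y => norm_nonneg _)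
    _ ≤ ∫ y : ℝ, C * ((1 + x ^ 2)⁻¹ * (1 + y ^ 2)⁻¹) :=
      integral_mono (f.integrable_slice x).norm
        ((integrable_inv_one_add_sq.const_mul _).const_mul _) (hC x)
    _ = _ := by rw [integral_const_mul, integral_const_mul]; ring

/-- The restriction to the diagonal of the Fourier transform over the quadrant `x ≥ 0 ≥ y`. -/
def quadrantDiagonal (f : ℝ × ℝ → ℂ) (η : ℝ) : ℂ :=
  ∫ x in (Ici (0 : ℝ)) ×ˢ (Iic (0 : ℝ)), Complex.exp (-(Complex.I * (x.1 * η + x.2 * η))) * f x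

theorem SchwartzMap.integrableOn_quadrantDiagonal (η : ℝ) :
    Integrable fun x : ℝ × ℝ => Complex.exp (-(Complex.I * (x.1 * η + x.2 * η))) * f x := by
  refine f.integrable.bdd_mul (c := 1) ?_ (Eventually.of_forall fun x => ?_)
  · exact (by fun_prop : Continuous fun x : ℝ × ℝ =>
      Complex.exp (-(Complex.I * (x.1 * η + x.2 * η)))).aestronglyMeasurable
  · have := norm_exp_neg_I_mul (x.1 + x.2) η
    push_cast at this
    rw [mul_assoc, add_mul] at this
    exact this.le

theorem SchwartzMap.quadrantDiagonal_eq (η : ℝ) : quadrantDiagonal f η =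
    fourierOn (Ioi 0) (fun x => fourierOn (Iic 0) (fun y => f (x, y)) η) η := by
  rw [quadrantDiagonal, Measure.volume_eq_prod, setIntegral_prod _
    (f.integrableOn_quadrantDiagonal η).integrableOn, integral_Ici_eq_integral_Ioi, fourierOn]
  refine integral_congr_ae (Eventually.of_forall fun x => ?_)
  simp only [fourierOn]
  rw [← integral_const_mul]
  refine integral_congr_ae (Eventually.of_forall fun y => ?_)
  simp only
  rw [← mul_assoc, ← Complex.exp_add]
  congr 2
  ring

theorem SchwartzMap.exists_norm_quadrantDiagonal_le :
    ∃ C, ∀ η : ℝ, ‖quadrantDiagonal f η‖ ≤ C * (1 + η ^ 2)⁻¹ := by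
  obtain ⟨C, hC0, hC⟩ := f.exists_fourierOn_slice_le
  obtain ⟨C', hC0', hC'⟩ := (∂_{((1, 0) : ℝ × ℝ)} f).exists_fourierOn_slice_le
  set D := ∫ y : ℝ, (1 + y ^ 2)⁻¹
  set B := ∫ x, ‖f x‖
  refine ⟨B + (C + C' * D), fun η => ?_⟩
  have h0 : ‖quadrantDiagonal f η‖ ≤ B := by
    refine (norm_integral_le_integral_norm _).trans ?_
    refine (setIntegral_le_integral (f.integrableOn_quadrantDiagonal η).norm
      (Eventually.of_forall fun y => norm_nonneg _)).trans_eq (integral_congr_ae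
        (Eventually.of_forall fun x => ?_))
    have := norm_exp_neg_I_mul (x.1 + x.2) η
    push_cast at this
    rw [mul_assoc, add_mul] at this
    simp only
    rw [norm_mul, this, one_mul]
  have h1 := abs_mul_norm_fourierOn_Ioi_le (fun x => f.hasDerivAt_fourierOn_slice x η)
    (f.integrable_fourierOn_slice η).integrableOn
    ((∂_{((1, 0) : ℝ × ℝ)} f).integrable_fourierOn_slice η).integrableOn η
  rw [← f.quadrantDiagonal_eq] at h1
  have h2 : |η| * ∫ x in Ioi (0 : ℝ),
      ‖fourierOn (Iic 0) (fun y => (∂_{((1, 0) : ℝ × ℝ)} f) (x, y)) η‖ ≤ C' * D := by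
    rw [← integral_const_mul, ← integral_const_mul]
    refine le_trans ?_ (setIntegral_le_integral (s := Ioi 0)
      (integrable_inv_one_add_sq.const_mul C')
      (Eventually.of_forall fun y => by positivity))
    exact integral_mono
      (((∂_{((1, 0) : ℝ × ℝ)} f).integrable_fourierOn_slice η).norm.const_mul _).integrableOn
      (integrable_inv_one_add_sq.const_mul C').integrableOn fun x => hC' x η
  have h3 := hC 0 η
  have h4 : η ^ 2 * ‖quadrantDiagonal f η‖ ≤ C + C' * D := by
    rw [← sq_abs, sq, mul_assoc]
    refine (mul_le_mul_of_nonneg_left h1 (abs_nonneg η)).trans ?_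
    rw [mul_add]
    exact add_le_add (h3.trans_eq (by simp)) h2
  rw [← div_eq_mul_inv, le_div_iff₀ (by positivity)]
  linarith

/-- The function of which `quadrantDiagonal f` is the Fourier transform. -/
def antidiagonalIntegral (f : ℝ × ℝ → ℂ) (t : ℝ) : ℂ :=
  ∫ x, ((Ici (0 : ℝ)) ×ˢ (Iic (0 : ℝ))).indicator f (x, t - x)

theorem antidiagonalIntegral_zero (f : ℝ × ℝ → ℂ) :
    antidiagonalIntegral f 0 = ∫ x in Ici (0 : ℝ), f (x, -x) := by
  rw [antidiagonalIntegral, ← integral_indicator measurableSet_Ici]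
  refine integral_congr_ae (Eventually.of_forall fun x => ?_)
  by_cases hx : 0 ≤ x <;> simp [indicator, hx]

theorem SchwartzMap.continuous_antidiagonalIntegral : Continuous (antidiagonalIntegral f) := by
  obtain ⟨C, hC0, hC⟩ := f.exists_norm_prod_le
  refine continuous_iff_continuousAt.2 fun t => ?_
  refine continuousAt_of_dominated (bound := fun x => C * (1 + x ^ 2)⁻¹)
    (Eventually.of_forall fun t => ?_) (Eventually.of_forall fun t => Eventually.of_forall fun x =>
    ?_) (integrable_inv_one_add_sq.const_mul C) ?_
  · exact ((f.continuous.measurable.indicator (measurableSet_Ici.prod measurableSet_Iic)).comp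
      (by fun_prop : Measurable fun x : ℝ => (x, t - x))).aestronglyMeasurable
  · refine (norm_indicator_le_norm_self _ _).trans ((hC _ _).trans
      (mul_le_mul_of_nonneg_left ?_ hC0))
    exact mul_le_of_le_one_right (by positivity) (inv_le_one_of_one_le₀ (by nlinarith [sq_nonneg (t - x)]))
  · have h : ∀ᵐ x : ℝ, x ≠ t := by simp [ae_iff]
    filter_upwards [h] with x hx
    have hf : ContinuousAt (fun t => f (x, t - x)) t := (f.continuous.comp (by fun_prop)).continuousAt
    have hev : ∀ᶠ s in 𝓝 t, (0 ≤ x ∧ s - x ≤ 0 ↔ 0 ≤ x ∧ t - x ≤ 0) := by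
      rcases lt_or_gt_of_ne hx with h1 | h1
      · filter_upwards [lt_mem_nhds h1] with s hs
        constructor <;> rintro ⟨-, h2⟩ <;> linarith
      · filter_upwards [gt_mem_nhds h1] with s hs
        constructor <;> rintro ⟨h2, -⟩ <;> exact ⟨h2, by linarith⟩
    by_cases hP : 0 ≤ x ∧ t - x ≤ 0
    · refine hf.congr ?_
      filter_upwards [hev] with s hs
      rw [indicator_of_mem (by simpa using hs.2 hP)]
    · refine (continuousAt_const (y := (0 : ℂ))).congr ?_
      filter_upwards [hev] with s hs
      rw [indicator_of_notMem (fun h => hP (hs.1 (by simpa using h)))]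

theorem SchwartzMap.integrable_indicator_shear (η : ℝ) :
    Integrable (fun z : ℝ × ℝ => Complex.exp (-(Complex.I * z.2 * η)) *
      ((Ici (0 : ℝ)) ×ˢ (Iic (0 : ℝ))).indicator f (z.1, z.2 - z.1)) ∧
    ∫ z : ℝ × ℝ, Complex.exp (-(Complex.I * z.2 * η)) *
      ((Ici (0 : ℝ)) ×ˢ (Iic (0 : ℝ))).indicator f (z.1, z.2 - z.1) = quadrantDiagonal f η := by
  have hmp : MeasurePreserving (fun z : ℝ × ℝ => (z.1, z.1 + z.2)) (volume : Measure (ℝ × ℝ))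
      volume := measurePreserving_prod_add volume volume
  have hemb : MeasurableEmbedding (fun z : ℝ × ℝ => (z.1, z.1 + z.2)) :=
    (MeasurableEquiv.shearAddRight ℝ).measurableEmbedding
  have hS : MeasurableSet ((Ici (0 : ℝ)) ×ˢ (Iic (0 : ℝ))) := measurableSet_Ici.prod measurableSet_Iic
  have heq : (fun z : ℝ × ℝ => Complex.exp (-(Complex.I * z.2 * η)) *
      ((Ici (0 : ℝ)) ×ˢ (Iic (0 : ℝ))).indicator f (z.1, z.2 - z.1)) ∘
      (fun z : ℝ × ℝ => (z.1, z.1 + z.2)) = ((Ici (0 : ℝ)) ×ˢ (Iic (0 : ℝ))).indicator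
        fun x : ℝ × ℝ => Complex.exp (-(Complex.I * (x.1 * η + x.2 * η))) * f x := by
    funext z
    simp only [Function.comp_apply, add_sub_cancel_left]
    by_cases hz : z ∈ (Ici (0 : ℝ)) ×ˢ (Iic (0 : ℝ))
    · rw [indicator_of_mem hz, indicator_of_mem (show (z.1, z.2) ∈ _ from hz)]
      push_cast
      congr 3
      ring
    · rw [indicator_of_notMem hz, indicator_of_notMem (show (z.1, z.2) ∉ _ from hz), mul_zero]
  constructor
  · rw [← hmp.integrable_comp_emb hemb, heq]
    exact (f.integrableOn_quadrantDiagonal η).indicator hS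
  · rw [← hmp.integral_comp hemb, quadrantDiagonal, ← integral_indicator hS, ← heq]
    rfl

theorem SchwartzMap.integrable_antidiagonalIntegral : Integrable (antidiagonalIntegral f) := by
  have h := (f.integrable_indicator_shear 0).1
  rw [Measure.volume_eq_prod] at h
  have h' := h.integral_prod_right
  simp only [Complex.ofReal_zero, mul_zero, neg_zero, Complex.exp_zero, one_mul] at h'
  exact h'

theorem SchwartzMap.integral_antidiagonalIntegral (η : ℝ) :
    ∫ t : ℝ, Complex.exp (-(Complex.I * t * η)) * antidiagonalIntegral f t = quadrantDiagonal f η := by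
  obtain ⟨h1, h2⟩ := f.integrable_indicator_shear η
  rw [Measure.volume_eq_prod] at h1 h2
  rw [← h2, integral_prod_symm _ h1]
  refine integral_congr_ae (Eventually.of_forall fun t => ?_)
  simp only [antidiagonalIntegral]
  rw [integral_const_mul]

open FourierTransform in
theorem SchwartzMap.fourier_antidiagonalIntegral (w : ℝ) :
    𝓕 (antidiagonalIntegral f) w = quadrantDiagonal f (2 * Real.pi * w) := by
  rw [Real.fourier_eq', ← f.integral_antidiagonalIntegral]
  refine integral_congr_ae (Eventually.of_forall fun t => ?_)
  simp only [smul_eq_mul]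
  congr 2
  simp
  ring

theorem SchwartzMap.integrable_quadrantDiagonal : Integrable (quadrantDiagonal f) := by
  obtain ⟨C, hC⟩ := f.exists_norm_quadrantDiagonal_le
  refine Integrable.mono' (integrable_inv_one_add_sq.const_mul C) ?_ (Eventually.of_forall hC)
  refine Continuous.aestronglyMeasurable ?_
  have h : quadrantDiagonal f = fun η : ℝ =>
      ∫ t : ℝ, Complex.exp (-(Complex.I * t * η)) * antidiagonalIntegral f t :=
    funext fun η => (f.integral_antidiagonalIntegral η).symm
  rw [h]
  refine continuous_of_dominated (bound := fun t => ‖antidiagonalIntegral f t‖)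
    (fun η => ?_) (fun η => Eventually.of_forall fun t => ?_)
    f.integrable_antidiagonalIntegral.norm (Eventually.of_forall fun t => by fun_prop)
  · exact ((by fun_prop : Continuous fun t : ℝ => Complex.exp (-(Complex.I * t * η))).mul
      f.continuous_antidiagonalIntegral).aestronglyMeasurable
  · rw [norm_mul, norm_exp_neg_I_mul, one_mul]

open FourierTransform in
theorem SchwartzMap.integral_exp_quadrantDiagonal (x : ℝ) :
    (2 * Real.pi : ℂ)⁻¹ * ∫ ξ : ℝ, Complex.exp (Complex.I * x * ξ) * quadrantDiagonal f ξ =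
      antidiagonalIntegral f x := by
  have h1 : 𝓕 (antidiagonalIntegral f) = fun w => quadrantDiagonal f (2 * Real.pi * w) :=
    funext f.fourier_antidiagonalIntegral
  have h2 : Integrable (𝓕 (antidiagonalIntegral f)) := by
    rw [h1]
    exact f.integrable_quadrantDiagonal.comp_mul_left' (by positivity)
  have h3 := f.integrable_antidiagonalIntegral.fourierInv_fourier_eq h2
    (v := x) f.continuous_antidiagonalIntegral.continuousAt
  rw [← h3, Real.fourierInv_eq', h1]
  have h4 := Measure.integral_comp_mul_left
    (fun ξ : ℝ => Complex.exp (Complex.I * x * ξ) * quadrantDiagonal f ξ) (2 * Real.pi)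
  have h5 : |(2 * Real.pi)⁻¹| = (2 * Real.pi)⁻¹ := abs_of_pos (by positivity)
  rw [h5, Complex.real_smul] at h4
  push_cast at h4
  rw [← h4]
  refine integral_congr_ae (Eventually.of_forall fun w => ?_)
  simp only [smul_eq_mul]
  congr 2
  simp
  ring

theorem SchwartzMap.piPrime_quadrantDiagonal :
    piPrime (quadrantDiagonal f) = ∫ x in Ici (0 : ℝ), f (x, -x) := by
  have h1 : ∀ x : ℝ, (limUnder (atTop : Filter ℝ) fun R : ℝ => (2 * Real.pi : ℂ)⁻¹ *
      ∫ ξ in (-R)..R, Complex.exp (Complex.I * x * ξ) * quadrantDiagonal f ξ) =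
        antidiagonalIntegral f x := fun x => by
    refine Tendsto.limUnder_eq ?_
    rw [← f.integral_exp_quadrantDiagonal]
    refine Tendsto.const_mul _ (intervalIntegral_tendsto_integral ?_ tendsto_neg_atTop_atBot
      tendsto_id)
    refine f.integrable_quadrantDiagonal.bdd_mul (c := 1) ?_ (Eventually.of_forall fun ξ => ?_)
    · exact (by fun_prop : Continuous fun ξ : ℝ =>
        Complex.exp (Complex.I * x * ξ)).aestronglyMeasurable
    · have := norm_exp_neg_I_mul (-x) ξ
      push_cast at this
      rw [show Complex.I * x * ξ = -(Complex.I * -(x : ℂ) * ξ) by ring]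
      exact this.le
  rw [piPrime]
  simp only [h1]
  rw [← antidiagonalIntegral_zero]
  exact (f.continuous_antidiagonalIntegral.tendsto 0 |>.mono_left nhdsWithin_le_nhds).limUnder_eq

end Green

/-! ### Smooth families of Schwartz functions -/

section SchwartzFamily

universe u

variable {E F : Type u} [NormedAddCommGroup E] [NormedSpace ℝ E] [NormedAddCommGroup F]
  [NormedSpace ℝ F] {F' : Type*} [NormedAddCommGroup F'] [NormedSpace ℝ F']
  {Q : Type*} [NormedAddCommGroup Q] [NormedSpace ℝ Q]

/-- Smooth functions of two variables that are Schwartz functions of the second variable, locally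
uniformly in the first one. -/
structure IsSchwartzFamily (U : Set E) (ψ : E × Q → F') : Prop where
  smooth : ContDiffOn ℝ ∞ ψ (U ×ˢ univ)
  decay : ∀ K : Set E, IsCompact K → K ⊆ U → ∀ i j : ℕ, ∃ C : ℝ, ∀ y ∈ K, ∀ x : Q,
    (1 + ‖x‖) ^ j * ‖iteratedFDeriv ℝ i ψ (y, x)‖ ≤ C

/-- The partial derivative with respect to the first variable. -/
def partialFst (ψ : E × Q → F') (z : E × Q) : E →L[ℝ] F' :=
  (fderiv ℝ ψ z).comp (ContinuousLinearMap.inl ℝ E Q)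

variable {U : Set E} {ψ : E × Q → F}

theorem IsSchwartzFamily.congr {ψ₁ ψ₂ : E × Q → F'} (h : IsSchwartzFamily U ψ₁) (hU : IsOpen U)
    (heq : ∀ y ∈ U, ∀ x, ψ₂ (y, x) = ψ₁ (y, x)) : IsSchwartzFamily U ψ₂ := by
  have hO : IsOpen (U ×ˢ (univ : Set Q)) := hU.prod isOpen_univ
  refine ⟨h.smooth.congr fun z hz => heq z.1 hz.1 z.2, fun K hK hKU i j => ?_⟩
  obtain ⟨C, hC⟩ := h.decay K hK hKU i j
  refine ⟨C, fun y hy x => ?_⟩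
  have h1 : ψ₂ =ᶠ[𝓝 (y, x)] ψ₁ := by
    filter_upwards [hO.mem_nhds ⟨hKU hy, mem_univ _⟩] with z hz using heq z.1 hz.1 z.2
  rw [(h1.iteratedFDeriv ℝ i).eq_of_nhds]
  exact hC y hy x

theorem IsSchwartzFamily.contDiffAt {ψ : E × Q → F'} (h : IsSchwartzFamily U ψ) (hU : IsOpen U)
    {y : E} (hy : y ∈ U) (x : Q) : ContDiffAt ℝ ∞ ψ (y, x) :=
  h.smooth.contDiffAt ((hU.prod isOpen_univ).mem_nhds ⟨hy, mem_univ _⟩)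

theorem IsSchwartzFamily.clm_fderiv (h : IsSchwartzFamily U ψ) (hU : IsOpen U)
    (L : (E × Q →L[ℝ] F) →L[ℝ] F') : IsSchwartzFamily U fun z => L (fderiv ℝ ψ z) := by
  refine ⟨L.contDiff.comp_contDiffOn (h.smooth.fderiv_of_isOpen (hU.prod isOpen_univ) (by simp)),
    fun K hK hKU i j => ?_⟩
  obtain ⟨C, hC⟩ := h.decay K hK hKU (i + 1) j
  obtain ⟨c, hc0, hc⟩ := L.exists_norm_iteratedFDerivWithin_comp_fderivWithin_le
  refine ⟨c * C, fun y hy x => ?_⟩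
  have h1 := hc ψ univ (y, x) (h.contDiffAt hU (hKU hy) x).contDiffWithinAt uniqueDiffOn_univ
    (mem_univ _) i
  simp only [fderivWithin_univ, iteratedFDerivWithin_univ] at h1
  calc _ ≤ (1 + ‖x‖) ^ j * (c * ‖iteratedFDeriv ℝ (i + 1) ψ (y, x)‖) := by gcongr
    _ = c * ((1 + ‖x‖) ^ j * ‖iteratedFDeriv ℝ (i + 1) ψ (y, x)‖) := by ring
    _ ≤ c * C := by gcongr; exact hC y hy x

/-- Restriction of linear maps to the first factor. -/
def restrictFstCLM (E F Q : Type*) [NormedAddCommGroup E] [NormedSpace ℝ E] [NormedAddCommGroup F]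
    [NormedSpace ℝ F] [NormedAddCommGroup Q] [NormedSpace ℝ Q] :
    (E × Q →L[ℝ] F) →L[ℝ] (E →L[ℝ] F) :=
  (ContinuousLinearMap.inl ℝ E Q).precomp F

theorem IsSchwartzFamily.partialFst (h : IsSchwartzFamily U ψ) (hU : IsOpen U) :
    IsSchwartzFamily U (partialFst ψ) :=
  h.clm_fderiv hU (restrictFstCLM E F Q)

theorem exists_norm_iteratedFDeriv_partialFst_le (E F Q : Type*) [NormedAddCommGroup E]
    [NormedSpace ℝ E] [NormedAddCommGroup F] [NormedSpace ℝ F] [NormedAddCommGroup Q]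
    [NormedSpace ℝ Q] : ∃ c : ℝ, 0 ≤ c ∧
    ∀ (ψ : E × Q → F) z, ContDiffAt ℝ ∞ ψ z → ∀ i : ℕ,
      ‖iteratedFDeriv ℝ i (_root_.partialFst ψ) z‖ ≤ c * ‖iteratedFDeriv ℝ (i + 1) ψ z‖ := by
  obtain ⟨c, hc0, hc⟩ :=
    (restrictFstCLM E F Q).exists_norm_iteratedFDerivWithin_comp_fderivWithin_le
  refine ⟨c, hc0, fun ψ z hz i => ?_⟩
  have h1 := hc ψ univ z hz.contDiffWithinAt uniqueDiffOn_univ (mem_univ _) i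
  simp only [fderivWithin_univ, iteratedFDerivWithin_univ] at h1
  exact h1

theorem IsSchwartzFamily.hasFDerivAt {ψ : E × Q → F'} (h : IsSchwartzFamily U ψ) (hU : IsOpen U)
    {y : E} (hy : y ∈ U) (x : Q) :
    HasFDerivAt (fun y => ψ (y, x)) (_root_.partialFst ψ (y, x)) y := by
  have h1 := ((h.contDiffAt hU hy x).differentiableAt (by simp)).hasFDerivAt
  exact h1.comp y (hasFDerivAt_prodMk_left y x)

theorem IsSchwartzFamily.continuous_slice {ψ : E × Q → F'} (h : IsSchwartzFamily U ψ) {y : E}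
    (hy : y ∈ U) : Continuous fun x => ψ (y, x) :=
  continuousOn_univ.1 (h.smooth.continuousOn.comp (Continuous.prodMk_right y).continuousOn
    fun x _ => ⟨hy, mem_univ x⟩)

/-- The values at a parameter are Schwartz functions. -/
theorem IsSchwartzFamily.exists_schwartzMap {ψ : E × Q → F'} (h : IsSchwartzFamily U ψ)
    (hU : IsOpen U) {y : E} (hy : y ∈ U) {F'' : Type*} [NormedAddCommGroup F''] [NormedSpace ℝ F'']
    (L : F' →L[ℝ] F'') : ∃ f : SchwartzMap Q F'', ∀ x, f x = L (ψ (y, x)) := by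
  set ψ₀ : E × Q → F' := fun z => ψ ((y, 0) + z)
  set s : Set (E × Q) := {z | y + z.1 ∈ U}
  have hs : IsOpen s := hU.preimage (by fun_prop)
  have hψ₀ : ContDiffOn ℝ ∞ ψ₀ s :=
    h.smooth.comp (contDiff_const.add contDiff_id).contDiffOn fun z hz => ⟨hz, mem_univ _⟩
  have hpre : (ContinuousLinearMap.inr ℝ E Q) ⁻¹' s = univ := by
    ext x; simp [s, hy]
  have heq : ∀ x, ψ (y, x) = ψ₀ (ContinuousLinearMap.inr ℝ E Q x) := fun x => by simp [ψ₀]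
  have hslice : ContDiff ℝ ∞ fun x => ψ (y, x) := by
    rw [← contDiffOn_univ]
    exact h.smooth.comp (contDiff_prodMk_right y).contDiffOn fun x _ => ⟨hy, mem_univ x⟩
  have hnorm : ∀ i x, ‖iteratedFDeriv ℝ i (fun x => ψ (y, x)) x‖ ≤
      ‖iteratedFDeriv ℝ i ψ (y, x)‖ * ∏ _j : Fin i, ‖ContinuousLinearMap.inr ℝ E Q‖ := by
    intro i x
    have hx : ContinuousLinearMap.inr ℝ E Q x ∈ s := by simp [s, hy]
    have h1 := (ContinuousLinearMap.inr ℝ E Q).iteratedFDerivWithin_comp_right hψ₀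
      hs.uniqueDiffOn (by rw [hpre]; exact uniqueDiffOn_univ) hx (i := i) (by exact_mod_cast le_top)
    rw [hpre, iteratedFDerivWithin_univ, iteratedFDerivWithin_of_isOpen i hs hx,
      iteratedFDeriv_comp_add_left] at h1
    have h2 : (y, (0 : Q)) + ContinuousLinearMap.inr ℝ E Q x = (y, x) := by simp
    rw [h2] at h1
    have h3 : (fun x => ψ (y, x)) = ψ₀ ∘ ContinuousLinearMap.inr ℝ E Q := funext heq
    rw [h3, h1]
    exact ContinuousMultilinearMap.norm_compContinuousLinearMap_le _ _
  refine ⟨⟨fun x => L (ψ (y, x)), L.contDiff.comp hslice, fun j i => ?_⟩, fun x => rfl⟩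
  obtain ⟨C, hC⟩ := h.decay {y} isCompact_singleton (singleton_subset_iff.2 hy) i j
  set c := ∏ _j : Fin i, ‖ContinuousLinearMap.inr ℝ E Q‖
  refine ⟨‖L‖ * (C * c), fun x => ?_⟩
  have h1 : ‖iteratedFDeriv ℝ i (fun x => L (ψ (y, x))) x‖ ≤
      ‖L‖ * ‖iteratedFDeriv ℝ i (fun x => ψ (y, x)) x‖ :=
    L.norm_iteratedFDeriv_comp_left hslice.contDiffAt (by exact_mod_cast le_top)
  calc _ ≤ (1 + ‖x‖) ^ j * (‖L‖ * (‖iteratedFDeriv ℝ i ψ (y, x)‖ * c)) := by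
        refine mul_le_mul (pow_le_pow_left₀ (norm_nonneg _) (by linarith) j)
          (h1.trans (mul_le_mul_of_nonneg_left (hnorm i x) (norm_nonneg L))) (norm_nonneg _)
          (by positivity)
    _ = ‖L‖ * (((1 + ‖x‖) ^ j * ‖iteratedFDeriv ℝ i ψ (y, x)‖) * c) := by ring
    _ ≤ _ := by
      refine mul_le_mul_of_nonneg_left (mul_le_mul_of_nonneg_right ?_ ?_) (norm_nonneg L)
      · exact hC y rfl x
      · exact Finset.prod_nonneg fun _ _ => norm_nonneg _

variable [MeasurableSpace Q] [BorelSpace Q] [SecondCountableTopology Q] {ν : Measure Q}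
  (hν : Integrable (fun x : Q => ((1 + ‖x‖) ^ 3)⁻¹) ν)
  {𝕜 : Type*} [NormedField 𝕜] [NormedSpace 𝕜 F] [SMulCommClass ℝ 𝕜 F] {e : Q → 𝕜}
  (he : Continuous e) (he1 : ∀ x, ‖e x‖ ≤ 1)

omit [SMulCommClass ℝ 𝕜 F] in
include hν he he1 in
theorem IsSchwartzFamily.integrable (h : IsSchwartzFamily U ψ) {y : E} (hy : y ∈ U) :
    Integrable (fun x => e x • ψ (y, x)) ν := by
  obtain ⟨C, hC⟩ := h.decay {y} isCompact_singleton (singleton_subset_iff.2 hy) 0 3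
  refine Integrable.mono' (hν.const_mul C) (he.smul (h.continuous_slice hy)).aestronglyMeasurable
    (Eventually.of_forall fun x => ?_)
  have h1 := hC y rfl x
  rw [norm_iteratedFDeriv_zero] at h1
  rw [norm_smul, ← div_eq_mul_inv, le_div_iff₀' (by positivity)]
  refine le_trans ?_ h1
  gcongr
  exact mul_le_of_le_one_left (norm_nonneg _) (he1 x)

include hν he he1 in
/-- Differentiation of a family of Schwartz functions under the integral. -/
theorem IsSchwartzFamily.hasFDerivAt_integral [ProperSpace E] (h : IsSchwartzFamily U ψ)
    (hU : IsOpen U) {y : E} (hy : y ∈ U) :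
    Integrable (fun x => e x • _root_.partialFst ψ (y, x)) ν ∧
    HasFDerivAt (fun y => ∫ x, e x • ψ (y, x) ∂ν) (∫ x, e x • _root_.partialFst ψ (y, x) ∂ν) y := by
  have h' := h.partialFst hU
  have hint := h'.integrable hν he he1 hy
  refine ⟨hint, ?_⟩
  obtain ⟨r, hr, hrU⟩ := Metric.nhds_basis_closedBall.mem_iff.1 (hU.mem_nhds hy)
  obtain ⟨C, hC⟩ := h'.decay _ (isCompact_closedBall y r) hrU 0 3
  refine hasFDerivAt_integral_of_dominated_of_fderiv_le
    (F' := fun y x => e x • _root_.partialFst ψ (y, x))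
    (bound := fun x => C * ((1 + ‖x‖) ^ 3)⁻¹) (Metric.closedBall_mem_nhds y hr) ?_
    (h.integrable hν he he1 hy) hint.aestronglyMeasurable
    (Eventually.of_forall fun x z hz => ?_) (hν.const_mul C)
    (Eventually.of_forall fun x z hz => (h.hasFDerivAt hU (hrU hz) x).const_smul _)
  · filter_upwards [hU.mem_nhds hy] with z hz
    exact (h.integrable hν he he1 hz).aestronglyMeasurable
  · have h1 := hC z hz x
    rw [norm_iteratedFDeriv_zero] at h1
    rw [norm_smul, ← div_eq_mul_inv, le_div_iff₀' (by positivity)]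
    refine le_trans ?_ h1
    gcongr
    exact mul_le_of_le_one_left (norm_nonneg _) (he1 x)

include hν in
theorem IsSchwartzFamily.hasFDerivAt_integral_one [ProperSpace E] (h : IsSchwartzFamily U ψ)
    (hU : IsOpen U) {y : E} (hy : y ∈ U) :
    HasFDerivAt (fun y => ∫ x, ψ (y, x) ∂ν) (∫ x, _root_.partialFst ψ (y, x) ∂ν) y := by
  have := (h.hasFDerivAt_integral hν (e := fun _ => (1 : ℝ)) continuous_const (by simp) hU hy).2
  simpa only [one_smul] using this

include hν in
theorem IsSchwartzFamily.contDiffOn_integral [ProperSpace E] (h : IsSchwartzFamily U ψ)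
    (hU : IsOpen U) (n : ℕ) : ContDiffOn ℝ n (fun y => ∫ x, ψ (y, x) ∂ν) U := by
  induction n generalizing F with
  | zero =>
    exact contDiffOn_zero.2 fun y hy =>
      (h.hasFDerivAt_integral_one hν hU hy).continuousAt.continuousWithinAt
  | succ n ih =>
    have key := (contDiffOn_succ_iff_fderiv_of_isOpen (n := n) hU).2
      ⟨fun y hy => (h.hasFDerivAt_integral_one hν hU hy).differentiableAt.differentiableWithinAt,
        fun h => by simp at h, (ih (h.partialFst hU)).congr
          fun y hy => (h.hasFDerivAt_integral_one hν hU hy).fderiv⟩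
    exact_mod_cast key

variable (F ν) in
theorem exists_norm_iteratedFDeriv_integral_le [ProperSpace E] (hU : IsOpen U) (i : ℕ)
    (hν : Integrable (fun x : Q => ((1 + ‖x‖) ^ 3)⁻¹) ν) :
    ∃ c : ℝ, 0 ≤ c ∧ ∀ ψ : E × Q → F, IsSchwartzFamily U ψ → ∀ y ∈ U, ∀ B : ℝ,
      (∀ x, (1 + ‖x‖) ^ 3 * ‖iteratedFDeriv ℝ i ψ (y, x)‖ ≤ B) →
        ‖iteratedFDeriv ℝ i (fun y => ∫ x, ψ (y, x) ∂ν) y‖ ≤ c * B := by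
  induction i generalizing F with
  | zero =>
    refine ⟨∫ x, ((1 + ‖x‖) ^ 3)⁻¹ ∂ν, integral_nonneg fun x => by positivity,
      fun ψ h y hy B hB => ?_⟩
    rw [norm_iteratedFDeriv_zero, ← integral_mul_const]
    refine norm_integral_le_of_norm_le (hν.mul_const B) (Eventually.of_forall fun x => ?_)
    have h1 := hB x
    rw [norm_iteratedFDeriv_zero] at h1
    rwa [mul_comm, ← div_eq_mul_inv, le_div_iff₀' (by positivity)]
  | succ i ih =>
    obtain ⟨c, hc0, hc⟩ := ih (E →L[ℝ] F)
    obtain ⟨c', hc0', hc'⟩ := exists_norm_iteratedFDeriv_partialFst_le E F Q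
    refine ⟨c * c', by positivity, fun ψ h y hy B hB => ?_⟩
    have h1 : fderiv ℝ (fun y => ∫ x, ψ (y, x) ∂ν) =ᶠ[𝓝 y]
        fun y => ∫ x, _root_.partialFst ψ (y, x) ∂ν := by
      filter_upwards [hU.mem_nhds hy] with z hz
      exact (h.hasFDerivAt_integral_one hν hU hz).fderiv
    rw [← norm_iteratedFDeriv_fderiv, (h1.iteratedFDeriv ℝ i).eq_of_nhds, mul_assoc]
    refine hc _ (h.partialFst hU) y hy _ fun x => ?_
    calc _ ≤ (1 + ‖x‖) ^ 3 * (c' * ‖iteratedFDeriv ℝ (i + 1) ψ (y, x)‖) := by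
          gcongr
          exact hc' ψ _ (h.contDiffAt hU hy x) i
      _ = c' * ((1 + ‖x‖) ^ 3 * ‖iteratedFDeriv ℝ (i + 1) ψ (y, x)‖) := by ring
      _ ≤ _ := by gcongr; exact hB x

end SchwartzFamily

/-! ### Integrals of families of forms -/

section SchwartzForm

universe u v

variable {E : Type u} [NormedAddCommGroup E] [NormedSpace ℝ E]
  {H : Type*} [TopologicalSpace H] {J : ModelWithCorners ℝ E H} [J.Boundaryless]
  {N : Type*} [TopologicalSpace N] [ChartedSpace H N] {k : ℕ}
  {Q : Type*} [NormedAddCommGroup Q] [NormedSpace ℝ Q]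

omit [J.Boundaryless] in
/-- The expression in a chart of a family of forms. -/
def DiffForm.familyRep (φ : Q → DiffForm J N k) (p₀ : N) (z : E × Q) : E [⋀^Fin k]→L[ℝ] ℂ :=
  (φ z.2).localRep p₀ z.1

/-- Smooth forms with values in a Schwartz space. -/
def IsSchwartzForm (φ : Q → DiffForm J N k) : Prop :=
  ∀ p₀ : N, IsSchwartzFamily (extChartAt J p₀).target (DiffForm.familyRep φ p₀)

variable {Γ : Type v} [Group Γ] {S : Finset Γ}

theorem IsCrossedSchwartz.isSchwartzForm {φ : Γ → Q → DiffForm J N k}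
    (hφ : IsCrossedSchwartz S φ) (γ : Γ) : IsSchwartzForm (φ γ) := by
  refine fun p₀ => ⟨hφ.smooth γ p₀, fun K hK hKU i j => ?_⟩
  obtain ⟨C, hC⟩ := hφ.rapid_decay p₀ K hK hKU i j 0
  refine ⟨C, fun y hy x => ?_⟩
  have h := hC γ y hy x
  rw [J.range_eq_univ, univ_prod_univ, iteratedFDerivWithin_univ, pow_zero, mul_one] at h
  exact h

variable {φ : Q → DiffForm J N k}

omit [J.Boundaryless] in
theorem IsSchwartzForm.isSmooth (hφ : IsSchwartzForm φ) (x : Q) : (φ x).IsSmooth := fun p₀ =>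
  (hφ p₀).smooth.comp (contDiff_prodMk_left x).contDiffOn fun _ hy => ⟨hy, mem_univ x⟩

variable [IsManifold J ∞ N]

theorem IsSchwartzForm.exists_schwartzMap (hφ : IsSchwartzForm φ) (p : N) (v : Fin k → E) :
    ∃ f : SchwartzMap Q ℂ, ∀ x, f x = (φ x).modelForm p v := by
  obtain ⟨f, hf⟩ := (hφ p).exists_schwartzMap (isOpen_extChartAt_target p)
    (mem_extChartAt_target p) (ContinuousAlternatingMap.apply ℝ E ℂ v)
  refine ⟨f, fun x => ?_⟩
  rw [hf, DiffForm.familyRep, DiffForm.localRep_self]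
  rfl

theorem IsSchwartzForm.localRep_extD (hφ : IsSchwartzForm φ) {p₀ : N} {y : E}
    (hy : y ∈ (extChartAt J p₀).target) (x : Q) : (φ x).extD.localRep p₀ y =
      ContinuousAlternatingMap.alternatizeUncurryFin
        (partialFst (DiffForm.familyRep φ p₀) (y, x)) := by
  rw [DiffForm.localRep_extD (hφ.isSmooth x) hy, J.range_eq_univ, extDerivWithin_univ, extDeriv,
    ← ((hφ p₀).hasFDerivAt (isOpen_extChartAt_target p₀) hy x).fderiv]
  rfl

theorem IsSchwartzForm.extD (hφ : IsSchwartzForm φ) : IsSchwartzForm fun x => (φ x).extD :=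
  fun p₀ => ((hφ p₀).clm_fderiv (isOpen_extChartAt_target p₀)
    ((ContinuousAlternatingMap.alternatizeUncurryFinCLM ℝ E ℂ (n := k)).comp
      (restrictFstCLM E (E [⋀^Fin k]→L[ℝ] ℂ) Q))).congr (isOpen_extChartAt_target p₀)
      fun _ hy x => hφ.localRep_extD hy x

/-- The integral of a family of forms, with a weight. -/
def DiffForm.integral [MeasurableSpace Q] {𝕜 : Type*} [NormedField 𝕜] [NormedSpace 𝕜 ℂ]
    [SMulCommClass ℝ 𝕜 ℂ] (e : Q → 𝕜) (ν : Measure Q) (φ : Q → DiffForm J N k) : DiffForm J N k :=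
  fun p => (∫ x, e x • (φ x).modelForm p ∂ν : E [⋀^Fin k]→L[ℝ] ℂ)

variable [MeasurableSpace Q] [BorelSpace Q] [SecondCountableTopology Q] {ν : Measure Q}
  (hν : Integrable (fun x : Q => ((1 + ‖x‖) ^ 3)⁻¹) ν)
  {𝕜 : Type*} [NormedField 𝕜] [NormedSpace 𝕜 ℂ] [SMulCommClass ℝ 𝕜 ℂ] {e : Q → 𝕜}
  (he : Continuous e) (he1 : ∀ x, ‖e x‖ ≤ 1)

include hν he he1

omit [J.Boundaryless] in
theorem IsSchwartzForm.integrable_modelForm (hφ : IsSchwartzForm φ) (p : N) :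
    Integrable (fun x => e x • (φ x).modelForm p) ν := by
  have h := (hφ p).integrable hν he he1 (mem_extChartAt_target p)
  simpa only [DiffForm.familyRep, DiffForm.localRep_self] using h

omit [J.Boundaryless] in
theorem IsSchwartzForm.localRep_integral (hφ : IsSchwartzForm φ) (p₀ : N) (y : E) :
    (DiffForm.integral e ν φ).localRep p₀ y =
      ∫ x, e x • DiffForm.familyRep φ p₀ (y, x) ∂ν := by
  rw [DiffForm.localRep_eq]
  exact ((ContinuousAlternatingMap.compContinuousLinearMapCLM
    (chartSymmDeriv J p₀ y)).integral_comp_comm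
    (hφ.integrable_modelForm hν he he1 _)).symm

omit [J.Boundaryless] in
theorem IsSchwartzForm.integral_apply (hφ : IsSchwartzForm φ) (p : N) (v : Fin k → E) :
    (DiffForm.integral e ν φ).modelForm p v = ∫ x, e x • (φ x).modelForm p v ∂ν :=
  ((ContinuousAlternatingMap.apply ℝ E ℂ v).integral_comp_comm
    (hφ.integrable_modelForm hν he he1 p)).symm

theorem IsSchwartzForm.extD_integral [ProperSpace E] (hφ : IsSchwartzForm φ) :
    (DiffForm.integral e ν φ).extD = DiffForm.integral e ν fun x => (φ x).extD := by
  funext p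
  change (DiffForm.integral e ν φ).extD.modelForm p = ∫ x, e x • (φ x).extD.modelForm p ∂ν
  have hy := mem_extChartAt_target (I := J) p
  obtain ⟨h1, h2⟩ := (hφ p).hasFDerivAt_integral hν he he1 (isOpen_extChartAt_target p) hy
  rw [DiffForm.modelForm_extD, J.range_eq_univ, extDerivWithin_univ, extDeriv,
    funext (hφ.localRep_integral hν he he1 p), h2.fderiv, ← integral_alternatizeUncurryFin h1]
  refine integral_congr_ae (Eventually.of_forall fun x => ?_)
  beta_reduce
  rw [ContinuousAlternatingMap.alternatizeUncurryFin_smul, ← hφ.localRep_extD hy,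
    DiffForm.localRep_self]

end SchwartzForm

section CrossedIntegral

universe u v

variable {E : Type u} [NormedAddCommGroup E] [NormedSpace ℝ E] [ProperSpace E]
  {H : Type*} [TopologicalSpace H] {J : ModelWithCorners ℝ E H} [J.Boundaryless]
  {N : Type*} [TopologicalSpace N] [ChartedSpace H N] [IsManifold J ∞ N] {k : ℕ}
  {Q : Type*} [NormedAddCommGroup Q] [NormedSpace ℝ Q]
  [MeasurableSpace Q] [BorelSpace Q] [SecondCountableTopology Q] {ν : Measure Q}
  {Γ : Type v} [Group Γ] {S : Finset Γ}

theorem IsCrossedSchwartz.isRapidlyDecreasing_integral {φ : Γ → Q → DiffForm J N k}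
    (hφ : IsCrossedSchwartz S φ) (hν : Integrable (fun x : Q => ((1 + ‖x‖) ^ 3)⁻¹) ν) :
    IsRapidlyDecreasing S fun γ => DiffForm.integral (fun _ => (1 : ℝ)) ν (φ γ) := by
  have hrep : ∀ γ p₀, (DiffForm.integral (fun _ => (1 : ℝ)) ν (φ γ)).localRep p₀ =
      fun y => ∫ x, DiffForm.familyRep (φ γ) p₀ (y, x) ∂ν := fun γ p₀ => funext fun y => by
    rw [(hφ.isSchwartzForm γ).localRep_integral hν continuous_const (by simp)]
    simp only [one_smul]
  refine ⟨fun γ p₀ => ?_, fun p₀ K hK hKt i n => ?_⟩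
  · rw [hrep, contDiffOn_infty]
    exact fun m => (hφ.isSchwartzForm γ p₀).contDiffOn_integral hν (isOpen_extChartAt_target p₀) m
  · obtain ⟨c, hc0, hc⟩ := exists_norm_iteratedFDeriv_integral_le (E [⋀^Fin k]→L[ℝ] ℂ) ν
      (isOpen_extChartAt_target (I := J) p₀) i hν
    obtain ⟨C, hC⟩ := hφ.rapid_decay p₀ K hK hKt i 3 n
    refine ⟨c * C, fun γ y hy => ?_⟩
    have hpos : (0 : ℝ) < (1 + (wordLength S γ : ℝ)) ^ n := by positivity
    rw [J.range_eq_univ, iteratedFDerivWithin_univ, hrep]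
    have h := hc _ (hφ.isSchwartzForm γ p₀) y (hKt hy) (C / (1 + (wordLength S γ : ℝ)) ^ n)
      fun x => by
        have h1 := hC γ y hy x
        rw [J.range_eq_univ, univ_prod_univ, iteratedFDerivWithin_univ] at h1
        rw [le_div_iff₀ hpos]
        exact h1
    rw [← mul_div_assoc, le_div_iff₀ hpos] at h
    exact h

omit [ProperSpace E] [J.Boundaryless] [IsManifold J ∞ N] in
theorem IsRapidlyDecreasing.add {θ₁ θ₂ : Γ → DiffForm J N k} (h₁ : IsRapidlyDecreasing S θ₁)
    (h₂ : IsRapidlyDecreasing S θ₂) : IsRapidlyDecreasing S fun γ => θ₁ γ + θ₂ γ := by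
  have hrep : ∀ γ p₀, (θ₁ γ + θ₂ γ).localRep p₀ = (θ₁ γ).localRep p₀ + (θ₂ γ).localRep p₀ :=
    fun γ p₀ => rfl
  refine ⟨fun γ p₀ => ?_, fun p₀ K hK hKt i n => ?_⟩
  · rw [hrep]
    exact (h₁.smooth γ p₀).add (h₂.smooth γ p₀)
  · obtain ⟨C₁, hC₁⟩ := h₁.rapid_decay p₀ K hK hKt i n
    obtain ⟨C₂, hC₂⟩ := h₂.rapid_decay p₀ K hK hKt i n
    refine ⟨C₁ + C₂, fun γ y hy => ?_⟩
    have hyt := hKt hy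
    rw [hrep, iteratedFDerivWithin_add_apply
      (((h₁.smooth γ).contDiffWithinAt hyt).of_le (by exact_mod_cast le_top))
      (((h₂.smooth γ).contDiffWithinAt hyt).of_le (by exact_mod_cast le_top))
      J.uniqueDiffOn (extChartAt_target_subset_range p₀ hyt)]
    refine (mul_le_mul_of_nonneg_right (norm_add_le _ _) (by positivity)).trans ?_
    rw [add_mul]
    exact add_le_add (hC₁ γ y hy) (hC₂ γ y hy)

omit [ProperSpace E] [J.Boundaryless] in
theorem DiffForm.extD_add {θ₁ θ₂ : DiffForm J N k} (h₁ : θ₁.IsSmooth) (h₂ : θ₂.IsSmooth) :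
    (θ₁ + θ₂).extD = θ₁.extD + θ₂.extD := by
  funext p
  change (θ₁ + θ₂).extD.modelForm p = θ₁.extD.modelForm p + θ₂.extD.modelForm p
  have hrep : (θ₁ + θ₂).localRep p = θ₁.localRep p + θ₂.localRep p := rfl
  have hy := mem_extChartAt_target (I := J) p
  rw [modelForm_extD, modelForm_extD, modelForm_extD, hrep]
  exact extDerivWithin_add (J.uniqueDiffOn _ (extChartAt_target_subset_range p hy))
    ((h₁.contDiffWithinAt hy).differentiableWithinAt (by simp))
    ((h₂.contDiffWithinAt hy).differentiableWithinAt (by simp))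

end CrossedIntegral

/-! ### The trace of a boundary form -/

section Boundary

universe u v

/-- The Lebesgue measure of the half-line `{(x, -x) : x ≥ 0}`. -/
def antidiagonalMeasure : Measure (ℝ × ℝ) :=
  (volume.restrict (Ici (0 : ℝ))).map fun x => (x, -x)

theorem integral_antidiagonalMeasure {F : Type*} [NormedAddCommGroup F] [NormedSpace ℝ F]
    {f : ℝ × ℝ → F} (hf : Continuous f) [SecondCountableTopology F] [MeasurableSpace F]
    [BorelSpace F] :
    ∫ z, f z ∂antidiagonalMeasure = ∫ x in Ici (0 : ℝ), f (x, -x) :=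
  integral_map (by fun_prop : Measurable fun x : ℝ => (x, -x)).aemeasurable
    hf.aestronglyMeasurable

theorem integrable_antidiagonalMeasure :
    Integrable (fun x : ℝ × ℝ => ((1 + ‖x‖) ^ 3)⁻¹) antidiagonalMeasure := by
  have hc : Continuous fun x : ℝ × ℝ => ((1 + ‖x‖) ^ 3)⁻¹ :=
    (by fun_prop : Continuous fun x : ℝ × ℝ => (1 + ‖x‖) ^ 3).inv₀ fun x => by positivity
  have hm : Measurable fun x : ℝ => (x, -x) := by fun_prop
  rw [antidiagonalMeasure, integrable_map_measure hc.aestronglyMeasurable hm.aemeasurable]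
  refine Integrable.mono' integrable_inv_one_add_sq.integrableOn
    (hc.comp (by fun_prop)).aestronglyMeasurable (Eventually.of_forall fun x => ?_)
  have h : ‖((x, -x) : ℝ × ℝ)‖ = |x| := by simp [Prod.norm_def]
  rw [Function.comp_apply, h, Real.norm_of_nonneg (by positivity)]
  refine inv_anti₀ (by positivity) ?_
  nlinarith [sq_abs x, abs_nonneg x, pow_nonneg (abs_nonneg x) 3]

theorem integrable_quadrant : Integrable (fun x : ℝ × ℝ => ((1 + ‖x‖) ^ 3)⁻¹)
    (volume.restrict ((Ici (0 : ℝ)) ×ˢ (Iic (0 : ℝ)))) := by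
  have h := integrable_one_add_norm (E := ℝ × ℝ) (μ := volume) (r := 3) (by simp; norm_num)
  refine (h.congr (Eventually.of_forall fun x => ?_)).integrableOn
  beta_reduce
  rw [Real.rpow_neg (by positivity)]
  norm_cast

/-- The kernel of the Fourier transform on the plane. -/
def fourierKernel (ξ η : ℝ) (x : ℝ × ℝ) : ℂ :=
  Complex.exp (-(Complex.I * (x.1 * ξ + x.2 * η)))

theorem continuous_fourierKernel (ξ η : ℝ) : Continuous (fourierKernel ξ η) := by
  unfold fourierKernel
  fun_prop

theorem norm_fourierKernel (ξ η : ℝ) (x : ℝ × ℝ) : ‖fourierKernel ξ η x‖ = 1 := by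
  have h := norm_exp_neg_I_mul (x.1 * ξ + x.2 * η) 1
  push_cast at h
  rwa [mul_one] at h

variable {E : Type u} [NormedAddCommGroup E] [NormedSpace ℝ E] [ProperSpace E]
  {H : Type*} [TopologicalSpace H] {J : ModelWithCorners ℝ E H} [J.Boundaryless]
  {N : Type*} [TopologicalSpace N] [ChartedSpace H N] [IsManifold J ∞ N] {k : ℕ}

/-- The trace of the coefficients of a boundary form, in terms of the function on the quadrant
that defines its Green part. -/
def traceForm (φ : ℝ × ℝ → DiffForm J N k) (q : DiffForm J N k) : DiffForm J N k :=
  DiffForm.integral (fun _ => (1 : ℝ)) antidiagonalMeasure φ + q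

omit [ProperSpace E] in
theorem IsSchwartzForm.piPrime_integral {φ : ℝ × ℝ → DiffForm J N k} (hφ : IsSchwartzForm φ)
    (p : N) (v : Fin k → E) :
    piPrime (fun η => (DiffForm.integral (fourierKernel η η)
      (volume.restrict ((Ici (0 : ℝ)) ×ˢ (Iic (0 : ℝ)))) φ).modelForm p v) =
      (DiffForm.integral (fun _ => (1 : ℝ)) antidiagonalMeasure φ).modelForm p v := by
  obtain ⟨f, hf⟩ := hφ.exists_schwartzMap p v
  rw [hφ.integral_apply integrable_antidiagonalMeasure continuous_const (by simp)]
  have h1 : (fun η => (DiffForm.integral (fourierKernel η η)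
      (volume.restrict ((Ici (0 : ℝ)) ×ˢ (Iic (0 : ℝ)))) φ).modelForm p v) =
      quadrantDiagonal f := funext fun η => by
    rw [hφ.integral_apply integrable_quadrant (continuous_fourierKernel η η)
      fun x => (norm_fourierKernel η η x).le]
    simp only [← hf]
    rfl
  rw [h1, f.piPrime_quadrantDiagonal]
  simp only [← hf, one_smul]
  rw [integral_antidiagonalMeasure f.continuous]

omit [ProperSpace E] in
theorem BoundaryForm.regTrace_eval {θ : BoundaryForm J N k} {φ : ℝ × ℝ → DiffForm J N k}
    (hφ : IsSchwartzForm φ) (hg : ∀ ξ η, θ.g ξ η = DiffForm.integral (fourierKernel ξ η)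
      (volume.restrict ((Ici (0 : ℝ)) ×ˢ (Iic (0 : ℝ)))) φ)
    (p : N) (v : Fin k → E) : (θ.eval p v).regTrace = (traceForm φ θ.q).modelForm p v := by
  have h := hφ.piPrime_integral p v
  simp only [← hg] at h
  exact congrArg (· + θ.q.modelForm p v) h

theorem BoundaryForm.extD_g {θ : BoundaryForm J N k} {φ : ℝ × ℝ → DiffForm J N k}
    (hφ : IsSchwartzForm φ) (hg : ∀ ξ η, θ.g ξ η = DiffForm.integral (fourierKernel ξ η)
      (volume.restrict ((Ici (0 : ℝ)) ×ˢ (Iic (0 : ℝ)))) φ) (ξ η : ℝ) :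
    θ.extD.g ξ η = DiffForm.integral (fourierKernel ξ η)
      (volume.restrict ((Ici (0 : ℝ)) ×ˢ (Iic (0 : ℝ)))) fun x => (φ x).extD := by
  rw [← hφ.extD_integral integrable_quadrant (continuous_fourierKernel ξ η)
    (fun x => (norm_fourierKernel ξ η x).le), ← hg]
  rfl

theorem extD_traceForm {φ : ℝ × ℝ → DiffForm J N k} (hφ : IsSchwartzForm φ)
    (hs : (DiffForm.integral (fun _ => (1 : ℝ)) antidiagonalMeasure φ).IsSmooth)
    {q : DiffForm J N k} (hq : q.IsSmooth) :
    (traceForm φ q).extD = traceForm (fun x => (φ x).extD) q.extD := by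
  rw [traceForm, DiffForm.extD_add hs hq,
    hφ.extD_integral integrable_antidiagonalMeasure continuous_const (by simp)]
  rfl

variable {Γ : Type v} [Group Γ] {S : Finset Γ}

/-- The trace turns boundary forms into forms, compatibly with pullbacks and with exterior
derivatives. -/
theorem IsCrossedBoundaryForm.exists_trace {θ : Γ → BoundaryForm J N k}
    (hθ : IsCrossedBoundaryForm S θ) :
    ∃ σ : Γ → DiffForm J N k, IsRapidlyDecreasing S σ ∧
      (∀ γ p (v : Fin k → E), ((θ γ).eval p v).regTrace = (σ γ).modelForm p v) ∧
      ∀ γ p (v : Fin (k + 1) → E), ((θ γ).extD.eval p v).regTrace = (σ γ).extD.modelForm p v := by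
  obtain ⟨φ, hφ, hg⟩ := hθ.g_mem
  have hS := fun γ => hφ.isSchwartzForm γ
  have hg' : ∀ γ ξ η, (θ γ).g ξ η = DiffForm.integral (fourierKernel ξ η)
      (volume.restrict ((Ici (0 : ℝ)) ×ˢ (Iic (0 : ℝ)))) (φ γ) := fun γ ξ η => by
    funext p
    ext v
    rw [hg γ ξ η p v]
    exact ((hS γ).integral_apply integrable_quadrant (continuous_fourierKernel ξ η)
      (fun x => (norm_fourierKernel ξ η x).le) p v).symm
  have hr := hφ.isRapidlyDecreasing_integral integrable_antidiagonalMeasure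
  refine ⟨fun γ => traceForm (φ γ) (θ γ).q, hr.add hθ.q_mem.isRapidlyDecreasing,
    fun γ p v => (θ γ).regTrace_eval (hS γ) (hg' γ) p v, fun γ p v => ?_⟩
  rw [extD_traceForm (hS γ) (hr.smooth γ) (hθ.q_mem.smooth γ)]
  exact (θ γ).extD.regTrace_eval (hS γ).extD (BoundaryForm.extD_g (hS γ) (hg' γ)) p v

end Boundary

/-! ### The averaged trace of boundary forms -/

section BoundaryTrace

universe u

variable {E : Type u} [NormedAddCommGroup E] [NormedSpace ℝ E]
  {H : Type*} [TopologicalSpace H] {J : ModelWithCorners ℝ E H}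
  {N : Type*} [TopologicalSpace N] [ChartedSpace H N] {k : ℕ}
  {G : Type*} [Group G] [TopologicalSpace G] [IsTopologicalGroup G] [MeasurableSpace G]
  {act : G → N → N} {Γ : Subgroup G} {γ : Γ} {μ : Measure (closureCentralizer γ)}

theorem trRestrict_pullback_pullback {θ : BoundaryForm J N k} {σ : DiffForm J N k}
    (h : ∀ p (v : Fin k → E), (θ.eval p v).regTrace = σ.modelForm p v) (f₁ f₂ f₃ : N → N) :
    ((θ.pullback f₁).pullback f₂).trRestrict f₃ = ((σ.pullback f₁).pullback f₂).restrict f₃ :=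
  funext fun _ => funext fun _ => h _ _

theorem tauXSummand_eq_tauSummand {θ : Γ → BoundaryForm J N k} {σ : Γ → DiffForm J N k}
    (h : ∀ γ p (v : Fin k → E), ((θ γ).eval p v).regTrace = (σ γ).modelForm p v) :
    tauXSummand act γ μ θ = tauSummand act γ μ σ := by
  funext γ' z p v
  simp only [tauXSummand, tauSummand, trRestrict_pullback_pullback (h γ')]

theorem tauX_eq_tau {θ : Γ → BoundaryForm J N k} {σ : Γ → DiffForm J N k}
    (h : ∀ γ p (v : Fin k → E), ((θ γ).eval p v).regTrace = (σ γ).modelForm p v) (z : Γ → G) :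
    tauX act γ μ z θ = tau act γ μ z σ := by
  funext p v
  simp only [tauX, tau, tauXSummand_eq_tauSummand h]

theorem tauXConverges_iff {θ : Γ → BoundaryForm J N k} {σ : Γ → DiffForm J N k}
    (h : ∀ γ p (v : Fin k → E), ((θ γ).eval p v).regTrace = (σ γ).modelForm p v) (z : Γ → G) :
    TauXConverges act γ μ z θ ↔ TauConverges act γ μ z σ := by
  simp only [TauXConverges, TauConverges, tauXSummand_eq_tauSummand h,
    fun γ' => trRestrict_pullback_pullback (h γ')]

end BoundaryTrace

end

theorem mainTheorem5 {m : ℕ} {M X : Type*}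
    -- a smooth compact Riemannian manifold `M` of dimension `m + 1` with boundary `X`
    [TopologicalSpace M] [T2Space M] [CompactSpace M]
    [ChartedSpace (EuclideanHalfSpace (m + 1)) M] [IsManifold (𝓡∂ (m + 1)) ∞ M]
    (g : ContMDiffRiemannianMetric (𝓡∂ (m + 1)) ∞ (EuclideanSpace ℝ (Fin (m + 1)))
      (fun x : M => TangentSpace (𝓡∂ (m + 1)) x))
    [TopologicalSpace X] [ChartedSpace (EuclideanSpace ℝ (Fin m)) X] [IsManifold (𝓡 m) ∞ X]
    (ι : X → M) (hι : IsSmoothEmbedding (𝓡 m) (𝓡∂ (m + 1)) ∞ ι)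
    (hX : range ι = (𝓡∂ (m + 1)).boundary M)
    -- a finitely generated group of polynomial growth of isometries of `M`
    (Γ : Subgroup (IsometryGroup g)) (S : Finset Γ)
    (hS : Subgroup.closure (S : Set Γ) = ⊤) (hΓ : HasPolynomialGrowth S)
    -- an element of the group and a Haar measure on its centralizer in the closure of the group
    (γ : Γ) (μ : Measure (closureCentralizer γ)) [μ.IsHaarMeasure] :
    -- the summands do not depend on the conjugating elements
    (∀ (k : ℕ) (θ : Γ → DiffForm ((𝓡∂ (m + 1)).prod 𝓘(ℝ, EuclideanSpace ℝ (Fin (m + 1)) →L[ℝ] ℝ))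
        (CotangentBundle (𝓡∂ (m + 1)) M) k), IsCrossedForm S θ →
      ∀ (γ' : Γ) (z₁ z₂ : IsometryGroup g), IsConjugator γ γ' z₁ → IsConjugator γ γ' z₂ →
        tauSummand cotangentAction γ μ θ γ' z₁ = tauSummand cotangentAction γ μ θ γ' z₂) ∧
    (∀ (k : ℕ) (θ : Γ → BoundaryForm ((𝓡 m).prod 𝓘(ℝ, EuclideanSpace ℝ (Fin m) →L[ℝ] ℝ))
        (CotangentBundle (𝓡 m) X) k), IsCrossedBoundaryForm S θ →
      ∀ (γ' : Γ) (z₁ z₂ : IsometryGroup g), IsConjugator γ γ' z₁ → IsConjugator γ γ' z₂ →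
        tauXSummand (boundaryCotangentAction (𝓡 m) ι) γ μ θ γ' z₁ =
          tauXSummand (boundaryCotangentAction (𝓡 m) ι) γ μ θ γ' z₂) ∧
    -- for any choice `z` of conjugating elements
    (∀ z : Γ → IsometryGroup g, (∀ γ' : Γ, IsConj γ γ' → IsConjugator γ γ' (z γ')) →
      -- the functionals are well defined
      (∀ (k : ℕ)
          (θ : Γ → DiffForm ((𝓡∂ (m + 1)).prod 𝓘(ℝ, EuclideanSpace ℝ (Fin (m + 1)) →L[ℝ] ℝ))
          (CotangentBundle (𝓡∂ (m + 1)) M) k), IsCrossedForm S θ →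
        TauConverges cotangentAction γ μ z θ) ∧
      (∀ (k : ℕ) (θ : Γ → BoundaryForm ((𝓡 m).prod 𝓘(ℝ, EuclideanSpace ℝ (Fin m) →L[ℝ] ℝ))
          (CotangentBundle (𝓡 m) X) k), IsCrossedBoundaryForm S θ →
        TauXConverges (boundaryCotangentAction (𝓡 m) ι) γ μ z θ) ∧
      -- the functional on the forms on `T^*M` is a graded trace
      (∀ (k l : ℕ)
          (ω₁ : Γ → DiffForm ((𝓡∂ (m + 1)).prod 𝓘(ℝ, EuclideanSpace ℝ (Fin (m + 1)) →L[ℝ] ℝ))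
            (CotangentBundle (𝓡∂ (m + 1)) M) k)
          (ω₂ : Γ → DiffForm ((𝓡∂ (m + 1)).prod 𝓘(ℝ, EuclideanSpace ℝ (Fin (m + 1)) →L[ℝ] ℝ))
            (CotangentBundle (𝓡∂ (m + 1)) M) l),
        IsCrossedForm S ω₁ → IsCrossedForm S ω₂ →
          (∀ (γ₀ : Γ) (p : CotangentBundle (𝓡∂ (m + 1)) M), Summable fun γ₁ : Γ =>
            wedge (ω₁ γ₁ p)
              ((ω₂ (γ₁⁻¹ * γ₀)).pullback (cotangentAction ((γ₁⁻¹ : Γ) : IsometryGroup g)) p)) ∧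
          TauConverges cotangentAction γ μ z (crossedMul cotangentAction ω₁ ω₂) ∧
          ∀ p v, tau cotangentAction γ μ z (crossedMul cotangentAction ω₁ ω₂) p v =
            (-1) ^ (k * l) * tau cotangentAction γ μ z (crossedMul cotangentAction ω₂ ω₁) p
              (v ∘ Fin.cast (add_comm l k))) ∧
      -- the functional on the forms on `T^*X` commutes with the exterior differential
      (∀ (k : ℕ) (θ : Γ → BoundaryForm ((𝓡 m).prod 𝓘(ℝ, EuclideanSpace ℝ (Fin m) →L[ℝ] ℝ))
          (CotangentBundle (𝓡 m) X) k), IsCrossedBoundaryForm S θ →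
        TauXConverges (boundaryCotangentAction (𝓡 m) ι) γ μ z (fun γ₀ => (θ γ₀).extD) ∧
        (tauX (boundaryCotangentAction (𝓡 m) ι) γ μ z θ).HasExtD
          (tauX (boundaryCotangentAction (𝓡 m) ι) γ μ z (fun γ₀ => (θ γ₀).extD)))) := by
  have hact := isSmoothAction_cotangentAction (g := g)
  have hactX := isSmoothAction_boundaryCotangentAction (g := g) hι hX
  refine ⟨fun k θ _ γ' z₁ z₂ h₁ h₂ => tauSummand_eq hact θ γ' h₁ h₂,
    fun k θ hθ γ' z₁ z₂ h₁ h₂ => ?_, fun z hz => ⟨fun k θ hθ =>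
      hθ.isRapidlyDecreasing.tauConverges hact hΓ z, fun k θ hθ => ?_,
      fun k l ω₁ ω₂ h₁ h₂ => ⟨fun γ₀ p => summable_modelForm_wedge hact h₁.isRapidlyDecreasing
        h₂.isRapidlyDecreasing hΓ γ₀ p, (tau_crossedMul hact h₁.isRapidlyDecreasing
        h₂.isRapidlyDecreasing hΓ z).1, tau_crossedMul_comm hact h₁.isRapidlyDecreasing
        h₂.isRapidlyDecreasing hΓ hz⟩, fun k θ hθ => ?_⟩⟩
  · obtain ⟨σ, -, hσ, -⟩ := hθ.exists_trace
    rw [tauXSummand_eq_tauSummand hσ]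
    exact tauSummand_eq hactX σ γ' h₁ h₂
  · obtain ⟨σ, hr, hσ, -⟩ := hθ.exists_trace
    exact (tauXConverges_iff hσ z).2 (hr.tauConverges hactX hΓ z)
  · obtain ⟨σ, hr, hσ, hσ'⟩ := hθ.exists_trace
    obtain ⟨r, hsum⟩ := hΓ.exists_summable
    rw [tauXConverges_iff hσ' z, tauX_eq_tau hσ, tauX_eq_tau hσ']
    exact ⟨hr.extD.tauConverges hactX hΓ z, hasExtD_tau hsum hΓ.tendsto_wordLength hactX hr⟩
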